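/- Let $d\ge 1$, let $(X_n)_{n\ge1}$ be random vectors in $\mathbb{R}^d$, $S_0=0$, $S_n=X_1+\dots+X_n$ and $\mathcal F_n=\sigma(X_1,\dots,X_n)$. Assume that $\mathbb E[X_1]=0$, that $\sup_{n\ge1}\mathbb E\|X_n\|^p<\infty$ for some $p>2$, and that for every $n\ge 1$ $$\mathbb E[X_{n+1}\mid\mathcal F_n]=\frac1n AS_n,\qquad \mathbb E[X_{n+1}X_{n+1}^\top\mid\mathcal F_n]=\Sigma+\mathcal E_n ,$$ where $\Sigma\in\mathbb R^{d\times d}$ is (symmetric) positive definite, $\mathcal E_n$ is an $\mathcal F_n$-measurable random matrix with $\mathbb E\|\mathcal E_n\|\to0$, and $A\in\mathbb R^{d\times d}$ satisfies $\lambda_{\min}(A)>0$ and $\lambda_{\max}(A)<1$; here $\lambda_{\min}$ and $\lambda_{\max}$ denote the smallest and largest real parts of the complex eigenvalues. Write $n^{B}=\exp((\log n)B)$. (a) Subcritical case. If $\lambda_{\max}(A)<1/2$, then the Lyapunov equation $$\left(\tfrac12 I_d-A\right)\Xi+\Xi\left(\tfrac12 I_d-A^\top\right)=\Sigma$$ has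 a unique solution $\Xi$, which is positive semidefinite, and $S_n/\sqrt n$ converges in distribution to $\mathcal N(0,\Xi)$. (b) Supercritical case. If $\lambda_{\min}(A)>1/2$, then the same Lyapunov equation has a unique solution $\Xi$, the matrix $-\Xi$ is positive semidefinite, and there is a square-integrable random vector $W$ in $\mathbb R^d$, non-degenerate in the sense that its covariance matrix is positive definite, such that $n^{-A}S_n\to W$ almost surely and in $L^2$. Furthermore $(S_n-n^{A}W)/\sqrt n$ converges in distribution to $\mathcal N(0,-\Xi)$. (c) Critical case. Suppose that $A=Q(\lambda I_d+N)Q^{-1}$ with $Q\in\mathbb C^{d\times d}$ invertible, $\lambda\in\mathbb C$, $\operatorname{Re}\lambda=1/2$, and $N$ the nilpotent matrix with ones on the superdiagonal and zeros elsewhere. For $n\ge 2$ put $$D_n=Q\operatorname{diag}\big((\log n)^{d-\frac12},\dots,(\log n)^{\frac32},(\log n)^{\frac12}\big)Q^{-1},$$ and for $1\le i,j\le d$ $$\mathcal V_{i,j}=\frac{(-1)^{i+j}}{(d-i)!\,(d-j)!\,(2d-i-j+1)}\,\big(Q^{-1}\Sigma(Q^{-1})^*\big)_{d,d}.$$ If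 $Q$ is real, then $Q\mathcal VQ^*$ is positive semidefinite and $D_n^{-1}n^{-A}S_n$ converges in distribution to $\mathcal N(0,Q\mathcal VQ^*)$ on $\mathbb R^d$. For general complex $Q$, $D_n^{-1}n^{-A}S_n$ converges in distribution to a centred complex Gaussian vector $Z$ in $\mathbb C^d$ (that is, $(\operatorname{Re}Z,\operatorname{Im}Z)$ is a Gaussian vector in $\mathbb R^{2d}$) with $\mathbb E[ZZ^*]=Q\mathcal VQ^*$ and $\mathbb E[ZZ^\top]=Q\mathcal V'Q^\top$, where $\mathcal V'$ is given by the formula for $\mathcal V$ with $(Q^{-1}\Sigma(Q^{-1})^\top)_{d,d}$ in place of $(Q^{-1}\Sigma(Q^{-1})^*)_{d,d}$. -/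

import Mathlib

open MeasureTheory ProbabilityTheory Filter Topology
open scoped ENNReal Matrix

namespace RWSD

noncomputable section

/-- Largest real part of the (complex) eigenvalues of a real square matrix. -/
def lambdaMax {d : ℕ} (A : Matrix (Fin d) (Fin d) ℝ) : ℝ :=
  sSup (Complex.re '' spectrum ℂ (A.map Complex.ofReal))

/-- Smallest real part of the (complex) eigenvalues of a real square matrix. -/
def lambdaMin {d : ℕ} (A : Matrix (Fin d) (Fin d) ℝ) : ℝ :=
  sInf (Complex.re '' spectrum ℂ (A.map Complex.ofReal))

/-- The matrix power `n ^ B = exp (log n • B)`. -/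
def matPow {d : ℕ} (n : ℕ) (B : Matrix (Fin d) (Fin d) ℝ) : Matrix (Fin d) (Fin d) ℝ :=
  NormedSpace.exp (Real.log n • B)

/-- A matrix acting on column vectors of the Euclidean (or Hermitian) space. -/
def act {𝕜 : Type*} [RCLike 𝕜] {d : ℕ} (B : Matrix (Fin d) (Fin d) 𝕜)
    (x : EuclideanSpace 𝕜 (Fin d)) : EuclideanSpace 𝕜 (Fin d) :=
  Matrix.toEuclideanCLM (𝕜 := 𝕜) B x

/-- A real vector regarded as a complex one. -/
def complexify {d : ℕ} (x : EuclideanSpace ℝ (Fin d)) : EuclideanSpace ℂ (Fin d) :=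
  WithLp.toLp 2 fun i => (x i : ℂ)

/-- The walk `S n = X 1 + ⋯ + X n`, with `S 0 = 0` (the value `X 0` is never used). -/
def walk {Ω : Type*} {d : ℕ} (X : ℕ → Ω → EuclideanSpace ℝ (Fin d)) (n : ℕ) (ω : Ω) :
    EuclideanSpace ℝ (Fin d) :=
  ∑ k ∈ Finset.Icc 1 n, X k ω

/-- The sigma-algebra `F n` generated by `X 1, …, X n`. -/
abbrev past {Ω : Type*} {d : ℕ} (X : ℕ → Ω → EuclideanSpace ℝ (Fin d)) (n : ℕ) :
    MeasurableSpace Ω :=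
  ⨆ k ∈ Finset.Icc 1 n, MeasurableSpace.comap (X k) inferInstance

/-- The increments `X 1, X 2, …` form a random walk with linear spatio-temporal drift `A s / n`:
`E[X 1] = 0`, moments of some order `p > 2` are bounded, `E[X (n+1) | F n] = A (S n) / n` and
`E[X (n+1) X (n+1)ᵀ | F n] = Sig + err n` for `n ≥ 1`, with `err n` measurable with respect to
`F n` and `E ‖err n‖ → 0` (operator norm). -/
structure IsLinearRWSD {Ω : Type*} [MeasurableSpace Ω] {d : ℕ} (P : Measure Ω)
    (X : ℕ → Ω → EuclideanSpace ℝ (Fin d)) (A Sig : Matrix (Fin d) (Fin d) ℝ) : Prop where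
  measurable : ∀ n, 1 ≤ n → Measurable (X n)
  mean_one : ∫ ω, X 1 ω ∂P = 0
  moment : ∃ p : ℝ, 2 < p ∧ (⨆ (n : ℕ) (_ : 1 ≤ n), ∫⁻ ω, ‖X n ω‖ₑ ^ p ∂P) < ∞
  lambdaMin_pos : 0 < lambdaMin A
  lambdaMax_lt_one : lambdaMax A < 1
  posDef : Sig.PosDef
  drift : ∀ n, 1 ≤ n →
    P[X (n + 1) | past X n] =ᵐ[P] fun ω => (1 / (n : ℝ)) • act A (walk X n ω)
  second_moment : ∃ err : ℕ → Ω → Matrix (Fin d) (Fin d) ℝ,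
    (∀ n, 1 ≤ n → ∀ i j, Measurable[past X n] fun ω => err n ω i j) ∧
    (∀ n, 1 ≤ n → ∀ i j,
      P[fun ω => X (n + 1) ω i * X (n + 1) ω j | past X n] =ᵐ[P]
        fun ω => Sig i j + err n ω i j) ∧
    Tendsto (fun n => ∫⁻ ω, ‖Matrix.toEuclideanCLM (𝕜 := ℝ) (err n ω)‖ₑ ∂P) atTop (𝓝 0)

/-- The Lyapunov equation `(I/2 - A) Ξ + Ξ (I/2 - Aᵀ) = Sig`. -/
def IsLyapunovSolution {d : ℕ} (A Sig Xi : Matrix (Fin d) (Fin d) ℝ) : Prop :=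
  ((1 / 2 : ℝ) • 1 - A) * Xi + Xi * ((1 / 2 : ℝ) • 1 - Aᵀ) = Sig

/-- The random variables `Y n` on `(Ω, P)` converge in distribution to the law `ν`. -/
def ConvergesInLaw {Ω E : Type*} [MeasurableSpace Ω] [TopologicalSpace E] [MeasurableSpace E]
    [OpensMeasurableSpace E] (P : Measure Ω) [IsProbabilityMeasure P] (Y : ℕ → Ω → E)
    (ν : Measure E) [IsProbabilityMeasure ν] : Prop :=
  TendstoInDistribution Y atTop (id : E → E) (fun _ => P) ν

/-- A square integrable random vector is non-degenerate if its covariance matrix is positive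
definite (equivalently, it lies almost surely in no proper affine subspace). -/
def Nondegenerate {Ω : Type*} [MeasurableSpace Ω] {d : ℕ} (P : Measure Ω)
    (W : Ω → EuclideanSpace ℝ (Fin d)) : Prop :=
  (Matrix.of fun i j : Fin d => cov[fun ω => W ω i, fun ω => W ω j; P]).PosDef

/-- The nilpotent matrix with ones on the superdiagonal and zeros elsewhere. -/
def superdiag (d : ℕ) : Matrix (Fin d) (Fin d) ℂ :=
  Matrix.of fun i j => if (i : ℕ) + 1 = (j : ℕ) then 1 else 0

/-- `D n = Q diag((log n)^(d - 1/2), …, (log n)^(3/2), (log n)^(1/2)) Q⁻¹`. -/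
def logScale {𝕜 : Type*} [RCLike 𝕜] {d : ℕ} (Q : Matrix (Fin d) (Fin d) 𝕜) (n : ℕ) :
    Matrix (Fin d) (Fin d) 𝕜 :=
  Q * Matrix.diagonal (fun i : Fin d =>
    ((Real.log n ^ ((d : ℝ) - 1 / 2 - (i : ℕ)) : ℝ) : 𝕜)) * Q⁻¹

/-- The matrix with entries `(-1)^(i+j) / ((d-i)! (d-j)! (2d-i-j+1)) * s`, `1 ≤ i, j ≤ d`
(an index `i : Fin d` stands for the row `i + 1`). -/
def critMatrix {𝕜 : Type*} [RCLike 𝕜] (d : ℕ) (s : 𝕜) : Matrix (Fin d) (Fin d) 𝕜 :=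
  Matrix.of fun i j =>
    (-1) ^ ((i : ℕ) + 1 + ((j : ℕ) + 1)) /
      (((d - ((i : ℕ) + 1)).factorial : 𝕜) * ((d - ((j : ℕ) + 1)).factorial : 𝕜) *
        (2 * (d : 𝕜) - ((i : ℕ) + 1) - ((j : ℕ) + 1) + 1)) * s

/-- The last diagonal entry, in position `(d, d)`. -/
def lastEntry {𝕜 : Type*} {d : ℕ} (hd : 0 < d) (M : Matrix (Fin d) (Fin d) 𝕜) : 𝕜 :=
  M ⟨d - 1, Nat.sub_lt hd one_pos⟩ ⟨d - 1, Nat.sub_lt hd one_pos⟩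

/-- `ν` is the law of a centred complex Gaussian vector `Z` with covariance matrix
`E[Z Z*] = Γ` and relation matrix `E[Z Zᵀ] = C`: for each `w`, the real variable `Re (w* Z)` is
centred Gaussian with variance `(E|w* Z|² + Re E[(w* Z)²]) / 2`. These laws determine `ν`. -/
def IsComplexGaussian {d : ℕ} (ν : Measure (EuclideanSpace ℂ (Fin d)))
    (Γ C : Matrix (Fin d) (Fin d) ℂ) : Prop :=
  ∀ w : Fin d → ℂ, ∃ v : NNReal,
    (v : ℝ) = ((star w ⬝ᵥ Γ *ᵥ w).re + (star w ⬝ᵥ C *ᵥ star w).re) / 2 ∧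
    ν.map (fun z => (∑ i, star (w i) * z i).re) = gaussianReal 0 v

end

end RWSD

/-! The walk is a linear recursion driven by martingale noise. With e_n = X_{n+1} - A S_n / n one
has S_{n+1} = (1 + A/n) S_n + e_n, so variation of constants (`walk_eq_sum`) gives S_n = ∑_{k<n}
Φ(n,k+1) e_k, where Φ(n,k) = (1 + A/(n-1)) ⋯ (1 + A/k). Since log(n+1) - log n = 1/n + O(1/n²),
these products behave like powers: n^{-A} Φ(n,1) converges to an invertible matrix with error O(1/n)
(`exists_normProp_limit`). Hence Φ(n,k) is comparable to (n/k)^A (`transition_eq`), whose size is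
governed by the real parts of the eigenvalues of A (`exists_norm_flow_le`,
`exists_norm_flow_neg_le`).

All convergence in law comes from one central limit theorem, `IsMartingaleNoise.convergesInLaw`, for
deterministic linear combinations of the e_k with uniformly small coefficients. Because λ_max < 1,
the drift A S_n / n vanishes in L², so the conditional covariances of the noise tend to Σ in mean.
Each summand then multiplies the characteristic function by nearly exp(-q/2), with q the quadratic
form of Σ, and only the limit of the total variance remains to be computed.

In (a) and (b) the solution Ξ of the Lyapunov equation makes that variance telescope
(`gramSum_Ico`): over k < n it is nΞ + o(n), and over k ≥ n it is -nΞ + O(1). The same limits for Σ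
= 0 show that the equation is uniquely solvable, and they transfer positivity to Ξ or -Ξ. In (b),
n^{-A} S_n = V_n Z_n with V_n → I and Z_n an L²-bounded martingale; its limit is W, and S_n - n^A W
is, up to a small remainder, minus the noise sum over the indices k ≥ n.

In (c) the trace of A is real, which forces λ = 1/2. Up to a remainder bounded in L², n^{-A} S_n is
∑ (k+1)^{-A} e_k, whose coefficients in the Jordan basis are k^{-1/2} (-log k)^m / m!. Since ∑_{k≤n}
(log k)^m / k ~ (log n)^{m+1}/(m+1), rescaling by D_n leaves in the limit only the last column of
the kernel, hence only the last diagonal entry of the transformed Σ. The limit law is constructed as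
a linear image of a real Gaussian family; for real Q one takes real parts. -/

namespace RWSD

noncomputable section

set_option linter.unusedSectionVars false

/-! ### Products of the factors 1 + a/n compared with powers n^a in a Banach algebra. -/

section Propagator

open NormedSpace Asymptotics

variable {𝔸 : Type*} [NormedRing 𝔸] [NormedAlgebra ℝ 𝔸]

/-- The one-parameter group generated by `a`. -/
def flow (a : 𝔸) (t : ℝ) : 𝔸 := NormedSpace.exp (t • a)

/-- The products `(1 + a / (n - 1)) ⋯ (1 + a / 1)`. -/
def propagator (a : 𝔸) : ℕ → 𝔸
  | 0 => 1
  | n + 1 => (1 + (1 / (n : ℝ)) • a) * propagator a n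

lemma commute_propagator (a : 𝔸) (n : ℕ) : Commute a (propagator a n) := by
  induction n with
  | zero => exact Commute.one_right a
  | succ n ih =>
    exact (((Commute.one_right a).add_right ((Commute.refl a).smul_right _))).mul_right ih

/-- Division by zero makes the factor of index 0 equal to 1, so the product effectively begins with
1 + a/1. -/
lemma propagator_one (a : 𝔸) : propagator a 1 = 1 := by
  simp [propagator]

lemma isUnit_propagator {a : 𝔸} (ha : ∀ n : ℕ, IsUnit (1 + (1 / (n : ℝ)) • a)) (n : ℕ) :
    IsUnit (propagator a n) := by
  induction n with
  | zero => exact isUnit_one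
  | succ n ih => exact (ha n).mul ih

lemma flow_zero (a : 𝔸) : flow a 0 = 1 := by
  simp [flow]

lemma commute_flow (a : 𝔸) (t : ℝ) {b : 𝔸} (h : Commute a b) : Commute (flow a t) b :=
  (h.smul_left t).exp_left

variable [CompleteSpace 𝔸]

lemma flow_add (a : 𝔸) (s t : ℝ) : flow a (s + t) = flow a s * flow a t := by
  let := NormedAlgebra.restrictScalars ℚ ℝ 𝔸
  rw [flow, flow, flow, add_smul]
  exact exp_add_of_commute (((Commute.refl a).smul_left s).smul_right t)

lemma flow_mul_flow_neg (a : 𝔸) (t : ℝ) : flow a t * flow a (-t) = 1 := by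
  rw [← flow_add, add_neg_cancel, flow_zero]

lemma flow_neg_mul_flow (a : 𝔸) (t : ℝ) : flow a (-t) * flow a t = 1 := by
  rw [← flow_add, neg_add_cancel, flow_zero]

lemma flow_isBigO_nhds_zero (a : 𝔸) :
    (fun t : ℝ => flow a t - 1 - t • a) =O[𝓝 0] fun t => t ^ 2 := by
  have h := (exp_hasFPowerSeriesAt_zero (𝕂 := ℝ) (𝔸 := 𝔸)).isBigO_sub_partialSum_pow 2
  have ht : Tendsto (fun t : ℝ => t • a) (𝓝 0) (𝓝 0) := by
    have : Continuous fun t : ℝ => t • a := by fun_prop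
    simpa using this.tendsto 0
  have h2 := h.comp_tendsto ht
  have h3 : (fun t : ℝ => flow a t - 1 - t • a) =O[𝓝 0] fun t : ℝ => ‖t • a‖ ^ 2 :=
    h2.congr_left fun t => by
      simp [FormalMultilinearSeries.partialSum, Finset.sum_range_succ, expSeries_apply_eq, flow,
        sub_sub]
  refine h3.trans (IsBigO.of_bound (‖a‖ ^ 2) (Eventually.of_forall fun t => ?_))
  simp only [norm_pow, norm_smul, norm_norm, norm_mul]
  rw [mul_pow, mul_comm]

lemma abs_log_succ_sub_log_sub_le {n : ℕ} (hn : 1 ≤ n) :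
    |Real.log ((n + 1 : ℕ) : ℝ) - Real.log n - 1 / n| ≤ 1 / (n : ℝ) ^ 2 := by
  have h0 : (0 : ℝ) < n := by exact_mod_cast hn
  have hlog : Real.log ((n + 1 : ℕ) : ℝ) - Real.log n = Real.log (((n : ℝ) + 1) / n) := by
    push_cast
    rw [Real.log_div (by positivity) (by positivity)]
  have h1 := Real.one_sub_inv_le_log_of_pos (show 0 < ((n : ℝ) + 1) / n by positivity)
  have h2 := Real.log_le_sub_one_of_pos (show 0 < ((n : ℝ) + 1) / n by positivity)
  have e1 : 1 - (((n : ℝ) + 1) / n)⁻¹ = 1 / (n + 1) := by field_simp; ring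
  have e2 : ((n : ℝ) + 1) / n - 1 = 1 / n := by field_simp; ring
  have e3 : 1 / (n : ℝ) - 1 / (n + 1) ≤ 1 / (n : ℝ) ^ 2 := by
    rw [div_sub_div _ _ (by positivity) (by positivity), div_le_div_iff₀ (by positivity)
      (by positivity)]
    nlinarith
  have e4 : 0 ≤ 1 / (n : ℝ) ^ 2 := by positivity
  rw [hlog, abs_le]
  constructor <;> linarith

/-- The error of one step of the normalised propagator. -/
def stepError (a : 𝔸) (n : ℕ) : 𝔸 :=
  flow a (-(Real.log ((n + 1 : ℕ) : ℝ) - Real.log n)) * (1 + (1 / (n : ℝ)) • a) - 1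

/-- With s = log(n+1) - log n = 1/n + O(1/n²), the first-order terms -s a and a/n of exp(-s a)(1 +
a/n) cancel up to O(1/n²), and all else is quadratic in 1/n. -/
lemma stepError_isBigO (a : 𝔸) :
    (stepError a) =O[atTop] fun n : ℕ => 1 / (n : ℝ) ^ 2 := by
  set s : ℕ → ℝ := fun n => Real.log ((n + 1 : ℕ) : ℝ) - Real.log n with hs
  have hinv : (fun n : ℕ => 1 / (n : ℝ)) =O[atTop] fun n : ℕ => 1 / (n : ℝ) := isBigO_refl _ _
  have h1 : (fun n => s n - 1 / n) =O[atTop] fun n : ℕ => 1 / (n : ℝ) ^ 2 := by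
    refine IsBigO.of_bound 1 ?_
    filter_upwards [eventually_ge_atTop 1] with n hn
    have := abs_log_succ_sub_log_sub_le hn
    rw [Real.norm_eq_abs, one_mul, Real.norm_eq_abs, abs_of_nonneg (by positivity :
      0 ≤ 1 / (n : ℝ) ^ 2)]
    exact this
  have hsq : (fun n : ℕ => 1 / (n : ℝ) ^ 2) =O[atTop] fun n : ℕ => 1 / (n : ℝ) := by
    refine IsBigO.of_bound 1 ?_
    filter_upwards [eventually_ge_atTop 1] with n hn
    have h0 : (1 : ℝ) ≤ n := by exact_mod_cast hn
    rw [one_mul, Real.norm_of_nonneg (by positivity), Real.norm_of_nonneg (by positivity)]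
    exact one_div_le_one_div_of_le (by positivity) (by nlinarith)
  have h2 : s =O[atTop] fun n : ℕ => 1 / (n : ℝ) := by
    simpa using (h1.trans hsq).add hinv
  have hlim : Tendsto (fun n => -s n) atTop (𝓝 0) := by
    have : Tendsto s atTop (𝓝 0) := h2.trans_tendsto tendsto_one_div_atTop_nhds_zero_nat
    simpa using this.neg
  have h3 : (fun n => flow a (-s n) - 1 - (-s n) • a) =O[atTop] fun n : ℕ => 1 / (n : ℝ) ^ 2 := by
    refine ((flow_isBigO_nhds_zero a).comp_tendsto hlim).trans ?_
    have := h2.neg_left.pow 2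
    simpa [Function.comp_def] using this
  have h4 : (fun n : ℕ => 1 + (1 / (n : ℝ)) • a) =O[atTop] fun _ : ℕ => (1 : ℝ) := by
    have : Tendsto (fun n : ℕ => 1 + (1 / (n : ℝ)) • a) atTop (𝓝 (1 + (0 : ℝ) • a)) :=
      (tendsto_one_div_atTop_nhds_zero_nat.smul_const a).const_add 1
    exact this.isBigO_one ℝ
  have h5 : (fun n : ℕ => (s n - 1 / n) • a) =O[atTop] fun n : ℕ => 1 / (n : ℝ) ^ 2 := by
    refine (h1.smul (isBigO_refl (fun _ : ℕ => a) atTop)).trans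
      (IsBigO.of_bound ‖a‖ (Eventually.of_forall fun n => ?_))
    rw [norm_smul, mul_comm]
  have h6 : (fun n : ℕ => (s n * (1 / n)) • (a * a)) =O[atTop] fun n : ℕ => 1 / (n : ℝ) ^ 2 := by
    have := (h2.mul hinv).smul (isBigO_refl (fun _ : ℕ => a * a) atTop)
    refine this.trans (IsBigO.of_bound ‖a * a‖ (Eventually.of_forall fun n => ?_))
    simp [norm_smul, mul_comm, sq]
  -- An exact splitting into the Taylor remainder of the exponential, the defect s - 1/n, and the
  -- product of the two linear terms.
  have key : stepError a = fun n : ℕ =>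
      (flow a (-s n) - 1 - (-s n) • a) * (1 + (1 / (n : ℝ)) • a) - (s n - 1 / n) • a
        - (s n * (1 / n)) • (a * a) := by
    funext n
    simp only [stepError, hs]
    simp only [mul_add, sub_mul, smul_mul_assoc, mul_smul_comm, one_mul, mul_one]
    module
  rw [key]
  have h7 := h3.mul h4
  simp only [mul_one] at h7
  exact (h7.sub h5).sub h6

lemma exists_limit_of_norm_sub_le {E : Type*} [NormedAddCommGroup E] [CompleteSpace E]
    {u : ℕ → E} {K : ℝ} (h : ∀ n : ℕ, 1 ≤ n → ‖u (n + 1) - u n‖ ≤ K / (n : ℝ) ^ 2) :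
    ∃ l, ∀ n : ℕ, 1 ≤ n → ‖u n - l‖ ≤ 2 * K / n := by
  have hK : 0 ≤ K := by simpa using (norm_nonneg _).trans (h 1 le_rfl)
  have step : ∀ n : ℕ, 1 ≤ n → ∀ m, n ≤ m → ‖u m - u n‖ ≤ 2 * K / n - 2 * K / m := by
    intro n hn m hm
    induction m, hm using Nat.le_induction with
    | base => simp
    | succ m hm ih =>
      have h0 : (1 : ℝ) ≤ m := by exact_mod_cast hn.trans hm
      -- 1/m² ≤ 2/(m(m+1)) turns the bound into a telescoping one; the factor 2 in the conclusion
      -- comes from here.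
      have h1 : K / (m : ℝ) ^ 2 ≤ 2 * K / m - 2 * K / ((m + 1 : ℕ) : ℝ) := by
        have : 2 * K / m - 2 * K / ((m + 1 : ℕ) : ℝ) = K * (2 / (m * (m + 1))) := by
          push_cast; field_simp; ring
        rw [this, div_eq_mul_inv]
        refine mul_le_mul_of_nonneg_left ?_ hK
        rw [inv_eq_one_div, div_le_div_iff₀ (by positivity) (by positivity)]
        nlinarith
      calc ‖u (m + 1) - u n‖ ≤ ‖u (m + 1) - u m‖ + ‖u m - u n‖ := norm_sub_le_norm_sub_add_norm_sub ..
        _ ≤ K / (m : ℝ) ^ 2 + (2 * K / n - 2 * K / m) := add_le_add (h m (hn.trans hm)) ih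
        _ ≤ _ := by linarith
  have step' : ∀ n : ℕ, 1 ≤ n → ∀ m, n ≤ m → ‖u m - u n‖ ≤ 2 * K / n := fun n hn m hm =>
    (step n hn m hm).trans (sub_le_self _ (by positivity))
  have hc : CauchySeq u := by
    rw [Metric.cauchySeq_iff']
    intro ε hε
    obtain ⟨N, hN⟩ := exists_nat_gt (2 * K / ε)
    refine ⟨N + 1, fun n hn => ?_⟩
    rw [dist_eq_norm]
    refine (step' (N + 1) (by lia) n hn).trans_lt ?_
    push_cast
    rw [div_lt_iff₀ (by positivity)]
    rw [div_lt_iff₀ hε] at hN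
    nlinarith
  obtain ⟨l, hl⟩ := cauchySeq_tendsto_of_complete hc
  refine ⟨l, fun n hn => ?_⟩
  rw [norm_sub_rev]
  exact le_of_tendsto ((hl.sub_const (u n)).norm) (eventually_atTop.2 ⟨n, fun m hm => step' n hn m hm⟩)

/-- ∏ (1 + C/k²) ≤ exp(∑ C/k²), and the exponent has the telescoping majorant 2C(1 - 1/n). -/
lemma exists_bound_of_norm_succ_le {v : ℕ → ℝ} (hv : ∀ n, 0 ≤ v n) {C : ℝ} (hC : 0 ≤ C)
    (h : ∀ n : ℕ, 1 ≤ n → v (n + 1) ≤ (1 + C / (n : ℝ) ^ 2) * v n) :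
    ∃ B, ∀ n : ℕ, 1 ≤ n → v n ≤ B := by
  have key : ∀ n : ℕ, 1 ≤ n → v n ≤ Real.exp (2 * C * (1 - 1 / n)) * v 1 := by
    intro n hn
    induction n, hn using Nat.le_induction with
    | base => simp
    | succ n hn ih =>
      have h0 : (1 : ℝ) ≤ n := by exact_mod_cast hn
      calc v (n + 1) ≤ (1 + C / (n : ℝ) ^ 2) * v n := h n hn
        _ ≤ Real.exp (C / (n : ℝ) ^ 2) * (Real.exp (2 * C * (1 - 1 / n)) * v 1) := by
          refine mul_le_mul ?_ ih (hv _) (Real.exp_pos _).le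
          linarith [Real.add_one_le_exp (C / (n : ℝ) ^ 2)]
        _ = Real.exp (C / (n : ℝ) ^ 2 + 2 * C * (1 - 1 / n)) * v 1 := by
          rw [Real.exp_add]; ring
        _ ≤ _ := by
          refine mul_le_mul_of_nonneg_right (Real.exp_le_exp.2 ?_) (hv 1)
          have : 2 * C * (1 - 1 / ((n + 1 : ℕ) : ℝ)) - 2 * C * (1 - 1 / n)
              = C * (2 / (n * (n + 1))) := by
            push_cast; field_simp; ring
          have h2 : C / (n : ℝ) ^ 2 ≤ C * (2 / (n * (n + 1))) := by
            rw [div_eq_mul_inv]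
            refine mul_le_mul_of_nonneg_left ?_ hC
            rw [inv_eq_one_div, div_le_div_iff₀ (by positivity) (by positivity)]
            nlinarith
          linarith
  refine ⟨Real.exp (2 * C) * v 1, fun n hn => (key n hn).trans ?_⟩
  refine mul_le_mul_of_nonneg_right (Real.exp_le_exp.2 ?_) (hv 1)
  have : 0 ≤ 1 / (n : ℝ) := by positivity
  nlinarith

omit [NormedAlgebra ℝ 𝔸] in
-- A product of factors 1 + O(1/n²) stays bounded, so its increments are O(1/n²), and the rate
-- O(1/n) is that of the tail of the series of increments.
lemma exists_limit_of_multiplicative {u r : ℕ → 𝔸} {C : ℝ}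
    (hu : ∀ n : ℕ, 1 ≤ n → u (n + 1) = (1 + r n) * u n)
    (hr : ∀ n : ℕ, 1 ≤ n → ‖r n‖ ≤ C / (n : ℝ) ^ 2) :
    ∃ l K, ∀ n : ℕ, 1 ≤ n → ‖u n - l‖ ≤ K / n := by
  have hC : 0 ≤ C := by simpa using (norm_nonneg _).trans (hr 1 le_rfl)
  obtain ⟨B, hB⟩ := exists_bound_of_norm_succ_le (v := fun n => ‖u n‖) (fun _ => norm_nonneg _) hC
    (by
      intro n hn
      rw [hu n hn, add_mul, one_mul, add_mul, one_mul]
      exact (norm_add_le _ _).trans (add_le_add le_rfl ((norm_mul_le _ _).trans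
        (mul_le_mul_of_nonneg_right (hr n hn) (norm_nonneg _)))))
  obtain ⟨l, hl⟩ := exists_limit_of_norm_sub_le (u := u) (K := C * B) (by
    intro n hn
    rw [hu n hn, add_mul, one_mul, add_sub_cancel_left]
    refine (norm_mul_le _ _).trans ?_
    rw [mul_div_right_comm]
    exact mul_le_mul (hr n hn) (hB n hn) (norm_nonneg _) (by positivity))
  exact ⟨l, 2 * (C * B), hl⟩

/-- The propagator normalised by the power `n ^ (-a)`. -/
def normProp (a : 𝔸) (n : ℕ) : 𝔸 := flow a (-Real.log n) * propagator a n

lemma normProp_succ (a : 𝔸) (n : ℕ) : normProp a (n + 1) = (1 + stepError a n) * normProp a n := by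
  have h : flow a (-Real.log ((n + 1 : ℕ) : ℝ)) =
      flow a (-(Real.log ((n + 1 : ℕ) : ℝ) - Real.log n)) * flow a (-Real.log n) := by
    rw [← flow_add]; congr 1; ring
  have hc : Commute (flow a (-Real.log n)) (1 + (1 / (n : ℝ)) • a) :=
    commute_flow _ _ ((Commute.one_right a).add_right ((Commute.refl a).smul_right _))
  rw [normProp, h, propagator, stepError, add_sub_cancel, normProp, mul_assoc, mul_assoc,
    ← mul_assoc (flow a (-Real.log n)), hc.eq, mul_assoc]

omit [NormedAlgebra ℝ 𝔸] in
-- (1 + r)⁻¹ - 1 = -(1 + r)⁻¹ r, and the inverse stays bounded because r tends to 0.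
lemma exists_inverse_sub_one_bound {r : ℕ → 𝔸} (hr : r =O[atTop] fun n : ℕ => 1 / (n : ℝ) ^ 2) :
    (fun n => Ring.inverse (1 + r n) - 1) =O[atTop] fun n : ℕ => 1 / (n : ℝ) ^ 2 := by
  have h0 : Tendsto (fun n : ℕ => 1 / (n : ℝ) ^ 2) atTop (𝓝 0) := by
    have := tendsto_one_div_atTop_nhds_zero_nat (𝕜 := ℝ)
    simpa using this.pow 2
  have hr0 : Tendsto r atTop (𝓝 0) := hr.trans_tendsto h0
  have hn0 : Tendsto (fun n => -r n) atTop (𝓝 0) := by simpa using hr0.neg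
  have h1 : (fun n => Ring.inverse (1 + r n)) =O[atTop] fun _ : ℕ => (1 : ℝ) := by
    have := (NormedRing.inverse_one_sub_norm (R := 𝔸)).comp_tendsto hn0
    simpa [Function.comp_def] using this
  have h2 := h1.mul hr
  simp only [one_mul] at h2
  refine (h2.neg_left).congr' ?_ EventuallyEq.rfl
  have hu : ∀ᶠ n in atTop, IsUnit (1 + r n) := by
    have : Tendsto (fun n => 1 + r n) atTop (𝓝 (1 + 0)) := hr0.const_add 1
    rw [add_zero] at this
    exact this.eventually (Units.nhds 1)
  filter_upwards [hu] with n hn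
  have := Ring.inverse_mul_cancel _ hn
  rw [mul_add, mul_one] at this
  rw [← eq_sub_iff_add_eq'] at this
  rw [this]; abel

omit [NormedAlgebra ℝ 𝔸] [CompleteSpace 𝔸] in
lemma bound_of_isBigO_inv_sq {r : ℕ → 𝔸} (hr : r =O[atTop] fun n : ℕ => 1 / (n : ℝ) ^ 2) :
    ∃ C, ∀ n : ℕ, 1 ≤ n → ‖r n‖ ≤ C / (n : ℝ) ^ 2 := by
  obtain ⟨C, -, hC⟩ := bound_of_isBigO_nat_atTop hr
  refine ⟨C, fun n hn => ?_⟩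
  have h0 : (0 : ℝ) < n := by exact_mod_cast hn
  have := hC (x := n) (by positivity)
  rw [Real.norm_of_nonneg (by positivity)] at this
  rwa [div_eq_mul_one_div]

/-- The propagator is asymptotic to `n ^ a` times an invertible constant. -/
theorem exists_normProp_limit {a : 𝔸} (ha : ∀ n : ℕ, IsUnit (1 + (1 / (n : ℝ)) • a)) :
    ∃ (G G' : 𝔸) (C : ℝ), G * G' = 1 ∧ G' * G = 1 ∧
      (∀ n : ℕ, 1 ≤ n → ‖normProp a n - G‖ ≤ C / n) ∧
      (∀ n : ℕ, 1 ≤ n → ‖normProp a n‖ ≤ C) ∧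
      (∀ n : ℕ, 1 ≤ n → ‖Ring.inverse (normProp a n)‖ ≤ C) := by
  obtain ⟨C, hC⟩ := bound_of_isBigO_inv_sq (stepError_isBigO a)
  obtain ⟨C', hC'⟩ := bound_of_isBigO_inv_sq (exists_inverse_sub_one_bound (stepError_isBigO a))
  have hflow : ∀ t, IsUnit (flow a t) := fun t =>
    ⟨⟨flow a t, flow a (-t), flow_mul_flow_neg a t, flow_neg_mul_flow a t⟩, rfl⟩
  have hH : ∀ n, IsUnit (normProp a n) := fun n => (hflow _).mul (isUnit_propagator ha n)
  have hr : ∀ n, IsUnit (1 + stepError a n) := fun n => by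
    rw [stepError, add_sub_cancel]; exact (hflow _).mul (ha n)
  have hac : ∀ n, Commute a (normProp a n) := fun n =>
    ((commute_flow a _ (Commute.refl a)).symm).mul_right (commute_propagator a n)
  have hcomm : ∀ n, Commute (1 + stepError a n) (normProp a n) := fun n => by
    rw [stepError, add_sub_cancel]
    exact (commute_flow a _ (hac n)).mul_left
      ((Commute.one_left _).add_left ((hac n).smul_left _))
  obtain ⟨G, K, hG⟩ := exists_limit_of_multiplicative (u := normProp a)
    (fun n _ => normProp_succ a n) hC
  -- The inverses obey a recursion of the same kind because all factors commute; their convergence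
  -- is what makes the limit `G` invertible.
  obtain ⟨G', K', hG'⟩ := exists_limit_of_multiplicative
    (u := fun n => Ring.inverse (normProp a n)) (r := fun n => Ring.inverse (1 + stepError a n) - 1)
    (fun n _ => by
      rw [add_sub_cancel, normProp_succ, (hcomm n).eq]
      exact Ring.mul_inverse_rev' ((hcomm n).symm)) hC'
  have tend : ∀ {u : ℕ → 𝔸} {l : 𝔸} {K : ℝ}, (∀ n : ℕ, 1 ≤ n → ‖u n - l‖ ≤ K / n) →
      Tendsto u atTop (𝓝 l) := by
    intro u l K h
    rw [tendsto_iff_norm_sub_tendsto_zero]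
    refine squeeze_zero' (Eventually.of_forall fun _ => norm_nonneg _)
      (eventually_atTop.2 ⟨1, h⟩) (tendsto_const_div_atTop_nhds_zero_nat K)
  have t1 := tend hG
  have t2 := tend hG'
  have bd : ∀ {u : ℕ → 𝔸} {l : 𝔸} {K : ℝ}, (∀ n : ℕ, 1 ≤ n → ‖u n - l‖ ≤ K / n) →
      ∀ n : ℕ, 1 ≤ n → ‖u n‖ ≤ |K| + ‖l‖ := by
    intro u l K h n hn
    have h1 : K / n ≤ |K| := by
      have : (1 : ℝ) ≤ n := by exact_mod_cast hn
      calc K / n ≤ |K| / n := by gcongr; exact le_abs_self K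
        _ ≤ |K| := div_le_self (abs_nonneg _) this
    calc ‖u n‖ = ‖(u n - l) + l‖ := by rw [sub_add_cancel]
      _ ≤ ‖u n - l‖ + ‖l‖ := norm_add_le _ _
      _ ≤ _ := by linarith [h n hn]
  refine ⟨G, G', max K (max (|K| + ‖G‖) (|K'| + ‖G'‖)), ?_, ?_, ?_, ?_, ?_⟩
  · refine tendsto_nhds_unique (t1.mul t2) ?_
    simp only [Ring.mul_inverse_cancel _ (hH _)]
    exact tendsto_const_nhds
  · refine tendsto_nhds_unique (t2.mul t1) ?_
    simp only [Ring.inverse_mul_cancel _ (hH _)]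
    exact tendsto_const_nhds
  · intro n hn
    exact (hG n hn).trans (by gcongr; exact le_max_left _ _)
  · intro n hn
    exact (bd hG n hn).trans ((le_max_left _ _).trans (le_max_right _ _))
  · intro n hn
    exact (bd hG' n hn).trans ((le_max_right _ _).trans (le_max_right _ _))

end Propagator

/-! ### Transition operators Φ(n,k) and their weighted covariance sums. -/

section Transition

variable {𝔸 : Type*} [NormedRing 𝔸] [NormedAlgebra ℝ 𝔸]

/-- The transition operators `(1 + a / (n - 1)) ⋯ (1 + a / k)` of the linear recursion. -/
def transition (a : 𝔸) (n k : ℕ) : 𝔸 := propagator a n * Ring.inverse (propagator a k)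

lemma transition_self {a : 𝔸} (ha : ∀ n : ℕ, IsUnit (1 + (1 / (n : ℝ)) • a)) (n : ℕ) :
    transition a n n = 1 :=
  Ring.mul_inverse_cancel _ (isUnit_propagator ha n)

lemma transition_succ_left (a : 𝔸) (n k : ℕ) :
    transition a (n + 1) k = (1 + (1 / (n : ℝ)) • a) * transition a n k := by
  rw [transition, propagator, mul_assoc, transition]

lemma transition_succ_right {a : 𝔸} (ha : ∀ n : ℕ, IsUnit (1 + (1 / (n : ℝ)) • a)) (n k : ℕ) :
    transition a n k = transition a n (k + 1) * (1 + (1 / (k : ℝ)) • a) := by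
  have h : Ring.inverse (propagator a (k + 1)) * (1 + (1 / (k : ℝ)) • a)
      = Ring.inverse (propagator a k) := by
    calc Ring.inverse (propagator a (k + 1)) * (1 + (1 / (k : ℝ)) • a)
        = Ring.inverse (propagator a (k + 1)) * ((1 + (1 / (k : ℝ)) • a) *
          (propagator a k * Ring.inverse (propagator a k))) := by
          rw [Ring.mul_inverse_cancel _ (isUnit_propagator ha k), mul_one]
      _ = Ring.inverse (propagator a (k + 1)) * propagator a (k + 1) *
          Ring.inverse (propagator a k) := by rw [propagator]; simp only [mul_assoc]
      _ = _ := by rw [Ring.inverse_mul_cancel _ (isUnit_propagator ha (k + 1)), one_mul]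
  rw [transition, transition, mul_assoc, h]

lemma transition_mul_propagator {a : 𝔸} (ha : ∀ n : ℕ, IsUnit (1 + (1 / (n : ℝ)) • a))
    (n k : ℕ) : transition a n k * propagator a k = propagator a n := by
  rw [transition, mul_assoc, Ring.inverse_mul_cancel _ (isUnit_propagator ha k), mul_one]

variable [CompleteSpace 𝔸]

lemma isUnit_flow (a : 𝔸) (t : ℝ) : IsUnit (flow a t) :=
  ⟨⟨flow a t, flow a (-t), flow_mul_flow_neg a t, flow_neg_mul_flow a t⟩, rfl⟩

/-- The precise form of Φ(n,k) ≈ (n/k)^a: the power sits between two corrections that are bounded by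
`exists_normProp_limit`. Bounds on the flow thereby become bounds on Φ. -/
lemma transition_eq (a : 𝔸) (n k : ℕ) :
    transition a n k =
      normProp a n * flow a (Real.log n - Real.log k) * Ring.inverse (normProp a k) := by
  have hc : Commute (flow a (-Real.log k)) (propagator a k) :=
    commute_flow _ _ (commute_propagator a k)
  have hcn : Commute (flow a (-Real.log n)) (propagator a n) :=
    commute_flow _ _ (commute_propagator a n)
  have h1 : Ring.inverse (normProp a k) = flow a (Real.log k) * Ring.inverse (propagator a k) := by
    have hf : Ring.inverse (flow a (-Real.log k)) = flow a (Real.log k) := by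
      have := flow_neg_mul_flow a (Real.log k)
      calc Ring.inverse (flow a (-Real.log k))
          = Ring.inverse (flow a (-Real.log k)) * (flow a (-Real.log k) * flow a (Real.log k)) := by
            rw [this, mul_one]
        _ = _ := by rw [← mul_assoc, Ring.inverse_mul_cancel _ (isUnit_flow a _), one_mul]
    rw [normProp, hc.eq, Ring.mul_inverse_rev' hc.symm, hf]
  rw [h1, normProp, hcn.eq, mul_assoc, ← mul_assoc (flow a _), ← mul_assoc,
    mul_assoc (propagator a n), ← mul_assoc (flow a _), ← flow_add, ← flow_add]
  have : -Real.log n + (Real.log n - Real.log k) + Real.log k = 0 := by ring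
  rw [this, flow_zero, mul_one, transition]

lemma exp_mul_log_sub_log {n k : ℕ} (hn : 1 ≤ n) (hk : 1 ≤ k) (α : ℝ) :
    Real.exp (α * (Real.log n - Real.log k)) = ((n : ℝ) / k) ^ α := by
  have h1 : (0 : ℝ) < n := by exact_mod_cast hn
  have h2 : (0 : ℝ) < k := by exact_mod_cast hk
  rw [Real.rpow_def_of_pos (by positivity), Real.log_div h1.ne' h2.ne', mul_comm]

lemma exists_norm_transition_le {a : 𝔸} (ha : ∀ n : ℕ, IsUnit (1 + (1 / (n : ℝ)) • a)) :
    ∃ C, 0 ≤ C ∧ ∀ n k : ℕ, 1 ≤ n → 1 ≤ k →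
      ‖transition a n k‖ ≤ C * ‖flow a (Real.log n - Real.log k)‖ := by
  obtain ⟨G, G', C, -, -, -, h1, h2⟩ := exists_normProp_limit ha
  have hC : 0 ≤ C := (norm_nonneg _).trans (h1 1 le_rfl)
  refine ⟨C * C, by positivity, fun n k hn hk => ?_⟩
  rw [transition_eq]
  calc _ ≤ ‖normProp a n‖ * ‖flow a (Real.log n - Real.log k)‖ *
        ‖Ring.inverse (normProp a k)‖ :=
        (norm_mul_le _ _).trans (mul_le_mul_of_nonneg_right (norm_mul_le _ _) (norm_nonneg _))
    _ ≤ C * ‖flow a (Real.log n - Real.log k)‖ * C := by gcongr; exacts [h1 n hn, h2 k hk]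
    _ = _ := by ring

lemma norm_transition_le {a : 𝔸} (ha : ∀ n : ℕ, IsUnit (1 + (1 / (n : ℝ)) • a)) {α K : ℝ}
    (hα : ∀ t, 0 ≤ t → ‖flow a t‖ ≤ K * Real.exp (α * t)) :
    ∃ C, 0 ≤ C ∧ ∀ n k : ℕ, 1 ≤ k → k ≤ n → ‖transition a n k‖ ≤ C * ((n : ℝ) / k) ^ α := by
  obtain ⟨C, hC, h⟩ := exists_norm_transition_le ha
  have hK : 0 ≤ K := by simpa using (norm_nonneg _).trans (hα 0 le_rfl)
  refine ⟨C * K, by positivity, fun n k hk hkn => (h n k (hk.trans hkn) hk).trans ?_⟩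
  rw [mul_assoc, ← exp_mul_log_sub_log (hk.trans hkn) hk]
  refine mul_le_mul_of_nonneg_left (hα _ (sub_nonneg.2 (Real.log_le_log ?_ ?_))) hC
  · exact_mod_cast hk
  · exact_mod_cast hkn

/-- For n ≤ k the operator Φ(n,k) runs the recursion backwards, so the flow at negative times
controls it. -/
lemma norm_transition_le' {a : 𝔸} (ha : ∀ n : ℕ, IsUnit (1 + (1 / (n : ℝ)) • a)) {β K : ℝ}
    (hβ : ∀ t, 0 ≤ t → ‖flow a (-t)‖ ≤ K * Real.exp (-β * t)) :
    ∃ C, 0 ≤ C ∧ ∀ n k : ℕ, 1 ≤ n → n ≤ k → ‖transition a n k‖ ≤ C * ((n : ℝ) / k) ^ β := by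
  obtain ⟨C, hC, h⟩ := exists_norm_transition_le ha
  have hK : 0 ≤ K := by simpa using (norm_nonneg _).trans (hβ 0 le_rfl)
  refine ⟨C * K, by positivity, fun n k hn hnk => (h n k hn (hn.trans hnk)).trans ?_⟩
  rw [mul_assoc, ← exp_mul_log_sub_log hn (hn.trans hnk)]
  refine mul_le_mul_of_nonneg_left ?_ hC
  have := hβ (Real.log k - Real.log n) (sub_nonneg.2 (Real.log_le_log ?_ ?_))
  · rw [neg_sub] at this
    refine this.trans (le_of_eq ?_)
    congr 2; ring
  · exact_mod_cast hn
  · exact_mod_cast hnk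

variable [StarRing 𝔸] [StarModule ℝ 𝔸] [NormedStarGroup 𝔸]

/-- The weighted sums `∑ Φ(n, k+1) σ Φ(n, k+1)*`. -/
def gramSum (a σ : 𝔸) (n : ℕ) (s : Finset ℕ) : 𝔸 :=
  ∑ k ∈ s, transition a n (k + 1) * σ * star (transition a n (k + 1))

omit [CompleteSpace 𝔸] [NormedStarGroup 𝔸] in
-- A discrete Lyapunov identity. With U = Φ(n,k+1), the relation Φ(n,k) = U(1 + a/k) gives k Φ(n,k)
-- ξ Φ(n,k)* = U(kξ + aξ + ξa* + aξa*/k)U*. As σ = ξ - aξ - ξa*, each summand UσU* is the increment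
-- of k Φ(n,k) ξ Φ(n,k)* plus an error carrying a factor 1/k.
lemma gramSum_Ico {a σ ξ : 𝔸} (ha : ∀ n : ℕ, IsUnit (1 + (1 / (n : ℝ)) • a))
    (hξ : ξ - a * ξ - ξ * star a = σ) (n : ℕ) {m m' : ℕ} (hm : 1 ≤ m) (hmm : m ≤ m') :
    gramSum a σ n (Finset.Ico m m') =
      (m' : ℝ) • (transition a n m' * ξ * star (transition a n m')) -
      (m : ℝ) • (transition a n m * ξ * star (transition a n m)) +
      ∑ k ∈ Finset.Ico m m', (1 / (k : ℝ)) •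
        (transition a n (k + 1) * (a * ξ * star a) * star (transition a n (k + 1))) := by
  unfold gramSum
  induction m', hmm using Nat.le_induction with
  | base => simp
  | succ k hk ih =>
    rw [Finset.sum_Ico_succ_top hk, Finset.sum_Ico_succ_top hk, ih]
    have h0 : (k : ℝ) ≠ 0 := by
      have : 0 < k := hm.trans hk
      positivity
    set U := transition a n (k + 1)
    have hU : transition a n k = U * (1 + (1 / (k : ℝ)) • a) := transition_succ_right ha n k
    have key : (k : ℝ) • (transition a n k * ξ * star (transition a n k)) =
        (k : ℝ) • (U * ξ * star U) + U * (a * ξ) * star U + U * (ξ * star a) * star U +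
          (1 / (k : ℝ)) • (U * (a * ξ * star a) * star U) := by
      rw [hU]
      have h0' : (k : ℝ) * (1 / k * (1 / k)) = 1 / k := by field_simp
      simp only [star_mul, star_add, star_smul, star_trivial, mul_add, add_mul,
        smul_mul_assoc, mul_smul_comm, mul_one, smul_add, smul_smul]
      simp only [mul_one_div_cancel h0, h0', one_smul, mul_assoc]
      abel
    rw [key, ← hξ]
    push_cast
    simp only [mul_sub, sub_mul, mul_assoc]
    module

omit [NormedAlgebra ℝ 𝔸] [CompleteSpace 𝔸] [StarModule ℝ 𝔸] in
lemma norm_mul_mul_star_le (u x : 𝔸) : ‖u * x * star u‖ ≤ ‖u‖ ^ 2 * ‖x‖ := by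
  calc ‖u * x * star u‖ ≤ ‖u * x‖ * ‖star u‖ := norm_mul_le _ _
    _ ≤ ‖u‖ * ‖x‖ * ‖u‖ := by rw [norm_star]; gcongr; exact norm_mul_le _ _
    _ = _ := by ring

/-- In `gramSum_Ico` from 1 to n the upper boundary term is exactly nξ; the lower one and the error
sum are O(n^{2α}), negligible against n because 2α < 1. Taken with σ = 0, this also shows that the
homogeneous Lyapunov equation has only the zero solution. -/
theorem tendsto_gramSum_range {a σ ξ : 𝔸} (ha : ∀ n : ℕ, IsUnit (1 + (1 / (n : ℝ)) • a))
    {α K : ℝ} (hα : ∀ t, 0 ≤ t → ‖flow a t‖ ≤ K * Real.exp (α * t)) (hα0 : 0 < α)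
    (hα1 : α < 1 / 2) (hξ : ξ - a * ξ - ξ * star a = σ) :
    Tendsto (fun n : ℕ => (1 / (n : ℝ)) • gramSum a σ n (Finset.range n)) atTop (𝓝 ξ) := by
  obtain ⟨C, hC, hΦ⟩ := norm_transition_le ha hα
  set b : ℝ := ∑' k : ℕ, 1 / (k : ℝ) ^ (1 + 2 * α)
  have hsum : Summable fun k : ℕ => 1 / (k : ℝ) ^ (1 + 2 * α) :=
    Real.summable_one_div_nat_rpow.2 (by linarith)
  have hb : 0 ≤ b := tsum_nonneg fun k => by positivity
  rw [tendsto_iff_norm_sub_tendsto_zero]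
  set D : ℝ := C ^ 2 * ‖σ‖ + C ^ 2 * ‖ξ‖ + C ^ 2 * ‖a * ξ * star a‖ * b
  have hbound : ∀ n : ℕ, 1 ≤ n →
      ‖(1 / (n : ℝ)) • gramSum a σ n (Finset.range n) - ξ‖ ≤ D * (n : ℝ) ^ (-(1 - 2 * α)) := by
    intro n hn
    have h0 : (0 : ℝ) < n := by exact_mod_cast hn
    have hpow : ∀ k : ℕ, 1 ≤ k → k ≤ n →
        ‖transition a n k‖ ^ 2 ≤ C ^ 2 * ((n : ℝ) ^ (2 * α) / (k : ℝ) ^ (2 * α)) := by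
      intro k hk hkn
      have h1 : (0 : ℝ) < k := by exact_mod_cast hk
      calc ‖transition a n k‖ ^ 2 ≤ (C * ((n : ℝ) / k) ^ α) ^ 2 := by
            gcongr; exact hΦ n k hk hkn
        _ = _ := by
            rw [mul_pow, ← Real.rpow_natCast (((n : ℝ) / k) ^ α), ← Real.rpow_mul (by positivity),
              Real.div_rpow h0.le h1.le]
            norm_num [mul_comm]
    -- The term k = 0 is split off because the Lyapunov identity starts at k = 1.
    have hsplit : gramSum a σ n (Finset.range n) =
        transition a n 1 * σ * star (transition a n 1) + gramSum a σ n (Finset.Ico 1 n) := by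
      rw [gramSum, Finset.range_eq_Ico, Finset.sum_eq_sum_Ico_succ_bot hn, gramSum]
    have h1' : ‖transition a n 1‖ ^ 2 ≤ C ^ 2 * (n : ℝ) ^ (2 * α) := by
      simpa using hpow 1 le_rfl hn
    have e1 : ‖transition a n 1 * σ * star (transition a n 1)‖ ≤ C ^ 2 * (n : ℝ) ^ (2 * α) * ‖σ‖ :=
      (norm_mul_mul_star_le _ _).trans (by gcongr)
    have e2 : ‖transition a n 1 * ξ * star (transition a n 1)‖ ≤ C ^ 2 * (n : ℝ) ^ (2 * α) * ‖ξ‖ :=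
      (norm_mul_mul_star_le _ _).trans (by gcongr)
    have e3 : ‖∑ k ∈ Finset.Ico 1 n, (1 / (k : ℝ)) • (transition a n (k + 1) * (a * ξ * star a) *
        star (transition a n (k + 1)))‖ ≤ C ^ 2 * (n : ℝ) ^ (2 * α) * ‖a * ξ * star a‖ * b := by
      refine (norm_sum_le _ _).trans ?_
      calc _ ≤ ∑ k ∈ Finset.Ico 1 n, C ^ 2 * (n : ℝ) ^ (2 * α) * ‖a * ξ * star a‖ *
            (1 / (k : ℝ) ^ (1 + 2 * α)) := by
            refine Finset.sum_le_sum fun k hk => ?_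
            rw [Finset.mem_Ico] at hk
            have hk0 : (0 : ℝ) < k := by exact_mod_cast hk.1
            rw [norm_smul, Real.norm_of_nonneg (by positivity)]
            calc _ ≤ 1 / (k : ℝ) * (C ^ 2 * ((n : ℝ) ^ (2 * α) / (k : ℝ) ^ (2 * α)) *
                  ‖a * ξ * star a‖) := by
                  gcongr
                  refine (norm_mul_mul_star_le _ _).trans ?_
                  gcongr
                  refine (hpow (k + 1) (by lia) (by lia)).trans ?_
                  gcongr
                  linarith
              _ = _ := by
                  rw [Real.rpow_add hk0, Real.rpow_one]
                  field_simp
        _ ≤ _ := by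
            rw [← Finset.mul_sum]
            gcongr
            exact hsum.sum_le_tsum _ fun k _ => by positivity
    have key : (1 / (n : ℝ)) • gramSum a σ n (Finset.range n) - ξ = (1 / (n : ℝ)) •
        (transition a n 1 * σ * star (transition a n 1)
          - transition a n 1 * ξ * star (transition a n 1)
          + ∑ k ∈ Finset.Ico 1 n, (1 / (k : ℝ)) • (transition a n (k + 1) * (a * ξ * star a) *
            star (transition a n (k + 1)))) := by
      rw [hsplit, gramSum_Ico ha hξ n le_rfl hn, transition_self ha]
      have : (1 / (n : ℝ)) * n = 1 := by field_simp
      simp only [smul_add, smul_sub, smul_smul, this, one_mul, star_one, mul_one, one_smul,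
        Nat.cast_one]
      abel
    rw [key, norm_smul, Real.norm_of_nonneg (by positivity)]
    have h4 := (norm_add_le _ _).trans (add_le_add ((norm_sub_le
      (transition a n 1 * σ * star (transition a n 1))
      (transition a n 1 * ξ * star (transition a n 1))).trans (add_le_add e1 e2)) e3)
    refine (mul_le_mul_of_nonneg_left h4 (by positivity)).trans (le_of_eq ?_)
    rw [neg_sub, Real.rpow_sub h0, Real.rpow_one]
    simp only [D]
    ring
  have hlim : Tendsto (fun n : ℕ => D * (n : ℝ) ^ (-(1 - 2 * α))) atTop (𝓝 0) := by
    have := ((tendsto_rpow_neg_atTop (show 0 < 1 - 2 * α by linarith)).comp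
      tendsto_natCast_atTop_atTop).const_mul D
    simpa using this
  exact squeeze_zero' (Eventually.of_forall fun _ => norm_nonneg _)
    (eventually_atTop.2 ⟨1, hbound⟩) hlim

/-- Here ξ appears with the opposite sign: on [n, m) the subtracted lower boundary term of
`gramSum_Ico` is nξ, while the upper one is O(m (n/m)^{2β}) and vanishes as m grows since 2β > 1. -/
theorem eventually_norm_gramSum_Ico_le {a σ ξ : 𝔸}
    (ha : ∀ n : ℕ, IsUnit (1 + (1 / (n : ℝ)) • a))
    {β K : ℝ} (hβ : ∀ t, 0 ≤ t → ‖flow a (-t)‖ ≤ K * Real.exp (-β * t))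
    (hβ1 : 1 / 2 < β) (hξ : ξ - a * ξ - ξ * star a = σ) :
    ∃ D, ∀ n : ℕ, 1 ≤ n → ∀ᶠ m : ℕ in atTop,
      ‖(1 / (n : ℝ)) • gramSum a σ n (Finset.Ico n m) + ξ‖ ≤ D / n := by
  obtain ⟨C, hC, hΦ⟩ := norm_transition_le' ha hβ
  -- The 1 pays for the upper boundary term, which is below 1/n after normalisation once m is large;
  -- the rest bounds the error sum.
  refine ⟨C ^ 2 * ‖a * ξ * star a‖ + 1, fun n hn => ?_⟩
  have h0 : (0 : ℝ) < n := by exact_mod_cast hn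
  have hpow : ∀ k : ℕ, n ≤ k → ‖transition a n k‖ ^ 2 ≤ C ^ 2 * ((n : ℝ) / k) ^ (2 * β) := by
    intro k hk
    calc ‖transition a n k‖ ^ 2 ≤ (C * ((n : ℝ) / k) ^ β) ^ 2 := by gcongr; exact hΦ n k hn hk
      _ = _ := by
          rw [mul_pow, ← Real.rpow_natCast (((n : ℝ) / k) ^ β), ← Real.rpow_mul (by positivity)]
          norm_num [mul_comm]
  have hlim : Tendsto (fun m : ℕ => (1 / (n : ℝ)) * ((m : ℝ) *
      (C ^ 2 * ((n : ℝ) / m) ^ (2 * β) * ‖ξ‖))) atTop (𝓝 0) := by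
    have h1 := ((tendsto_rpow_neg_atTop (show 0 < 2 * β - 1 by linarith)).comp
      tendsto_natCast_atTop_atTop).const_mul (1 / (n : ℝ) * C ^ 2 * (n : ℝ) ^ (2 * β) * ‖ξ‖)
    rw [mul_zero] at h1
    refine h1.congr' ?_
    filter_upwards [eventually_ge_atTop 1] with m hm
    have hm0 : (0 : ℝ) < m := by exact_mod_cast hm
    rw [Real.div_rpow h0.le hm0.le, Function.comp_apply, neg_sub, Real.rpow_sub hm0, Real.rpow_one]
    ring
  have hev := hlim.eventually (gt_mem_nhds (show (0 : ℝ) < 1 / n by positivity))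
  filter_upwards [hev, eventually_ge_atTop n] with m hm hnm
  have hm0 : (0 : ℝ) < m := by exact_mod_cast hn.trans hnm
  have e1 : ‖(m : ℝ) • (transition a n m * ξ * star (transition a n m))‖ ≤
      (m : ℝ) * (C ^ 2 * ((n : ℝ) / m) ^ (2 * β) * ‖ξ‖) := by
    rw [norm_smul, Real.norm_of_nonneg hm0.le]
    gcongr
    exact (norm_mul_mul_star_le _ _).trans (by gcongr; exact hpow m hnm)
  have e3 : ‖∑ k ∈ Finset.Ico n m, (1 / (k : ℝ)) • (transition a n (k + 1) * (a * ξ * star a) *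
      star (transition a n (k + 1)))‖ ≤ C ^ 2 * ‖a * ξ * star a‖ := by
    refine (norm_sum_le _ _).trans ?_
    have htel : ∑ k ∈ Finset.Ico n m, (1 / (k : ℝ) - 1 / ((k + 1 : ℕ) : ℝ)) = 1 / n - 1 / m := by
      have := Finset.sum_Ico_sub (fun k : ℕ => -(1 / (k : ℝ))) hnm
      rw [← neg_sub_neg, ← this]
      exact Finset.sum_congr rfl fun k _ => by ring
    calc _ ≤ ∑ k ∈ Finset.Ico n m, C ^ 2 * ‖a * ξ * star a‖ * n *
          (1 / (k : ℝ) - 1 / ((k + 1 : ℕ) : ℝ)) := by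
          refine Finset.sum_le_sum fun k hk => ?_
          rw [Finset.mem_Ico] at hk
          have hk0 : (0 : ℝ) < k := by exact_mod_cast hn.trans hk.1
          have hnk : (n : ℝ) ≤ k := by exact_mod_cast hk.1
          rw [norm_smul, Real.norm_of_nonneg (by positivity)]
          -- Lowering the exponent from 2β to 1 leaves terms n/(k(k+1)), which telescope.
          have hle : ((n : ℝ) / ((k + 1 : ℕ) : ℝ)) ^ (2 * β) ≤ (n : ℝ) / ((k + 1 : ℕ) : ℝ) := by
            have h1 : (n : ℝ) / ((k + 1 : ℕ) : ℝ) ≤ 1 := by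
              rw [div_le_one (by positivity)]; push_cast; linarith
            calc _ ≤ ((n : ℝ) / ((k + 1 : ℕ) : ℝ)) ^ (1 : ℝ) :=
                  Real.rpow_le_rpow_of_exponent_ge (by positivity) h1 (by linarith)
              _ = _ := Real.rpow_one _
          calc _ ≤ 1 / (k : ℝ) * (C ^ 2 * ((n : ℝ) / ((k + 1 : ℕ) : ℝ)) *
                ‖a * ξ * star a‖) := by
                gcongr
                refine (norm_mul_mul_star_le _ _).trans ?_
                gcongr
                exact (hpow (k + 1) (by lia)).trans (by gcongr)
            _ = _ := by push_cast; field_simp; ring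
      _ = C ^ 2 * ‖a * ξ * star a‖ * (n * (1 / n - 1 / m)) := by
          rw [← Finset.mul_sum, htel, mul_assoc]
      _ ≤ C ^ 2 * ‖a * ξ * star a‖ * 1 := by
          gcongr
          have : 0 ≤ (n : ℝ) * (1 / m) := by positivity
          have h2 : (n : ℝ) * (1 / n) = 1 := by field_simp
          rw [mul_sub, h2]; linarith
      _ = _ := mul_one _
  have key : (1 / (n : ℝ)) • gramSum a σ n (Finset.Ico n m) + ξ = (1 / (n : ℝ)) •
      ((m : ℝ) • (transition a n m * ξ * star (transition a n m))) + (1 / (n : ℝ)) •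
        ∑ k ∈ Finset.Ico n m, (1 / (k : ℝ)) • (transition a n (k + 1) * (a * ξ * star a) *
          star (transition a n (k + 1))) := by
    rw [gramSum_Ico ha hξ n hn hnm, transition_self ha]
    have : (1 / (n : ℝ)) * n = 1 := by field_simp
    simp only [smul_add, smul_sub, smul_smul, this, one_mul, star_one, mul_one, one_smul]
    abel
  rw [key]
  refine (norm_add_le _ _).trans ?_
  rw [norm_smul, norm_smul (1 / (n : ℝ)) (∑ k ∈ _, _), Real.norm_of_nonneg (by positivity)]
  have f1 : 1 / (n : ℝ) * ‖(m : ℝ) • (transition a n m * ξ * star (transition a n m))‖ ≤ 1 / n :=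
    (mul_le_mul_of_nonneg_left e1 (by positivity)).trans hm.le
  have f2 := mul_le_mul_of_nonneg_left e3 (show 0 ≤ 1 / (n : ℝ) by positivity)
  calc _ ≤ _ := add_le_add f1 f2
    _ = _ := by ring

end Transition

/-! ### Growth of matrix exponentials in terms of the spectrum. -/

section Growth

open scoped Matrix.Norms.L2Operator

lemma mem_spectrum_of_mulVec {d : ℕ} {M : Matrix (Fin d) (Fin d) ℂ} {μ : ℂ}
    {v : Fin d → ℂ} (hv : v ≠ 0) (h : M *ᵥ v = μ • v) : μ ∈ spectrum ℂ M := by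
  rw [← AlgEquiv.spectrum_eq (Matrix.toLinAlgEquiv' (R := ℂ) (n := Fin d)),
    ← Module.End.hasEigenvalue_iff_mem_spectrum]
  refine Module.End.hasEigenvalue_of_hasEigenvector (x := v) ⟨?_, hv⟩
  rw [Module.End.mem_eigenspace_iff]
  simpa using h

lemma exp_mulVec_of_mulVec {d : ℕ} {M : Matrix (Fin d) (Fin d) ℂ} {μ : ℂ}
    {v : Fin d → ℂ} (h : M *ᵥ v = μ • v) : NormedSpace.exp M *ᵥ v = Complex.exp μ • v := by
  have h1 := NormedSpace.exp_series_hasSum_exp' (𝕂 := ℂ) M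
  have hpow : ∀ n : ℕ, M ^ n *ᵥ v = μ ^ n • v := by
    intro n
    induction n with
    | zero => simp
    | succ n ih => rw [pow_succ', ← Matrix.mulVec_mulVec, ih, Matrix.mulVec_smul, h, smul_smul,
        pow_succ]
  have hc : Continuous fun N : Matrix (Fin d) (Fin d) ℂ => N *ᵥ v := by fun_prop
  have h2 := h1.map (AddMonoidHom.mk' (fun N : Matrix (Fin d) (Fin d) ℂ => N *ᵥ v)
    (fun a b => Matrix.add_mulVec a b v)) hc
  have h3 := (NormedSpace.exp_series_hasSum_exp' (𝕂 := ℂ) μ).smul_const v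
  refine h2.unique ?_
  rw [Complex.exp_eq_exp_ℂ]
  convert h3 using 1
  funext n
  simp [Matrix.smul_mulVec, hpow, smul_smul]

/-- M commutes with its exponential, so it preserves the eigenspace for μ and has an eigenvector
there, on which the exponential acts as exp l. -/
lemma exists_eq_exp_of_mem_spectrum_exp {d : ℕ} {M : Matrix (Fin d) (Fin d) ℂ} {μ : ℂ}
    (h : μ ∈ spectrum ℂ (NormedSpace.exp M)) : ∃ l ∈ spectrum ℂ M, μ = Complex.exp l := by
  set f : Module.End ℂ (Fin d → ℂ) := Matrix.toLinAlgEquiv' M with hf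
  set g : Module.End ℂ (Fin d → ℂ) := Matrix.toLinAlgEquiv' (NormedSpace.exp M) with hg
  have hfg : Commute g f := by
    have : Commute (NormedSpace.exp M) M := (Commute.refl M).exp_left
    exact this.map (Matrix.toLinAlgEquiv' (R := ℂ) (n := Fin d))
  rw [← AlgEquiv.spectrum_eq (Matrix.toLinAlgEquiv' (R := ℂ) (n := Fin d)), ← hg,
    ← Module.End.hasEigenvalue_iff_mem_spectrum] at h
  have hmaps : Set.MapsTo f (Module.End.eigenspace g μ) (Module.End.eigenspace g μ) := by
    intro w hw
    simp only [SetLike.mem_coe, Module.End.mem_eigenspace_iff] at hw ⊢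
    have := LinearMap.congr_fun hfg.eq w
    simp only [Module.End.mul_apply] at this
    rw [this, hw, map_smul]
  have : Nontrivial (Module.End.eigenspace g μ) :=
    Submodule.nontrivial_iff_ne_bot.2 h
  obtain ⟨l, hl⟩ := Module.End.exists_eigenvalue (f.restrict hmaps)
  obtain ⟨w, hw⟩ := hl.exists_hasEigenvector
  have hw0 : (w : Fin d → ℂ) ≠ 0 := by simpa using hw.2
  have hw1 : M *ᵥ (w : Fin d → ℂ) = l • (w : Fin d → ℂ) := by
    have := congrArg Subtype.val hw.apply_eq_smul
    simpa [hf] using this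
  have hw2 : NormedSpace.exp M *ᵥ (w : Fin d → ℂ) = μ • (w : Fin d → ℂ) := by
    have := Module.End.mem_eigenspace_iff.1 w.2
    simpa [hg] using this
  refine ⟨l, mem_spectrum_of_mulVec hw0 hw1, ?_⟩
  rw [exp_mulVec_of_mulVec hw1] at hw2
  exact (smul_left_injective ℂ hw0 hw2).symm

/-- Gelfand's formula: the eigenvalues of exp M lie in the open disc of radius e^α, so (exp M)^n =
O(e^{αn}). The fractional part of t is handled by compactness of [0,1]. -/
lemma exists_norm_exp_smul_le {d : ℕ} (hd : 0 < d) (M : Matrix (Fin d) (Fin d) ℂ) {α : ℝ}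
    (h : ∀ l ∈ spectrum ℂ M, l.re < α) :
    ∃ K, ∀ t : ℝ, 0 ≤ t → ‖NormedSpace.exp (t • M)‖ ≤ K * Real.exp (α * t) := by
  have : Nonempty (Fin d) := ⟨⟨0, hd⟩⟩
  have : Nontrivial (Matrix (Fin d) (Fin d) ℂ) := inferInstance
  set S := NormedSpace.exp M
  obtain ⟨r, hrα⟩ : ∃ r : NNReal, (r : ℝ) = Real.exp α :=
    ⟨(Real.exp α).toNNReal, Real.coe_toNNReal _ (Real.exp_pos α).le⟩
  have hr : (0 : ℝ) < r := hrα ▸ Real.exp_pos α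
  have hrad : spectralRadius ℂ S < r := by
    refine spectrum.spectralRadius_lt_of_forall_lt S fun z hz => ?_
    obtain ⟨l, hl, rfl⟩ := exists_eq_exp_of_mem_spectrum_exp hz
    rw [← NNReal.coe_lt_coe, coe_nnnorm, Complex.norm_exp, hrα]
    exact Real.exp_lt_exp.2 (h l hl)
  have hev := (spectrum.pow_nnnorm_pow_one_div_tendsto_nhds_spectralRadius S).eventually
    (gt_mem_nhds hrad)
  have hO : (fun n : ℕ => S ^ n) =O[atTop] fun n : ℕ => (r : ℝ) ^ n := by
    refine Asymptotics.IsBigO.of_bound 1 ?_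
    filter_upwards [hev, eventually_ge_atTop 1] with n hn h1
    have hn0 : (0 : ℝ) < n := by exact_mod_cast h1
    have h2 := ENNReal.rpow_lt_rpow hn hn0
    rw [← ENNReal.rpow_mul, one_div_mul_cancel hn0.ne', ENNReal.rpow_one, ENNReal.rpow_natCast]
      at h2
    have h3 : ‖S ^ n‖₊ < r ^ n := by exact_mod_cast h2
    rw [one_mul, Real.norm_of_nonneg (by positivity)]
    exact_mod_cast h3.le
  obtain ⟨C, hC, hCb⟩ := Asymptotics.bound_of_isBigO_nat_atTop hO
  have hcont : Continuous fun s : ℝ => ‖NormedSpace.exp (s • M)‖ := by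
    let := NormedAlgebra.restrictScalars ℚ ℂ (Matrix (Fin d) (Fin d) ℂ)
    have h1 : Continuous fun s : ℝ => s • M := by fun_prop
    exact (NormedSpace.exp_continuous.comp h1).norm
  obtain ⟨B, hB⟩ := (isCompact_Icc (a := (0 : ℝ)) (b := 1)).bddAbove_image hcont.continuousOn
  have hB' : ∀ s : ℝ, 0 ≤ s → s ≤ 1 → ‖NormedSpace.exp (s • M)‖ ≤ B := fun s h0 h1 =>
    hB ⟨s, ⟨h0, h1⟩, rfl⟩
  have hB0 : 0 ≤ B := (norm_nonneg _).trans (hB' 0 le_rfl zero_le_one)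
  refine ⟨C * Real.exp |α| * B, fun t ht => ?_⟩
  set n := ⌊t⌋₊
  have hn1 : (n : ℝ) ≤ t := Nat.floor_le ht
  have hn2 : t < n + 1 := Nat.lt_floor_add_one t
  have hsplit : NormedSpace.exp (t • M) = S ^ n * NormedSpace.exp ((t - n) • M) := by
    let := NormedAlgebra.restrictScalars ℚ ℂ (Matrix (Fin d) (Fin d) ℂ)
    rw [← NormedSpace.exp_nsmul, ← NormedSpace.exp_add_of_commute]
    · congr 1
      rw [← Nat.cast_smul_eq_nsmul ℝ, ← add_smul]; congr 1; ring
    · exact ((Commute.refl M).smul_left _).smul_right _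
  have hSn : ‖S ^ n‖ ≤ C * Real.exp (α * n) := by
    have := hCb (x := n) (by positivity)
    rw [Real.norm_of_nonneg (by positivity)] at this
    refine this.trans (le_of_eq ?_)
    rw [hrα, ← Real.exp_nat_mul, mul_comm α]
  rw [hsplit]
  calc _ ≤ ‖S ^ n‖ * ‖NormedSpace.exp ((t - n) • M)‖ := norm_mul_le _ _
    _ ≤ (C * Real.exp (α * n)) * B := by
        gcongr
        exact hB' _ (by linarith) (by linarith)
    _ ≤ (C * (Real.exp |α| * Real.exp (α * t))) * B := by
        gcongr
        rw [← Real.exp_add]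
        refine Real.exp_le_exp.2 ?_
        have h1 : α * (n - t) ≤ |α| * 1 := by
          refine (le_abs_self _).trans ?_
          rw [abs_mul]
          gcongr
          rw [abs_le]; constructor <;> linarith
        linarith
    _ = _ := by ring

/-- The entrywise embedding is linear and injective, hence bounded below in finite dimension; growth
bounds need only be proved over the complex numbers. -/
lemma exists_norm_le_norm_map_ofReal (d : ℕ) :
    ∃ c, 0 ≤ c ∧ ∀ B : Matrix (Fin d) (Fin d) ℝ, ‖B‖ ≤ c * ‖B.map Complex.ofReal‖ := by
  let φ : Matrix (Fin d) (Fin d) ℝ →ₗ[ℝ] Matrix (Fin d) (Fin d) ℂ :=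
    { toFun := fun B => B.map Complex.ofReal
      map_add' := fun B C => by ext; simp
      map_smul' := fun r B => by ext; simp }
  have hφ : LinearMap.ker φ = ⊥ := by
    rw [LinearMap.ker_eq_bot]
    exact Matrix.map_injective Complex.ofReal_injective
  obtain ⟨K, -, hK⟩ := φ.exists_antilipschitzWith hφ
  refine ⟨K, K.2, fun B => ?_⟩
  have := hK.le_mul_dist B 0
  rwa [map_zero, dist_zero_right, dist_zero_right] at this

lemma map_ofReal_exp {d : ℕ} (B : Matrix (Fin d) (Fin d) ℝ) :
    (NormedSpace.exp B).map Complex.ofReal = NormedSpace.exp (B.map Complex.ofReal) := by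
  let := NormedAlgebra.restrictScalars ℚ ℝ (Matrix (Fin d) (Fin d) ℝ)
  let := NormedAlgebra.restrictScalars ℚ ℂ (Matrix (Fin d) (Fin d) ℂ)
  have hc : Continuous (Complex.ofRealHom.mapMatrix : Matrix (Fin d) (Fin d) ℝ →+* _) := by
    have : Continuous fun B : Matrix (Fin d) (Fin d) ℝ => B.map Complex.ofReal :=
      continuous_id.matrix_map Complex.continuous_ofReal
    exact this
  exact NormedSpace.map_exp (Complex.ofRealHom.mapMatrix : Matrix (Fin d) (Fin d) ℝ →+* _) hc B

lemma map_ofReal_smul {d : ℕ} (t : ℝ) (B : Matrix (Fin d) (Fin d) ℝ) :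
    (t • B).map Complex.ofReal = t • B.map Complex.ofReal := by
  ext; simp

lemma finite_spectrum {d : ℕ} (M : Matrix (Fin d) (Fin d) ℂ) : (spectrum ℂ M).Finite :=
  Matrix.finite_spectrum M

lemma re_le_lambdaMax {d : ℕ} {A : Matrix (Fin d) (Fin d) ℝ} {l : ℂ}
    (hl : l ∈ spectrum ℂ (A.map Complex.ofReal)) : l.re ≤ lambdaMax A :=
  le_csSup ((finite_spectrum _).image _).bddAbove ⟨l, hl, rfl⟩

lemma lambdaMin_le_re {d : ℕ} {A : Matrix (Fin d) (Fin d) ℝ} {l : ℂ}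
    (hl : l ∈ spectrum ℂ (A.map Complex.ofReal)) : lambdaMin A ≤ l.re :=
  csInf_le ((finite_spectrum _).image _).bddBelow ⟨l, hl, rfl⟩

theorem exists_norm_flow_le {d : ℕ} (hd : 0 < d) {A : Matrix (Fin d) (Fin d) ℝ} {α : ℝ}
    (h : lambdaMax A < α) :
    ∃ K, ∀ t : ℝ, 0 ≤ t → ‖flow A t‖ ≤ K * Real.exp (α * t) := by
  obtain ⟨c, hc, hcb⟩ := exists_norm_le_norm_map_ofReal d
  obtain ⟨K, hK⟩ := exists_norm_exp_smul_le hd (A.map Complex.ofReal)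
    fun l hl => (re_le_lambdaMax hl).trans_lt h
  refine ⟨c * K, fun t ht => (hcb _).trans ?_⟩
  rw [flow, map_ofReal_exp, map_ofReal_smul, mul_assoc]
  exact mul_le_mul_of_nonneg_left (hK t ht) hc

theorem exists_norm_flow_neg_le {d : ℕ} (hd : 0 < d) {A : Matrix (Fin d) (Fin d) ℝ} {β : ℝ}
    (h : β < lambdaMin A) :
    ∃ K, ∀ t : ℝ, 0 ≤ t → ‖flow A (-t)‖ ≤ K * Real.exp (-β * t) := by
  obtain ⟨c, hc, hcb⟩ := exists_norm_le_norm_map_ofReal d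
  obtain ⟨K, hK⟩ := exists_norm_exp_smul_le hd (-A.map Complex.ofReal) (α := -β) (by
    intro l hl
    have h1 : -l ∈ spectrum ℂ (A.map Complex.ofReal) := by
      rw [← spectrum.neg_eq] at hl
      simpa using hl
    have := lambdaMin_le_re h1
    rw [Complex.neg_re] at this
    linarith)
  refine ⟨c * K, fun t ht => (hcb _).trans ?_⟩
  rw [flow, map_ofReal_exp, map_ofReal_smul, mul_assoc, neg_smul, ← smul_neg]
  exact mul_le_mul_of_nonneg_left (hK t ht) hc

/-- If 1 + A/n were singular, -n would be an eigenvalue of A, against positivity of the real parts.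
At n = 0 the matrix is 1, by division by zero. -/
theorem isUnit_one_add_smul {d : ℕ} {A : Matrix (Fin d) (Fin d) ℝ} (h : 0 < lambdaMin A) (n : ℕ) :
    IsUnit (1 + (1 / (n : ℝ)) • A) := by
  rcases Nat.eq_zero_or_pos n with rfl | hn
  · simp
  have hn0 : (0 : ℝ) < n := by exact_mod_cast hn
  by_contra hu
  have hu' : ¬ IsUnit ((n : ℝ) • (1 : Matrix (Fin d) (Fin d) ℝ) + A) := by
    intro h1
    apply hu
    have : (1 : Matrix (Fin d) (Fin d) ℝ) + (1 / (n : ℝ)) • A =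
        (Units.mk0 (1 / (n : ℝ)) (by positivity)) • ((n : ℝ) • (1 : Matrix (Fin d) (Fin d) ℝ) + A) := by
      rw [Units.smul_mk0, smul_add, smul_smul, one_div_mul_cancel hn0.ne', one_smul]
    rw [this]
    exact h1.smul _
  have hmem : (-(n : ℂ)) ∈ spectrum ℂ (A.map Complex.ofReal) := by
    rw [spectrum.mem_iff]
    intro h2
    apply hu'
    have e : algebraMap ℂ (Matrix (Fin d) (Fin d) ℂ) (-(n : ℂ)) - A.map Complex.ofReal =
        -(Complex.ofRealHom.mapMatrix ((n : ℝ) • (1 : Matrix (Fin d) (Fin d) ℝ) + A)) := by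
      rw [Algebra.algebraMap_eq_smul_one]
      ext i j
      simp only [Matrix.sub_apply, Matrix.smul_apply, Matrix.map_apply, Matrix.neg_apply,
        RingHom.mapMatrix_apply, Matrix.add_apply, Complex.ofRealHom_eq_coe, Complex.ofReal_add,
        smul_eq_mul, Complex.ofReal_mul, Complex.ofReal_natCast, Matrix.one_apply]
      split_ifs <;> push_cast <;> ring
    rw [e, IsUnit.neg_iff, Matrix.isUnit_iff_isUnit_det, ← RingHom.map_det] at h2
    rw [Matrix.isUnit_iff_isUnit_det, isUnit_iff_ne_zero]
    rintro h3
    rw [h3] at h2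
    simp at h2
  have := lambdaMin_le_re hmem
  simp at this
  linarith

end Growth

/-! ### A central limit theorem for martingale differences by characteristic functions. -/

section WhiteNoise

open scoped RealInnerProductSpace

variable {Ω E : Type*} [mΩ : MeasurableSpace Ω] [NormedAddCommGroup E] [InnerProductSpace ℝ E]
  [CompleteSpace E]

/-- Martingale differences with bounded moments of order `p ∈ (2, 3]`. -/
structure IsMartingaleDiff (P : Measure Ω) (ℱ : Filtration ℕ mΩ) (e : ℕ → Ω → E)
    (p M : ℝ) : Prop where
  measurable : ∀ n, StronglyMeasurable[ℱ (n + 1)] (e n)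
  memLp : ∀ n, MemLp (e n) 2 P
  two_lt : 2 < p
  le_three : p ≤ 3
  moment_integrable : ∀ n, Integrable (fun ω => ‖e n ω‖ ^ p) P
  moment_le : ∀ n, ∫ ω, ‖e n ω‖ ^ p ∂P ≤ M
  condExp_eq_zero : ∀ n, P[e n | ℱ n] =ᵐ[P] 0

/-- Martingale differences whose conditional covariances converge in mean to the deterministic
quadratic form `q`. -/
structure IsMartingaleNoise (P : Measure Ω) (ℱ : Filtration ℕ mΩ) (e : ℕ → Ω → E)
    (q : E → ℝ) (p M : ℝ) (δ : ℕ → ℝ) : Prop extends IsMartingaleDiff P ℱ e p M where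
  -- A weak form of L¹ convergence of the conditional variances: the characteristic-function
  -- recursion only ever tests them against bounded functions of the past.
  variance : ∀ n (b : E) (g : Ω → ℂ), StronglyMeasurable[ℱ n] g → (∀ ω, ‖g ω‖ ≤ 1) →
    ‖∫ ω, g ω * ((⟪b, e n ω⟫ ^ 2 - q b : ℝ) : ℂ) ∂P‖ ≤ ‖b‖ ^ 2 * δ n
  tendsto_error : Tendsto δ atTop (𝓝 0)
  lower : ∃ c, 0 < c ∧ ∀ b, c * ‖b‖ ^ 2 ≤ q b
  upper : ∃ c, ∀ b, q b ≤ c * ‖b‖ ^ 2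

/-- For |x| ≤ 1 the cubic Taylor bound is at most |x|^p since p ≤ 3; for |x| > 1 all terms are
dominated by x² ≤ |x|^p since p ≥ 2. -/
lemma norm_exp_I_sub_taylor_le {p : ℝ} (h2 : 2 ≤ p) (h3 : p ≤ 3) (x : ℝ) :
    ‖Complex.exp (x * Complex.I) - 1 - x * Complex.I + ((x ^ 2 / 2 : ℝ) : ℂ)‖ ≤ 4 * |x| ^ p := by
  rcases le_or_gt |x| 1 with hx | hx
  · have h := Complex.exp_bound (x := x * Complex.I) (by simpa using hx) (n := 3) (by norm_num)
    have e : ∑ m ∈ Finset.range 3, (x * Complex.I) ^ m / (m.factorial : ℂ) =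
        1 + x * Complex.I - ((x ^ 2 / 2 : ℝ) : ℂ) := by
      simp [Finset.sum_range_succ, Nat.factorial, mul_pow, sub_eq_add_neg, neg_div]
    rw [e] at h
    have hx3 : |x| ^ 3 ≤ |x| ^ p := by
      rcases eq_or_ne x 0 with rfl | hx0
      · simp [Real.zero_rpow (by linarith : p ≠ 0)]
      · rw [← Real.rpow_natCast]
        exact Real.rpow_le_rpow_of_exponent_ge (abs_pos.2 hx0) hx (by simpa using h3)
    calc _ = ‖Complex.exp (x * Complex.I) - (1 + x * Complex.I - ((x ^ 2 / 2 : ℝ) : ℂ))‖ := by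
          congr 1; ring
      _ ≤ _ := h
      _ ≤ 1 * |x| ^ 3 := by
          simp only [norm_mul, Complex.norm_I, mul_one, Complex.norm_real, Real.norm_eq_abs]
          rw [mul_comm]
          gcongr
          norm_num [Nat.factorial]
      _ ≤ 4 * |x| ^ p := by
          have : 0 ≤ |x| ^ p := by positivity
          linarith
  · have hxp : |x| ^ 2 ≤ |x| ^ p := by
      rw [← Real.rpow_natCast]
      exact Real.rpow_le_rpow_of_exponent_le hx.le (by simpa using h2)
    have hE : ‖Complex.exp (x * Complex.I)‖ = 1 := Complex.norm_exp_ofReal_mul_I x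
    calc _ ≤ ‖Complex.exp (x * Complex.I)‖ + ‖(1 : ℂ)‖ + ‖x * Complex.I‖ +
          ‖((x ^ 2 / 2 : ℝ) : ℂ)‖ :=
          (norm_add_le _ _).trans (add_le_add ((norm_sub_le _ _).trans
            (add_le_add (norm_sub_le _ _) le_rfl)) le_rfl)
      _ = 2 + |x| + |x| ^ 2 / 2 := by
          rw [hE]
          simp only [norm_one, norm_mul, Complex.norm_I, mul_one, Complex.norm_real,
            Real.norm_eq_abs, abs_div, abs_pow, sq_abs]
          norm_num
      _ ≤ 4 * |x| ^ 2 := by nlinarith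
      _ ≤ _ := by linarith

lemma abs_exp_neg_sub_le {x : ℝ} (hx : 0 ≤ x) : |Real.exp (-x) - 1 + x| ≤ x ^ 2 := by
  rcases le_or_gt x 1 with h | h
  · have := Real.abs_exp_sub_one_sub_id_le (x := -x) (by rwa [abs_neg, abs_of_nonneg hx])
    simpa using this
  · have h1 := Real.exp_pos (-x)
    have h2 : Real.exp (-x) ≤ 1 := Real.exp_le_one_iff.2 (by linarith)
    rw [abs_le]; constructor <;> nlinarith

namespace IsMartingaleDiff

variable {P : Measure Ω} [IsProbabilityMeasure P] {ℱ : Filtration ℕ mΩ} {e : ℕ → Ω → E}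
  {p M : ℝ} (h : IsMartingaleDiff P ℱ e p M)

include h

lemma integrable (n : ℕ) : Integrable (e n) P := (h.memLp n).integrable one_le_two

lemma integrable_sq (n : ℕ) : Integrable (fun ω => ‖e n ω‖ ^ 2) P := (h.memLp n).integrable_norm_pow two_ne_zero

lemma integral_sq_le (n : ℕ) : ∫ ω, ‖e n ω‖ ^ 2 ∂P ≤ 1 + M := by
  have h1 : ∀ ω, ‖e n ω‖ ^ 2 ≤ 1 + ‖e n ω‖ ^ p := by
    intro ω
    rcases le_or_gt ‖e n ω‖ 1 with hx | hx
    · have : 0 ≤ ‖e n ω‖ ^ p := by positivity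
      have := pow_le_one₀ (n := 2) (norm_nonneg _) hx
      linarith
    · have : ‖e n ω‖ ^ 2 ≤ ‖e n ω‖ ^ p := by
        rw [← Real.rpow_natCast]
        exact Real.rpow_le_rpow_of_exponent_le hx.le (by simpa using h.two_lt.le)
      linarith
  calc _ ≤ ∫ ω, (1 + ‖e n ω‖ ^ p) ∂P :=
        integral_mono (h.integrable_sq n) ((integrable_const _).add (h.moment_integrable n)) h1
    _ = 1 + ∫ ω, ‖e n ω‖ ^ p ∂P := by
        rw [integral_add (integrable_const _) (h.moment_integrable n)]; simp
    _ ≤ _ := by linarith [h.moment_le n]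

lemma moment_nonneg : 0 ≤ M := by
  refine le_trans (integral_nonneg fun ω => ?_) (h.moment_le 0)
  positivity

/-- The factor known at time n is pulled out of the conditional expectation, which is zero. Stating
it for a bilinear map covers complex multipliers and inner products alike. -/
lemma integral_bilin_eq_zero {F G : Type*} [NormedAddCommGroup F] [NormedSpace ℝ F]
    [NormedAddCommGroup G] [NormedSpace ℝ G] [CompleteSpace G] (B : F →L[ℝ] E →L[ℝ] G) {n : ℕ}
    {g : Ω → F} (hg : StronglyMeasurable[ℱ n] g)
    (hi : Integrable (fun ω => B (g ω) (e n ω)) P) :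
    ∫ ω, B (g ω) (e n ω) ∂P = 0 := by
  have h1 := condExp_bilin_of_stronglyMeasurable_left (m := ℱ n) B hg hi (h.integrable n)
  have h2 : P[fun ω => B (g ω) (e n ω) | ℱ n] =ᵐ[P] 0 := by
    filter_upwards [h1, h.condExp_eq_zero n] with ω h3 h4
    rw [h3, h4]; simp
  rw [← integral_condExp (ℱ.le n), integral_congr_ae h2]; simp

lemma integral_mul_inner_eq_zero {n : ℕ} {g : Ω → ℂ} (hg : StronglyMeasurable[ℱ n] g) (b : E)
    (hi : Integrable (fun ω => g ω * ((⟪b, e n ω⟫ : ℝ) : ℂ)) P) :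
    ∫ ω, g ω * ((⟪b, e n ω⟫ : ℝ) : ℂ) ∂P = 0 := by
  let B : ℂ →L[ℝ] E →L[ℝ] ℂ := ContinuousLinearMap.smulRightL ℝ E ℂ (innerSL ℝ b)
  have hB : ∀ (z : ℂ) (y : E), B z y = z * ((⟪b, y⟫ : ℝ) : ℂ) := by
    intro z y
    change (⟪b, y⟫ : ℝ) • z = _
    rw [Complex.real_smul, mul_comm]
  have := h.integral_bilin_eq_zero B hg (by simpa only [hB] using hi)
  simpa only [hB] using this

lemma stronglyMeasurable_le {n m : ℕ} (hnm : n < m) : StronglyMeasurable[ℱ m] (e n) :=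
  (h.measurable n).mono (ℱ.mono hnm)

end IsMartingaleDiff

namespace IsMartingaleNoise

variable {P : Measure Ω} [IsProbabilityMeasure P] {ℱ : Filtration ℕ mΩ} {e : ℕ → Ω → E}
  {q : E → ℝ} {p M : ℝ} {δ : ℕ → ℝ} (h : IsMartingaleNoise P ℱ e q p M δ)

include h

/-- One step of the characteristic function recursion. -/
lemma norm_charFun_step_le {n : ℕ} {g : Ω → ℂ} (hg : StronglyMeasurable[ℱ n] g)
    (hg1 : ∀ ω, ‖g ω‖ ≤ 1) (b : E) (hq : 0 ≤ q b) :
    ‖∫ ω, g ω * Complex.exp ((⟪b, e n ω⟫ : ℝ) * Complex.I) ∂P -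
        Real.exp (-(q b / 2)) * ∫ ω, g ω ∂P‖ ≤
      4 * ‖b‖ ^ p * M + ‖b‖ ^ 2 * δ n / 2 + (q b / 2) ^ 2 := by
  set x : Ω → ℝ := fun ω => ⟪b, e n ω⟫ with hx
  have hgm : AEStronglyMeasurable g P := (hg.mono (ℱ.le n)).aestronglyMeasurable
  have hxi : Integrable x P := (h.integrable n).const_inner b
  have hxL : MemLp x 2 P := (h.memLp n).const_inner b
  have hxsq : Integrable (fun ω => x ω ^ 2) P := hxL.integrable_sq
  have hgi : Integrable g P := Integrable.of_bound hgm 1 (Eventually.of_forall hg1)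
  have mulg : ∀ {y : Ω → ℂ}, Integrable y P → Integrable (fun ω => g ω * y ω) P := by
    intro y hy
    exact hy.bdd_mul hgm (Eventually.of_forall hg1)
  have hexp : Integrable (fun ω => Complex.exp (x ω * Complex.I)) P := by
    refine Integrable.of_bound ?_ 1 (Eventually.of_forall fun ω =>
      (Complex.norm_exp_ofReal_mul_I _).le)
    exact Complex.continuous_exp.comp_aestronglyMeasurable
      ((Complex.continuous_ofReal.comp_aestronglyMeasurable hxi.1).mul_const _)
  set R : Ω → ℂ := fun ω =>
    Complex.exp (x ω * Complex.I) - 1 - x ω * Complex.I + ((x ω ^ 2 / 2 : ℝ) : ℂ) with hR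
  have hxI : Integrable (fun ω => (x ω : ℂ) * Complex.I) P := hxi.ofReal.mul_const _
  have hx2 : Integrable (fun ω => ((x ω ^ 2 / 2 : ℝ) : ℂ)) P := (hxsq.div_const 2).ofReal
  have hRi : Integrable R P := ((hexp.sub (integrable_const 1)).sub hxI).add hx2
  have hV : Integrable (fun ω => ((x ω ^ 2 - q b : ℝ) : ℂ)) P :=
    (hxsq.sub (integrable_const _)).ofReal
  set κ : ℝ := Real.exp (-(q b / 2)) - 1 + q b / 2 with hκ
  -- Second-order Taylor expansion on both sides: the linear term will have mean zero, the quadratic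
  -- one is compared with q b, and κ is the error in exp(-q/2) ≈ 1 - q/2.
  have key : ∀ ω, g ω * Complex.exp (x ω * Complex.I) - (Real.exp (-(q b / 2)) : ℂ) * g ω =
      g ω * R ω + g ω * (x ω * Complex.I) - 2⁻¹ * (g ω * ((x ω ^ 2 - q b : ℝ) : ℂ)) -
        (κ : ℂ) * g ω := by
    intro ω
    simp only [hR, hκ]
    push_cast
    ring
  have hzero : ∫ ω, g ω * (x ω * Complex.I) ∂P = 0 := by
    have h1 := h.integral_mul_inner_eq_zero hg b (mulg hxi.ofReal)
    simp only [← mul_assoc]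
    rw [integral_mul_const, h1, zero_mul]
  have heq : ∫ ω, g ω * Complex.exp (x ω * Complex.I) ∂P - Real.exp (-(q b / 2)) * ∫ ω, g ω ∂P =
      ∫ ω, g ω * R ω ∂P - 2⁻¹ * ∫ ω, g ω * ((x ω ^ 2 - q b : ℝ) : ℂ) ∂P - κ * ∫ ω, g ω ∂P := by
    rw [← integral_const_mul, ← integral_sub (mulg hexp) (hgi.const_mul _), integral_congr_ae
      (Eventually.of_forall key), integral_sub, integral_sub, integral_add, hzero,
      integral_const_mul, integral_const_mul, add_zero]
    · exact mulg hRi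
    · exact mulg hxI
    · exact (mulg hRi).add (mulg hxI)
    · exact (mulg hV).const_mul _
    · exact ((mulg hRi).add (mulg hxI)).sub ((mulg hV).const_mul _)
    · exact hgi.const_mul _
  have b1 : ‖∫ ω, g ω * R ω ∂P‖ ≤ 4 * ‖b‖ ^ p * M := by
    have hint : Integrable (fun ω => 4 * ‖b‖ ^ p * ‖e n ω‖ ^ p) P :=
      (h.moment_integrable n).const_mul _
    calc _ ≤ ∫ ω, 4 * ‖b‖ ^ p * ‖e n ω‖ ^ p ∂P := by
          refine norm_integral_le_of_norm_le hint (Eventually.of_forall fun ω => ?_)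
          rw [norm_mul]
          calc _ ≤ 1 * (4 * |x ω| ^ p) :=
                mul_le_mul (hg1 ω) (norm_exp_I_sub_taylor_le h.two_lt.le h.le_three _)
                  (norm_nonneg _) zero_le_one
            _ ≤ 4 * (‖b‖ * ‖e n ω‖) ^ p := by
                rw [one_mul]
                gcongr
                · linarith [h.two_lt]
                · exact abs_real_inner_le_norm _ _
            _ = _ := by rw [Real.mul_rpow (norm_nonneg _) (norm_nonneg _)]; ring
      _ = 4 * ‖b‖ ^ p * ∫ ω, ‖e n ω‖ ^ p ∂P := integral_const_mul _ _
      _ ≤ _ := by gcongr; exact h.moment_le n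
  have b2 := h.variance n b g hg hg1
  have b3 : ‖(κ : ℂ) * ∫ ω, g ω ∂P‖ ≤ (q b / 2) ^ 2 := by
    rw [norm_mul, Complex.norm_real]
    calc _ ≤ (q b / 2) ^ 2 * 1 := by
          gcongr
          · exact abs_exp_neg_sub_le (by positivity)
          · simpa using norm_integral_le_of_norm_le_const (μ := P) (Eventually.of_forall hg1)
      _ = _ := mul_one _
  rw [heq]
  refine (norm_sub_le _ _).trans (add_le_add ((norm_sub_le _ _).trans (add_le_add b1 ?_)) b3)
  rw [norm_mul, norm_inv, Complex.norm_ofNat]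
  linarith

/-- Peel off the last summand: the exponential of the earlier sum is known at time m, so the
one-step estimate applies to it, while the accumulated error is multiplied by exp(-q/2) ≤ 1. The
one-step errors therefore simply add. -/
lemma norm_charFun_sum_sub_le (b : ℕ → E) (hq : ∀ b, 0 ≤ q b) (m : ℕ) :
    ‖∫ ω, Complex.exp ((∑ k ∈ Finset.range m, ⟪b k, e k ω⟫ : ℝ) * Complex.I) ∂P -
        Real.exp (-(∑ k ∈ Finset.range m, q (b k)) / 2)‖ ≤
      ∑ k ∈ Finset.range m, (4 * ‖b k‖ ^ p * M + ‖b k‖ ^ 2 * δ k / 2 + (q (b k) / 2) ^ 2) := by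
  induction m with
  | zero => simp
  | succ m ih =>
    set T : Ω → ℝ := fun ω => ∑ k ∈ Finset.range m, ⟪b k, e k ω⟫ with hT
    set g : Ω → ℂ := fun ω => Complex.exp (T ω * Complex.I) with hgdef
    have hTm : StronglyMeasurable[ℱ m] T := by
      refine Finset.stronglyMeasurable_fun_sum _ fun k hk => ?_
      exact (stronglyMeasurable_const).inner (h.stronglyMeasurable_le (Finset.mem_range.1 hk))
    have hg : StronglyMeasurable[ℱ m] g := by
      have hc : Continuous fun t : ℝ => Complex.exp (t * Complex.I) := by fun_prop
      exact hc.comp_stronglyMeasurable hTm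
    have hg1 : ∀ ω, ‖g ω‖ ≤ 1 := fun ω => (Complex.norm_exp_ofReal_mul_I _).le
    have hstep := h.norm_charFun_step_le hg hg1 (b m) (hq _)
    rw [Finset.sum_range_succ _ m, Finset.sum_range_succ _ m]
    have e1 : ∀ ω, Complex.exp ((∑ k ∈ Finset.range (m + 1), ⟪b k, e k ω⟫ : ℝ) * Complex.I) =
        g ω * Complex.exp ((⟪b m, e m ω⟫ : ℝ) * Complex.I) := by
      intro ω
      rw [Finset.sum_range_succ, hgdef, ← Complex.exp_add]
      push_cast
      rw [add_mul]
      simp [hT]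
    have e2 : Real.exp (-(∑ k ∈ Finset.range m, q (b k) + q (b m)) / 2) =
        Real.exp (-(q (b m) / 2)) * Real.exp (-(∑ k ∈ Finset.range m, q (b k)) / 2) := by
      rw [← Real.exp_add]; congr 1; ring
    simp only [e1]
    rw [e2]
    set I := ∫ ω, g ω * Complex.exp ((⟪b m, e m ω⟫ : ℝ) * Complex.I) ∂P
    have hle : Real.exp (-(q (b m) / 2)) ≤ 1 := Real.exp_le_one_iff.2 (by linarith [hq (b m)])
    calc _ = ‖(I - Real.exp (-(q (b m) / 2)) * ∫ ω, g ω ∂P) + Real.exp (-(q (b m) / 2)) *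
          (∫ ω, g ω ∂P - Real.exp (-(∑ k ∈ Finset.range m, q (b k)) / 2))‖ := by
          congr 1; push_cast; ring
      _ ≤ _ + _ := norm_add_le _ _
      _ ≤ _ + 1 * _ := by
          gcongr
          rw [norm_mul, Complex.norm_real, Real.norm_of_nonneg (Real.exp_pos _).le]
          gcongr
      _ ≤ _ := by
          rw [one_mul, add_comm]
          exact add_le_add ih hstep

lemma q_nonneg (b : E) : 0 ≤ q b := by
  obtain ⟨c, hc, hcb⟩ := h.lower
  exact le_trans (by positivity) (hcb b)

/-- Central limit theorem for deterministic linear combinations of a martingale noise. -/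
theorem tendsto_charFun {m : ℕ → ℕ} {b : ℕ → ℕ → E} {β : ℕ → ℝ} {s : ℝ}
    (hβ : Tendsto β atTop (𝓝 0)) (hb : ∀ᶠ n in atTop, ∀ k < m n, ‖b n k‖ ≤ β n)
    (hs : Tendsto (fun n => ∑ k ∈ Finset.range (m n), q (b n k)) atTop (𝓝 s)) :
    Tendsto (fun n => ∫ ω, Complex.exp
      ((∑ k ∈ Finset.range (m n), ⟪b n k, e k ω⟫ : ℝ) * Complex.I) ∂P) atTop
      (𝓝 (Real.exp (-s / 2) : ℂ)) := by
  obtain ⟨c, hc, hcb⟩ := h.lower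
  obtain ⟨c', hcb'⟩ := h.upper
  have hp := h.two_lt
  have hM := h.moment_nonneg
  -- All three error sums are measured against ∑ ‖b‖², which stays bounded because q is coercive and
  -- ∑ q(b) converges.
  set N : ℕ → ℝ := fun n => ∑ k ∈ Finset.range (m n), ‖b n k‖ ^ 2 with hN
  have hN0 : ∀ n, 0 ≤ N n := fun n => Finset.sum_nonneg fun k _ => by positivity
  have hNle : ∀ n, N n ≤ c⁻¹ * ∑ k ∈ Finset.range (m n), q (b n k) := by
    intro n
    rw [Finset.mul_sum]
    refine Finset.sum_le_sum fun k _ => ?_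
    rw [← div_eq_inv_mul, le_div_iff₀ hc, mul_comm]
    exact hcb _
  have hNb : ∀ᶠ n in atTop, N n ≤ c⁻¹ * (s + 1) := by
    filter_upwards [hs.eventually (gt_mem_nhds (lt_add_one s))] with n hn
    exact (hNle n).trans (by gcongr)
  set K := c⁻¹ * (s + 1)
  have hsum1 : Tendsto (fun n => ∑ k ∈ Finset.range (m n), 4 * ‖b n k‖ ^ p * M) atTop (𝓝 0) := by
    have hlim : Tendsto (fun n => 4 * |β n| ^ (p - 2) * M * K) atTop (𝓝 0) := by
      have : Tendsto (fun n => |β n| ^ (p - 2)) atTop (𝓝 0) := by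
        have := (hβ.abs).rpow_const (p := p - 2) (Or.inr (by linarith))
        simpa [Real.zero_rpow (by linarith : p - 2 ≠ 0)] using this
      simpa using ((this.const_mul 4).mul_const M).mul_const K
    refine squeeze_zero' (Eventually.of_forall fun n => Finset.sum_nonneg fun k _ => by positivity)
      ?_ hlim
    filter_upwards [hb, hNb] with n hn hn2
    calc _ ≤ ∑ k ∈ Finset.range (m n), 4 * |β n| ^ (p - 2) * M * ‖b n k‖ ^ 2 := by
          refine Finset.sum_le_sum fun k hk => ?_
          have hk' := (hn k (Finset.mem_range.1 hk)).trans (le_abs_self _)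
          have : ‖b n k‖ ^ p ≤ |β n| ^ (p - 2) * ‖b n k‖ ^ 2 := by
            rcases eq_or_ne ‖b n k‖ 0 with h0 | h0
            · rw [h0, Real.zero_rpow (by linarith)]; positivity
            · have h0' : 0 < ‖b n k‖ := lt_of_le_of_ne (norm_nonneg _) h0.symm
              have : ‖b n k‖ ^ p = ‖b n k‖ ^ (p - 2) * ‖b n k‖ ^ 2 := by
                rw [← Real.rpow_natCast, ← Real.rpow_add h0']; norm_num
              rw [this]
              gcongr
          calc _ ≤ 4 * (|β n| ^ (p - 2) * ‖b n k‖ ^ 2) * M := by gcongr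
            _ = _ := by ring
      _ = 4 * |β n| ^ (p - 2) * M * N n := by rw [← Finset.mul_sum]
      _ ≤ _ := by gcongr
  have hsum3 : Tendsto (fun n => ∑ k ∈ Finset.range (m n), (q (b n k) / 2) ^ 2) atTop (𝓝 0) := by
    have hlim : Tendsto (fun n => c' ^ 2 * β n ^ 2 * K) atTop (𝓝 0) := by
      simpa using ((hβ.pow 2).const_mul (c' ^ 2)).mul_const K
    refine squeeze_zero' (Eventually.of_forall fun n => Finset.sum_nonneg fun k _ => by positivity)
      ?_ hlim
    filter_upwards [hb, hNb] with n hn hn2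
    calc _ ≤ ∑ k ∈ Finset.range (m n), c' ^ 2 * β n ^ 2 * ‖b n k‖ ^ 2 := by
          refine Finset.sum_le_sum fun k hk => ?_
          have hk' := hn k (Finset.mem_range.1 hk)
          have h0 := h.q_nonneg (b n k)
          have h1 : (q (b n k) / 2) ^ 2 ≤ q (b n k) ^ 2 := by nlinarith
          have h2 : q (b n k) ^ 2 ≤ (c' * ‖b n k‖ ^ 2) ^ 2 := by gcongr; exact hcb' _
          have h3 : ‖b n k‖ ^ 2 ≤ β n ^ 2 := by gcongr
          calc _ ≤ (c' * ‖b n k‖ ^ 2) ^ 2 := h1.trans h2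
            _ = c' ^ 2 * ‖b n k‖ ^ 2 * ‖b n k‖ ^ 2 := by ring
            _ ≤ _ := by gcongr
      _ = c' ^ 2 * β n ^ 2 * N n := by rw [← Finset.mul_sum]
      _ ≤ _ := by gcongr
  -- A Toeplitz argument: the first k₀ indices carry vanishing weight because ‖b n k‖ ≤ β n, and the
  -- later ones have small δ against a bounded total weight.
  have hsum2 : Tendsto (fun n => ∑ k ∈ Finset.range (m n), ‖b n k‖ ^ 2 * |δ k| / 2) atTop
      (𝓝 0) := by
    have hδ := h.tendsto_error.abs
    rw [abs_zero] at hδ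
    rw [Metric.tendsto_nhds]
    intro ε hε
    have hK : 0 < |K| + 1 := by positivity
    obtain ⟨k₀, hk₀⟩ := eventually_atTop.1 (hδ.eventually (gt_mem_nhds
      (show 0 < ε / (|K| + 1) by positivity)))
    have hfirst : Tendsto (fun n => ∑ k ∈ Finset.range k₀, β n ^ 2 * |δ k|) atTop (𝓝 0) := by
      rw [← Finset.sum_const_zero (s := Finset.range k₀)]
      refine tendsto_finsetSum _ fun k _ => ?_
      simpa using (hβ.pow 2).mul_const |δ k|
    filter_upwards [hb, hNb, hfirst.eventually (gt_mem_nhds hε)] with n hn hn2 hn3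
    have hnn : 0 ≤ ∑ k ∈ Finset.range (m n), ‖b n k‖ ^ 2 * |δ k| / 2 :=
      Finset.sum_nonneg fun k _ => by positivity
    rw [Real.dist_0_eq_abs, abs_of_nonneg hnn]
    have hsplit : ∑ k ∈ Finset.range (m n), ‖b n k‖ ^ 2 * |δ k| ≤
        ∑ k ∈ Finset.range k₀, β n ^ 2 * |δ k| + ε / (|K| + 1) * N n := by
      rw [← Finset.sum_filter_add_sum_filter_not (Finset.range (m n)) (· < k₀)]
      refine add_le_add ?_ ?_
      · calc _ ≤ ∑ k ∈ Finset.range (m n) with k < k₀, β n ^ 2 * |δ k| := by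
              refine Finset.sum_le_sum fun k hk => ?_
              have := hn k (Finset.mem_range.1 (Finset.mem_filter.1 hk).1)
              gcongr
          _ ≤ _ := by
              refine Finset.sum_le_sum_of_subset_of_nonneg (fun k hk => ?_)
                (fun k _ _ => by positivity)
              exact Finset.mem_range.2 (Finset.mem_filter.1 hk).2
      · rw [hN, Finset.mul_sum]
        calc _ ≤ ∑ k ∈ Finset.range (m n) with ¬k < k₀, ε / (|K| + 1) * ‖b n k‖ ^ 2 := by
              refine Finset.sum_le_sum fun k hk => ?_
              have := (hk₀ k (not_lt.1 (Finset.mem_filter.1 hk).2)).le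
              rw [mul_comm]
              gcongr
          _ ≤ _ := Finset.sum_le_sum_of_subset_of_nonneg (Finset.filter_subset _ _)
              (fun k _ _ => by positivity)
    have h4 : ε / (|K| + 1) * N n ≤ ε := by
      rw [div_mul_eq_mul_div, div_le_iff₀ hK]
      have := hn2.trans (le_abs_self K)
      nlinarith
    rw [← Finset.sum_div]
    linarith
  have hdiff : Tendsto (fun n => ∫ ω, Complex.exp
      ((∑ k ∈ Finset.range (m n), ⟪b n k, e k ω⟫ : ℝ) * Complex.I) ∂P -
      (Real.exp (-(∑ k ∈ Finset.range (m n), q (b n k)) / 2) : ℂ)) atTop (𝓝 0) := by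
    have htot := (hsum1.add hsum2).add hsum3
    simp only [add_zero] at htot
    refine squeeze_zero_norm (fun n => (h.norm_charFun_sum_sub_le (b n) h.q_nonneg (m n)).trans ?_)
      htot
    rw [← Finset.sum_add_distrib, ← Finset.sum_add_distrib]
    refine Finset.sum_le_sum fun k _ => ?_
    gcongr
    exact le_abs_self _
  have hG : Tendsto (fun n => (Real.exp (-(∑ k ∈ Finset.range (m n), q (b n k)) / 2) : ℂ)) atTop
      (𝓝 (Real.exp (-s / 2) : ℂ)) := by
    have hc : Continuous fun t : ℝ => ((Real.exp (-t / 2) : ℝ) : ℂ) := by fun_prop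
    exact (hc.tendsto s).comp hs
  simpa using hdiff.add hG

end IsMartingaleNoise

end WhiteNoise

/-! ### Second moments of noise sums and the multivariate central limit theorem. -/

section NoiseSums

open scoped RealInnerProductSpace

lemma integrable_inner_of_memLp {Ω F : Type*} [MeasurableSpace Ω] [NormedAddCommGroup F]
    [InnerProductSpace ℝ F] {P : Measure Ω} {u v : Ω → F} (hu : MemLp u 2 P) (hv : MemLp v 2 P) :
    Integrable (fun ω => ⟪u ω, v ω⟫) P :=
  (hu.norm.integrable_mul hv.norm).mono' (hu.1.inner hv.1)
    (Eventually.of_forall fun _ => norm_inner_le_norm _ _)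

variable {Ω E F : Type*} [mΩ : MeasurableSpace Ω] [NormedAddCommGroup E] [InnerProductSpace ℝ E]
  [CompleteSpace E] [NormedAddCommGroup F] [InnerProductSpace ℝ F] [CompleteSpace F]
  {P : Measure Ω} [IsProbabilityMeasure P] {ℱ : Filtration ℕ mΩ} {e : ℕ → Ω → E} {p M : ℝ}

lemma eLpNorm_two_eq {u : Ω → F} (hu : MemLp u 2 P) :
    eLpNorm u 2 P = ENNReal.ofReal (Real.sqrt (∫ ω, ‖u ω‖ ^ 2 ∂P)) := by
  rw [hu.eLpNorm_eq_integral_rpow_norm two_ne_zero ENNReal.ofNat_ne_top]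
  simp [Real.sqrt_eq_rpow]

namespace IsMartingaleDiff

variable (h : IsMartingaleDiff P ℱ e p M)

include h

lemma memLp_sum (B : ℕ → E →L[ℝ] F) (s : Finset ℕ) :
    MemLp (fun ω => ∑ k ∈ s, B k (e k ω)) 2 P :=
  memLp_finsetSum s fun k _ => (B k).comp_memLp' (h.memLp k)

lemma stronglyMeasurable_sum_range (B : ℕ → E →L[ℝ] F) (m : ℕ) :
    StronglyMeasurable[ℱ m] (fun ω => ∑ k ∈ Finset.range m, B k (e k ω)) :=
  Finset.stronglyMeasurable_fun_sum _ fun k hk =>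
    (B k).continuous.comp_stronglyMeasurable (h.stronglyMeasurable_le (Finset.mem_range.1 hk))

lemma integral_inner_eq_zero {n : ℕ} {u : Ω → F} (hu : StronglyMeasurable[ℱ n] u)
    (hu2 : MemLp u 2 P) (B : E →L[ℝ] F) : ∫ ω, ⟪u ω, B (e n ω)⟫ ∂P = 0 := by
  let L : F →L[ℝ] E →L[ℝ] ℝ :=
    ((isBoundedBilinearMap_inner (𝕜 := ℝ) (E := F)).toContinuousLinearMap).bilinearComp
      (ContinuousLinearMap.id ℝ F) B
  exact h.integral_bilin_eq_zero L hu (integrable_inner_of_memLp hu2 (B.comp_memLp' (h.memLp n)))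

/-- Martingale increments are orthogonal in L². -/
lemma integral_norm_sq_sum_range (B : ℕ → E →L[ℝ] F) (m : ℕ) :
    ∫ ω, ‖∑ k ∈ Finset.range m, B k (e k ω)‖ ^ 2 ∂P =
      ∑ k ∈ Finset.range m, ∫ ω, ‖B k (e k ω)‖ ^ 2 ∂P := by
  induction m with
  | zero => simp
  | succ m ih =>
    rw [Finset.sum_range_succ, ← ih]
    have h1 := h.memLp_sum B (Finset.range m)
    have h2 := (B m).comp_memLp' (h.memLp m)
    have h0 := h.integral_inner_eq_zero (h.stronglyMeasurable_sum_range B m) h1 (B m)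
    simp only [Finset.sum_range_succ, norm_add_sq_real]
    rw [integral_add, integral_add, integral_const_mul, h0, mul_zero, add_zero]
    · exact h1.integrable_norm_pow two_ne_zero
    · exact (integrable_inner_of_memLp h1 h2).const_mul 2
    · exact (h1.integrable_norm_pow two_ne_zero).add ((integrable_inner_of_memLp h1 h2).const_mul 2)
    · exact h2.integrable_norm_pow two_ne_zero

lemma integral_norm_sq_apply_le (B : E →L[ℝ] F) (n : ℕ) :
    ∫ ω, ‖B (e n ω)‖ ^ 2 ∂P ≤ ‖B‖ ^ 2 * (1 + M) := by
  calc _ ≤ ∫ ω, ‖B‖ ^ 2 * ‖e n ω‖ ^ 2 ∂P := by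
        refine integral_mono ((B.comp_memLp' (h.memLp n)).integrable_norm_pow two_ne_zero)
          ((h.integrable_sq n).const_mul _) fun ω => ?_
        rw [← mul_pow]
        exact pow_le_pow_left₀ (norm_nonneg _) (B.le_opNorm _) 2
    _ = ‖B‖ ^ 2 * ∫ ω, ‖e n ω‖ ^ 2 ∂P := integral_const_mul _ _
    _ ≤ _ := by gcongr; exact h.integral_sq_le n

lemma integral_norm_sq_sum_le (B : ℕ → E →L[ℝ] F) (s : Finset ℕ) :
    ∫ ω, ‖∑ k ∈ s, B k (e k ω)‖ ^ 2 ∂P ≤ (1 + M) * ∑ k ∈ s, ‖B k‖ ^ 2 := by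
  classical
  -- Extension by zero reduces an arbitrary index set to an initial segment, where orthogonality is
  -- available.
  set B' : ℕ → E →L[ℝ] F := fun k => if k ∈ s then B k else 0
  set m := s.sup id + 1
  have hs : s ⊆ Finset.range m := fun k hk =>
    Finset.mem_range.2 (Nat.lt_succ_of_le (Finset.le_sup (f := id) hk))
  have e1 : ∀ ω, ∑ k ∈ s, B k (e k ω) = ∑ k ∈ Finset.range m, B' k (e k ω) := by
    intro ω
    rw [← Finset.sum_subset hs (f := fun k => B' k (e k ω)) (fun k _ hk => by simp [B', hk])]
    exact Finset.sum_congr rfl fun k hk => by simp [B', hk]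
  have e2 : ∑ k ∈ s, ‖B k‖ ^ 2 = ∑ k ∈ Finset.range m, ‖B' k‖ ^ 2 := by
    rw [← Finset.sum_subset hs (f := fun k => ‖B' k‖ ^ 2) (fun k _ hk => by simp [B', hk])]
    exact Finset.sum_congr rfl fun k hk => by simp [B', hk]
  simp only [e1]
  rw [e2, h.integral_norm_sq_sum_range B' m, Finset.mul_sum]
  exact Finset.sum_le_sum fun k _ =>
    (h.integral_norm_sq_apply_le (B' k) k).trans (le_of_eq (mul_comm _ _))

lemma eLpNorm_sum_le (B : ℕ → E →L[ℝ] F) (s : Finset ℕ) :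
    eLpNorm (fun ω => ∑ k ∈ s, B k (e k ω)) 2 P ≤
      ENNReal.ofReal (Real.sqrt ((1 + M) * ∑ k ∈ s, ‖B k‖ ^ 2)) := by
  rw [eLpNorm_two_eq (h.memLp_sum B s)]
  exact ENNReal.ofReal_le_ofReal (Real.sqrt_le_sqrt (h.integral_norm_sq_sum_le B s))

end IsMartingaleDiff

namespace IsMartingaleNoise

variable {q : E → ℝ} {δ : ℕ → ℝ} (h : IsMartingaleNoise P ℱ e q p M δ)

include h

variable [MeasurableSpace F] [BorelSpace F] [FiniteDimensional ℝ F]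

/-- Multivariate central limit theorem for linear images of a martingale noise, up to a remainder
that vanishes in mean. -/
theorem convergesInLaw {Y : ℕ → Ω → F} (hY : ∀ n, AEMeasurable (Y n) P) {m : ℕ → ℕ}
    {B : ℕ → ℕ → E →L[ℝ] F} {β : ℕ → ℝ} (hβ : Tendsto β atTop (𝓝 0))
    (hB : ∀ᶠ n in atTop, ∀ k < m n, ‖B n k‖ ≤ β n)
    (hR : Tendsto (fun n => eLpNorm
      (fun ω => Y n ω - ∑ k ∈ Finset.range (m n), B n k (e k ω)) 1 P) atTop (𝓝 0))
    (ν : Measure F) [IsProbabilityMeasure ν]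
    (hν : ∀ t : F, ∃ s : ℝ, charFun ν t = (Real.exp (-s / 2) : ℂ) ∧
      Tendsto (fun n => ∑ k ∈ Finset.range (m n), q ((B n k).adjoint t)) atTop (𝓝 s)) :
    ConvergesInLaw P Y ν := by
  set X : ℕ → Ω → F := fun n ω => ∑ k ∈ Finset.range (m n), B n k (e k ω) with hX
  have hXm : ∀ n, AEMeasurable (X n) P := fun n =>
    (h.memLp_sum (B n) (Finset.range (m n))).1.aemeasurable
  have hXlaw : TendstoInDistribution X atTop (id : F → F) (fun _ => P) ν := by
    refine ⟨hXm, aemeasurable_id, ?_⟩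
    -- Lévy's continuity theorem; adjoints move the operators onto the test vector and reduce to the
    -- scalar statement.
    refine ProbabilityMeasure.tendsto_of_tendsto_charFun fun t => ?_
    obtain ⟨s, hs1, hs2⟩ := hν t
    simp only [ProbabilityMeasure.coe_mk, Measure.map_id]
    rw [hs1]
    have hb : ∀ᶠ n in atTop, ∀ k < m n, ‖(B n k).adjoint t‖ ≤ β n * ‖t‖ := by
      filter_upwards [hB] with n hn k hk
      refine ((B n k).adjoint.le_opNorm t).trans ?_
      rw [LinearIsometryEquiv.norm_map]
      gcongr
      exact hn k hk
    have := h.tendsto_charFun (b := fun n k => (B n k).adjoint t) (β := fun n => β n * ‖t‖)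
      (by simpa using hβ.mul_const ‖t‖) hb hs2
    refine this.congr fun n => ?_
    rw [charFun_apply, integral_map (hXm n) (by fun_prop)]
    refine integral_congr_ae (Eventually.of_forall fun ω => ?_)
    simp only [hX, sum_inner, ContinuousLinearMap.adjoint_inner_left]
    simp only [real_inner_comm t]
  -- Slutsky: the remainder vanishes in L¹, hence in probability.
  refine tendstoInDistribution_of_tendstoInMeasure_sub Y id hXlaw ?_ hY
  refine tendstoInMeasure_of_tendsto_eLpNorm one_ne_zero
    (fun n => ((hY n).sub (hXm n)).aestronglyMeasurable) aestronglyMeasurable_zero ?_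
  simpa [hX, Pi.sub_def] using hR

end IsMartingaleNoise

end NoiseSums

/-! ### The walk as a linear filter of its martingale increments. -/

section Walk

open scoped RealInnerProductSpace Matrix.Norms.L2Operator

variable {Ω : Type*} [mΩ : MeasurableSpace Ω] {d : ℕ}

/-- The operator of a matrix on the Euclidean space. -/
abbrev opOf (B : Matrix (Fin d) (Fin d) ℝ) :
    EuclideanSpace ℝ (Fin d) →L[ℝ] EuclideanSpace ℝ (Fin d) :=
  Matrix.toEuclideanCLM (𝕜 := ℝ) B

lemma act_eq (B : Matrix (Fin d) (Fin d) ℝ) (x : EuclideanSpace ℝ (Fin d)) :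
    act B x = opOf B x := rfl

lemma norm_opOf (B : Matrix (Fin d) (Fin d) ℝ) : ‖opOf B‖ = ‖B‖ := rfl

lemma opOf_mul_apply (B C : Matrix (Fin d) (Fin d) ℝ) (x : EuclideanSpace ℝ (Fin d)) :
    opOf (B * C) x = opOf B (opOf C x) := by
  rw [opOf, map_mul]; rfl

lemma adjoint_opOf (B : Matrix (Fin d) (Fin d) ℝ) : (opOf B).adjoint = opOf Bᵀ := by
  rw [← ContinuousLinearMap.star_eq_adjoint, opOf, opOf, ← map_star,
    Matrix.star_eq_conjTranspose, Matrix.conjTranspose_eq_transpose_of_trivial]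

/-- The filtration generated by the increments. -/
def pastFiltration (X : ℕ → Ω → EuclideanSpace ℝ (Fin d)) (hX : ∀ n, 1 ≤ n → Measurable (X n)) :
    Filtration ℕ mΩ where
  seq := past X
  mono' := by
    intro m n hmn
    refine iSup₂_le fun k hk => ?_
    refine le_iSup₂_of_le k ?_ le_rfl
    rw [Finset.mem_Icc] at hk ⊢
    exact ⟨hk.1, hk.2.trans hmn⟩
  le' := by
    intro n
    exact iSup₂_le fun k hk => (hX k (Finset.mem_Icc.1 hk).1).comap_le

/-- The martingale increments of the walk. -/
def noise (X : ℕ → Ω → EuclideanSpace ℝ (Fin d)) (A : Matrix (Fin d) (Fin d) ℝ) (n : ℕ) (ω : Ω) :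
    EuclideanSpace ℝ (Fin d) :=
  X (n + 1) ω - (1 / (n : ℝ)) • opOf A (walk X n ω)

lemma walk_succ (X : ℕ → Ω → EuclideanSpace ℝ (Fin d)) (n : ℕ) (ω : Ω) :
    walk X (n + 1) ω = walk X n ω + X (n + 1) ω := by
  rw [walk, Finset.sum_Icc_succ_top (by lia), walk]

/-- Variation of constants for S (n+1) = (1 + A/n) S n + e n. The convention 1/0 = 0 makes e 0 equal
to X 1, so the formula starts correctly. -/
lemma walk_eq_sum {A : Matrix (Fin d) (Fin d) ℝ} (hA : ∀ n : ℕ, IsUnit (1 + (1 / (n : ℝ)) • A))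
    (X : ℕ → Ω → EuclideanSpace ℝ (Fin d)) (n : ℕ) (ω : Ω) :
    walk X n ω = ∑ k ∈ Finset.range n, opOf (transition A n (k + 1)) (noise X A k ω) := by
  induction n with
  | zero => simp [walk]
  | succ n ih =>
    have e : X (n + 1) ω = noise X A n ω + (1 / (n : ℝ)) • opOf A (walk X n ω) := by
      rw [noise, sub_add_cancel]
    rw [walk_succ, Finset.sum_range_succ, transition_self hA]
    simp only [transition_succ_left, opOf_mul_apply]
    rw [← map_sum, ← ih, e]
    simp only [opOf, map_add, map_one, map_smul, _root_.add_apply,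
      one_apply_eq_self, _root_.smul_apply]
    abel

variable {X : ℕ → Ω → EuclideanSpace ℝ (Fin d)}

lemma measurable_past {k n : ℕ} (h1 : 1 ≤ k) (h2 : k ≤ n) : Measurable[past X n] (X k) := by
  have : MeasurableSpace.comap (X k) inferInstance ≤ past X n :=
    le_iSup₂_of_le k (Finset.mem_Icc.2 ⟨h1, h2⟩) le_rfl
  exact (comap_measurable (X k)).mono this le_rfl

lemma stronglyMeasurable_walk (n : ℕ) : StronglyMeasurable[past X n] (walk X n) := by
  have : walk X n = fun ω => ∑ k ∈ Finset.Icc 1 n, X k ω := rfl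
  rw [this]
  refine Finset.stronglyMeasurable_fun_sum _ fun k hk => ?_
  rw [Finset.mem_Icc] at hk
  exact (measurable_past hk.1 hk.2).stronglyMeasurable

lemma past_mono {m n : ℕ} (h : m ≤ n) : past X m ≤ past X n := by
  refine iSup₂_le fun k hk => ?_
  refine le_iSup₂_of_le k ?_ le_rfl
  rw [Finset.mem_Icc] at hk ⊢
  exact ⟨hk.1, hk.2.trans h⟩

lemma stronglyMeasurable_noise (A : Matrix (Fin d) (Fin d) ℝ) (n : ℕ) :
    StronglyMeasurable[past X (n + 1)] (noise X A n) := by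
  have h1 : StronglyMeasurable[past X (n + 1)] (X (n + 1)) :=
    (measurable_past (by lia) le_rfl).stronglyMeasurable
  have h2 : StronglyMeasurable[past X (n + 1)] (fun ω => opOf A (walk X n ω)) :=
    (opOf A).continuous.comp_stronglyMeasurable
      ((stronglyMeasurable_walk n).mono (past_mono (Nat.le_succ n)))
  exact h1.sub (h2.fun_const_smul _)

variable {P : Measure Ω} [IsProbabilityMeasure P] {A Sig : Matrix (Fin d) (Fin d) ℝ}

/-- The exponent is lowered to min p 3, the range in which `norm_exp_I_sub_taylor_le` applies. -/
lemma IsLinearRWSD.exists_eLpNorm_le (hX : IsLinearRWSD P X A Sig) :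
    ∃ p : ℝ, 2 < p ∧ p ≤ 3 ∧ ∃ C : ℝ, 0 ≤ C ∧ ∀ n, 1 ≤ n →
      eLpNorm (X n) (ENNReal.ofReal p) P ≤ ENNReal.ofReal C := by
  obtain ⟨p, hp, hS⟩ := hX.moment
  set S := ⨆ (n : ℕ) (_ : 1 ≤ n), ∫⁻ ω, ‖X n ω‖ₑ ^ p ∂P
  have hp0 : 0 < p := by linarith
  have hfin : S ^ (1 / p) ≠ ∞ := (ENNReal.rpow_lt_top_of_nonneg (by positivity) hS.ne).ne
  refine ⟨min p 3, lt_min hp (by norm_num), min_le_right _ _, (S ^ (1 / p)).toReal,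
    ENNReal.toReal_nonneg, fun n hn => ?_⟩
  rw [ENNReal.ofReal_toReal hfin]
  have hm : AEStronglyMeasurable (X n) P := (hX.measurable n hn).aestronglyMeasurable
  refine (eLpNorm_le_eLpNorm_of_exponent_le (ENNReal.ofReal_le_ofReal (min_le_left p 3)) hm).trans ?_
  rw [eLpNorm_eq_lintegral_rpow_enorm_toReal (by simpa using hp0) ENNReal.ofReal_ne_top,
    ENNReal.toReal_ofReal hp0.le]
  exact ENNReal.rpow_le_rpow (le_iSup₂ (f := fun (n : ℕ) (_ : 1 ≤ n) => ∫⁻ ω, ‖X n ω‖ₑ ^ p ∂P) n hn)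
    (by positivity)

/-- By the triangle inequality S n has L^p norm at most nC, so the drift A S n / n, and with it the
noise, is bounded in L^p uniformly in n. -/
lemma IsLinearRWSD.isMartingaleDiff (hX : IsLinearRWSD P X A Sig) :
    ∃ p M, IsMartingaleDiff P (pastFiltration X hX.measurable) (noise X A) p M := by
  obtain ⟨p, hp, hp3, C, hC, hCX⟩ := hX.exists_eLpNorm_le
  have hp0 : 0 < p := by linarith
  have hmX : ∀ n, 1 ≤ n → AEStronglyMeasurable (X n) P := fun n hn =>
    (hX.measurable n hn).aestronglyMeasurable
  have hone : (1 : ℝ≥0∞) ≤ ENNReal.ofReal p := by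
    rw [← ENNReal.ofReal_one]; exact ENNReal.ofReal_le_ofReal (by linarith)
  have htwo : (2 : ℝ≥0∞) ≤ ENNReal.ofReal p := by
    rw [show (2 : ℝ≥0∞) = ENNReal.ofReal 2 by norm_num]
    exact ENNReal.ofReal_le_ofReal (by linarith)
  have hwalk : ∀ n, eLpNorm (walk X n) (ENNReal.ofReal p) P ≤ ENNReal.ofReal (n * C) := by
    intro n
    have e : walk X n = ∑ k ∈ Finset.Icc 1 n, X k := by
      funext ω; simp [walk]
    rw [e]
    refine (eLpNorm_sum_le (fun k hk => hmX k (Finset.mem_Icc.1 hk).1) hone).trans ?_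
    refine (Finset.sum_le_sum fun k hk => hCX k (Finset.mem_Icc.1 hk).1).trans ?_
    rw [Finset.sum_const, Nat.card_Icc, Nat.add_sub_cancel, nsmul_eq_mul,
      ENNReal.ofReal_mul (Nat.cast_nonneg n), ENNReal.ofReal_natCast]
  have hwm : ∀ n, AEStronglyMeasurable (walk X n) P := fun n =>
    ((stronglyMeasurable_walk n).mono ((pastFiltration X hX.measurable).le n)).aestronglyMeasurable
  have hnm : ∀ n, AEStronglyMeasurable (noise X A n) P := fun n =>
    ((stronglyMeasurable_noise A n).mono
      ((pastFiltration X hX.measurable).le (n + 1))).aestronglyMeasurable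
  have hdm : ∀ n : ℕ, AEStronglyMeasurable (fun ω => (1 / (n : ℝ)) • opOf A (walk X n ω)) P := fun n =>
    ((opOf A).continuous.comp_aestronglyMeasurable (hwm n)).fun_const_smul _
  have hdrift : ∀ n : ℕ, eLpNorm (fun ω => (1 / (n : ℝ)) • opOf A (walk X n ω)) (ENNReal.ofReal p) P ≤
      ENNReal.ofReal (‖A‖ * C) := by
    intro n
    refine (eLpNorm_le_mul_eLpNorm_of_ae_le_mul (g := walk X n) (c := 1 / (n : ℝ) * ‖A‖)
      (Eventually.of_forall fun ω => ?_) _).trans ?_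
    · rw [norm_smul, Real.norm_of_nonneg (by positivity), mul_assoc]
      gcongr
      exact (opOf A).le_opNorm _
    · refine (mul_le_mul_right (hwalk n) _).trans ?_
      rw [← ENNReal.ofReal_mul (by positivity)]
      refine ENNReal.ofReal_le_ofReal ?_
      rcases Nat.eq_zero_or_pos n with rfl | hn
      · simp; positivity
      · have : (0 : ℝ) < n := by exact_mod_cast hn
        refine le_of_eq ?_
        field_simp
  have hnoise : ∀ n, eLpNorm (noise X A n) (ENNReal.ofReal p) P ≤
      ENNReal.ofReal (C + ‖A‖ * C) := by
    intro n
    rw [ENNReal.ofReal_add hC (by positivity)]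
    exact (eLpNorm_sub_le (hmX (n + 1) (by lia)) (hdm n) hone).trans
      (add_le_add (hCX (n + 1) (by lia)) (hdrift n))
  have hLp : ∀ n, MemLp (noise X A n) (ENNReal.ofReal p) P := fun n =>
    ⟨hnm n, (hnoise n).trans_lt ENNReal.ofReal_lt_top⟩
  have hint : ∀ n, Integrable (fun ω => ‖noise X A n ω‖ ^ p) P := by
    intro n
    have := (hLp n).integrable_norm_rpow (by simpa using hp0) ENNReal.ofReal_ne_top
    rwa [ENNReal.toReal_ofReal hp0.le] at this
  have hXint : ∀ n, 1 ≤ n → Integrable (X n) P := fun n hn =>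
    MemLp.integrable hone ⟨hmX n hn, (hCX n hn).trans_lt ENNReal.ofReal_lt_top⟩
  have hdint : ∀ n : ℕ, Integrable (fun ω => (1 / (n : ℝ)) • opOf A (walk X n ω)) P := fun n =>
    MemLp.integrable hone ⟨hdm n, (hdrift n).trans_lt ENNReal.ofReal_lt_top⟩
  refine ⟨p, (C + ‖A‖ * C) ^ p, ?_, ?_, hp, hp3, hint, ?_, ?_⟩
  · exact fun n => stronglyMeasurable_noise A n
  · exact fun n => (hLp n).mono_exponent htwo
  · intro n
    have h1 := hnoise n
    rw [(hLp n).eLpNorm_eq_integral_rpow_norm (by simpa using hp0) ENNReal.ofReal_ne_top,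
      ENNReal.toReal_ofReal hp0.le, ENNReal.ofReal_le_ofReal_iff (by positivity)] at h1
    have h2 : 0 ≤ ∫ ω, ‖noise X A n ω‖ ^ p ∂P := integral_nonneg fun ω => by positivity
    calc _ = ((∫ ω, ‖noise X A n ω‖ ^ p ∂P) ^ p⁻¹) ^ p := by
          rw [← Real.rpow_mul h2, inv_mul_cancel₀ hp0.ne', Real.rpow_one]
      _ ≤ _ := Real.rpow_le_rpow (by positivity) h1 hp0.le
  · intro n
    rcases Nat.eq_zero_or_pos n with rfl | hn
    · have hbot : (pastFiltration X hX.measurable) 0 = ⊥ := by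
        change past X 0 = ⊥
        simp [past]
      rw [hbot, condExp_bot]
      have : ∫ ω, noise X A 0 ω ∂P = 0 := by
        simp only [noise, CharP.cast_eq_zero, div_zero, zero_smul, sub_zero, zero_add]
        exact hX.mean_one
      rw [this]; rfl
    · have h1 := condExp_sub (hXint (n + 1) (by lia)) (hdint n) (past X n)
      have h2 : P[fun ω => (1 / (n : ℝ)) • opOf A (walk X n ω) | past X n] =
          fun ω => (1 / (n : ℝ)) • opOf A (walk X n ω) :=
        condExp_of_stronglyMeasurable ((pastFiltration X hX.measurable).le n)
          (((opOf A).continuous.comp_stronglyMeasurable (stronglyMeasurable_walk n)).fun_const_smul _)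
          (hdint n)
      have h3 := hX.drift n hn
      filter_upwards [h1, h3] with ω h4 h5
      refine h4.trans ?_
      rw [Pi.sub_apply, h5, h2]
      simp [act_eq]

/-- Orthogonality and Φ(n,k) = O((n/k)^α) bound the second moment by a multiple of n^{2α} ∑ k^{-2α},
where the series converges because α > 1/2. As λ_max < 1 some α < 1 is admissible, so S n / n tends
to 0 in L² in every regime. -/
lemma IsMartingaleDiff.exists_integral_norm_sq_walk_le {ℱ : Filtration ℕ mΩ} {p M : ℝ}
    (h : IsMartingaleDiff P ℱ (noise X A) p M) (hA : ∀ n : ℕ, IsUnit (1 + (1 / (n : ℝ)) • A))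
    {α K : ℝ} (hα : ∀ t, 0 ≤ t → ‖flow A t‖ ≤ K * Real.exp (α * t)) (hα1 : 1 / 2 < α) :
    ∃ C, 0 ≤ C ∧ ∀ n, ∫ ω, ‖walk X n ω‖ ^ 2 ∂P ≤ C * (n : ℝ) ^ (2 * α) := by
  obtain ⟨C, hC, hΦ⟩ := norm_transition_le hA hα
  have hM := h.moment_nonneg
  have hsum : Summable fun k : ℕ => 1 / (k : ℝ) ^ (2 * α) :=
    Real.summable_one_div_nat_rpow.2 (by linarith)
  set b : ℝ := ∑' k : ℕ, 1 / (k : ℝ) ^ (2 * α)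
  have hb : 0 ≤ b := tsum_nonneg fun k => by positivity
  refine ⟨(1 + M) * (C ^ 2 * b), by positivity, fun n => ?_⟩
  simp only [walk_eq_sum hA]
  refine (h.integral_norm_sq_sum_le (fun k => opOf (transition A n (k + 1)))
    (Finset.range n)).trans ?_
  rw [mul_assoc (1 + M)]
  gcongr
  calc _ ≤ ∑ k ∈ Finset.range n, C ^ 2 * (n : ℝ) ^ (2 * α) *
        (1 / ((k + 1 : ℕ) : ℝ) ^ (2 * α)) := by
        refine Finset.sum_le_sum fun k hk => ?_
        have hk' : k + 1 ≤ n := Finset.mem_range.1 hk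
        have hn0 : (0 : ℝ) < n := by
          have : 0 < n := by lia
          exact_mod_cast this
        rw [norm_opOf]
        calc _ ≤ (C * ((n : ℝ) / ((k + 1 : ℕ) : ℝ)) ^ α) ^ 2 := by
              gcongr; exact hΦ n (k + 1) (by lia) hk'
          _ = _ := by
              rw [mul_pow, ← Real.rpow_natCast (((n : ℝ) / ((k + 1 : ℕ) : ℝ)) ^ α),
                ← Real.rpow_mul (by positivity), Real.div_rpow hn0.le (by positivity)]
              push_cast
              rw [mul_comm α 2]
              ring
    _ = C ^ 2 * (n : ℝ) ^ (2 * α) * ∑ k ∈ Finset.range n, (1 / ((k + 1 : ℕ) : ℝ) ^ (2 * α)) := by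
        rw [Finset.mul_sum]
    _ ≤ C ^ 2 * (n : ℝ) ^ (2 * α) * b := by
        gcongr
        have h1 := Finset.sum_range_succ' (fun k : ℕ => 1 / (k : ℝ) ^ (2 * α)) n
        have h2 : ∑ k ∈ Finset.range (n + 1), 1 / (k : ℝ) ^ (2 * α) ≤ b :=
          hsum.sum_le_tsum _ fun k _ => by positivity
        have h3 : 0 ≤ 1 / ((0 : ℕ) : ℝ) ^ (2 * α) := by positivity
        linarith
    _ = _ := by ring

end Walk

/-! ### Conditional covariance of the noise. -/

section Noise

open scoped RealInnerProductSpace Matrix.Norms.L2Operator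

variable {Ω : Type*} [mΩ : MeasurableSpace Ω] {d : ℕ}

/-- The quadratic form of a matrix. -/
def quadForm (Sig : Matrix (Fin d) (Fin d) ℝ) (b : EuclideanSpace ℝ (Fin d)) : ℝ :=
  ⟪b, opOf Sig b⟫

lemma quadForm_eq_sum (Sig : Matrix (Fin d) (Fin d) ℝ) (b : EuclideanSpace ℝ (Fin d)) :
    quadForm Sig b = ∑ i, ∑ j, b i * b j * Sig i j := by
  rw [quadForm, Matrix.inner_toEuclideanCLM, dotProduct]
  refine Finset.sum_congr rfl fun i _ => ?_
  rw [Matrix.mulVec, dotProduct, Finset.mul_sum]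
  exact Finset.sum_congr rfl fun j _ => by ring

lemma abs_quadForm_le (Sig : Matrix (Fin d) (Fin d) ℝ) (b : EuclideanSpace ℝ (Fin d)) :
    |quadForm Sig b| ≤ ‖Sig‖ * ‖b‖ ^ 2 := by
  calc _ ≤ ‖b‖ * ‖opOf Sig b‖ := abs_real_inner_le_norm _ _
    _ ≤ ‖b‖ * (‖Sig‖ * ‖b‖) := by gcongr; exact (opOf Sig).le_opNorm b
    _ = _ := by ring

lemma quadForm_pos {Sig : Matrix (Fin d) (Fin d) ℝ} (hS : Sig.PosDef)
    {b : EuclideanSpace ℝ (Fin d)} (hb : b ≠ 0) : 0 < quadForm Sig b := by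
  rw [quadForm, Matrix.inner_toEuclideanCLM]
  have hb' : b.ofLp ≠ 0 := fun h => hb (by ext i; simp [h])
  simpa using hS.dotProduct_mulVec_pos hb'

lemma exists_le_quadForm (hd : 0 < d) {Sig : Matrix (Fin d) (Fin d) ℝ} (hS : Sig.PosDef) :
    ∃ c, 0 < c ∧ ∀ b, c * ‖b‖ ^ 2 ≤ quadForm Sig b := by
  have : Nonempty (Fin d) := ⟨⟨0, hd⟩⟩
  have hcont : Continuous (quadForm Sig) :=
    continuous_id.inner (opOf Sig).continuous
  obtain ⟨b₀, hb₀, hmin⟩ := (isCompact_sphere (0 : EuclideanSpace ℝ (Fin d)) 1).exists_isMinOn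
    (NormedSpace.sphere_nonempty.2 zero_le_one) hcont.continuousOn
  have hne : b₀ ≠ 0 := by
    rintro rfl
    simp at hb₀
  refine ⟨quadForm Sig b₀, quadForm_pos hS hne, fun b => ?_⟩
  rcases eq_or_ne b 0 with rfl | hb
  · simp [quadForm]
  have hn : ‖b‖ ≠ 0 := norm_ne_zero_iff.2 hb
  have h1 : quadForm Sig b₀ ≤ quadForm Sig (‖b‖⁻¹ • b) := hmin (by simp [norm_smul, hn])
  have h2 : quadForm Sig (‖b‖⁻¹ • b) = (‖b‖ ^ 2)⁻¹ * quadForm Sig b := by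
    rw [quadForm, map_smul, real_inner_smul_left, real_inner_smul_right, quadForm]
    ring
  rw [h2, ← div_eq_inv_mul, le_div_iff₀ (by positivity)] at h1
  exact h1

variable {X : ℕ → Ω → EuclideanSpace ℝ (Fin d)}
variable {P : Measure Ω} [IsProbabilityMeasure P] {A Sig : Matrix (Fin d) (Fin d) ℝ}

lemma norm_integral_mul_ofReal_le {g : Ω → ℂ} (hg : ∀ ω, ‖g ω‖ ≤ 1) {y w : Ω → ℝ}
    (hw : Integrable w P) (hyw : ∀ ω, |y ω| ≤ w ω) :
    ‖∫ ω, g ω * (y ω : ℂ) ∂P‖ ≤ ∫ ω, w ω ∂P := by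
  refine norm_integral_le_of_norm_le hw (Eventually.of_forall fun ω => ?_)
  rw [norm_mul, Complex.norm_real, Real.norm_eq_abs]
  calc _ ≤ 1 * |y ω| := by gcongr; exact hg ω
    _ ≤ _ := by rw [one_mul]; exact hyw ω

lemma condExp_sq_inner {Y : Ω → EuclideanSpace ℝ (Fin d)} (hY : MemLp Y 2 P)
    {m : MeasurableSpace Ω} {err : Ω → Matrix (Fin d) (Fin d) ℝ}
    (herr : ∀ i j, P[fun ω => Y ω i * Y ω j | m] =ᵐ[P] fun ω => Sig i j + err ω i j)
    (b : EuclideanSpace ℝ (Fin d)) :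
    P[fun ω => ⟪b, Y ω⟫ ^ 2 | m] =ᵐ[P] fun ω => quadForm Sig b + quadForm (err ω) b := by
  have hc : ∀ i, MemLp (fun ω => Y ω i) 2 P := fun i =>
    (EuclideanSpace.proj i : EuclideanSpace ℝ (Fin d) →L[ℝ] ℝ).comp_memLp' hY
  have hint : ∀ i j, Integrable (fun ω => Y ω i * Y ω j) P := fun i j =>
    (hc i).integrable_mul (hc j)
  have e : (fun ω => ⟪b, Y ω⟫ ^ 2) =
      ∑ ij : Fin d × Fin d, (b ij.1 * b ij.2) • fun ω => Y ω ij.1 * Y ω ij.2 := by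
    funext ω
    rw [Finset.sum_apply, Fintype.sum_prod_type, PiLp.inner_apply, sq, Finset.sum_mul_sum]
    refine Finset.sum_congr rfl fun i _ => Finset.sum_congr rfl fun j _ => ?_
    simp
    ring
  rw [e]
  have h1 := condExp_finsetSum (μ := P) (s := Finset.univ)
    (f := fun ij : Fin d × Fin d => (b ij.1 * b ij.2) • fun ω => Y ω ij.1 * Y ω ij.2)
    (fun ij _ => (hint ij.1 ij.2).smul _) m
  have h2 : ∀ᵐ ω ∂P, ∀ ij : Fin d × Fin d,
      P[(b ij.1 * b ij.2) • fun ω => Y ω ij.1 * Y ω ij.2 | m] ω =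
        b ij.1 * b ij.2 * (Sig ij.1 ij.2 + err ω ij.1 ij.2) := by
    rw [ae_all_iff]
    intro ij
    filter_upwards [condExp_smul (μ := P) (b ij.1 * b ij.2) (fun ω => Y ω ij.1 * Y ω ij.2) m,
      herr ij.1 ij.2] with ω h3 h4
    rw [h3, Pi.smul_apply, h4, smul_eq_mul]
  filter_upwards [h1, h2] with ω h3 h4
  rw [h3, Finset.sum_apply, Finset.sum_congr rfl fun ij _ => h4 ij, Fintype.sum_prod_type,
    quadForm_eq_sum, quadForm_eq_sum, ← Finset.sum_add_distrib]
  refine Finset.sum_congr rfl fun i _ => ?_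
  rw [← Finset.sum_add_distrib]
  exact Finset.sum_congr rfl fun j _ => by ring

lemma stronglyMeasurable_matrix {m : MeasurableSpace Ω} {B : Ω → Matrix (Fin d) (Fin d) ℝ}
    (h : ∀ i j, Measurable fun ω => B ω i j) : StronglyMeasurable B := by
  have e : B = fun ω => ∑ i, ∑ j, B ω i j • Matrix.single i j (1 : ℝ) := by
    funext ω
    conv_lhs => rw [Matrix.matrix_eq_sum_single (B ω)]
    simp
  rw [e]
  exact Finset.stronglyMeasurable_fun_sum _ fun i _ => Finset.stronglyMeasurable_fun_sum _ fun j _ =>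
    (h i j).stronglyMeasurable.smul_const _

/-- Let x, y, z be the components along b of X (n+1), the noise and the drift; then y² = x² - z² -
2zy. The cross term has mean zero against functions of the past, x² has conditional mean q(b) plus
the given error, and z² is small because S n / n → 0 in L². Hence the error E‖err n‖ + E‖drift‖². -/
theorem IsLinearRWSD.exists_isMartingaleNoise (hd : 0 < d) (hX : IsLinearRWSD P X A Sig) :
    ∃ p M δ, IsMartingaleNoise P (pastFiltration X hX.measurable) (noise X A)
      (quadForm Sig) p M δ := by
  obtain ⟨p, M, h⟩ := hX.isMartingaleDiff
  have hA := isUnit_one_add_smul hX.lambdaMin_pos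
  obtain ⟨err, herr_meas, herr, herr_lim⟩ := hX.second_moment
  set ℱ := pastFiltration X hX.measurable with hℱ
  set J : ℕ → ℝ≥0∞ := fun n => ∫⁻ ω, ‖Matrix.toEuclideanCLM (𝕜 := ℝ) (err n ω)‖ₑ ∂P with hJ
  set drf : ℕ → Ω → EuclideanSpace ℝ (Fin d) := fun n ω => (1 / (n : ℝ)) • opOf A (walk X n ω)
    with hdrf
  have hwL : ∀ n, MemLp (walk X n) 2 P := by
    intro n
    have : walk X n = fun ω => ∑ k ∈ Finset.range n,
        opOf (transition A n (k + 1)) (noise X A k ω) := by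
      funext ω; exact walk_eq_sum hA X n ω
    rw [this]
    exact h.memLp_sum _ _
  have hdL : ∀ n, MemLp (drf n) 2 P := fun n => ((opOf A).comp_memLp' (hwL n)).const_smul (1 / (n : ℝ))
  have hdm : ∀ n, StronglyMeasurable[ℱ n] (drf n) := fun n =>
    ((opOf A).continuous.comp_stronglyMeasurable (stronglyMeasurable_walk n)).fun_const_smul _
  have hXe : ∀ n ω, X (n + 1) ω = noise X A n ω + drf n ω := by
    intro n ω
    simp only [hdrf, noise, sub_add_cancel]
  have hXL : ∀ n, MemLp (X (n + 1)) 2 P := by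
    intro n
    have : X (n + 1) = noise X A n + drf n := by funext ω; exact hXe n ω
    rw [this]
    exact (h.memLp n).add (hdL n)
  set D : ℕ → ℝ := fun n => ∫ ω, ‖drf n ω‖ ^ 2 ∂P with hD
  have hM := h.moment_nonneg
  classical
  -- For n = 0, or when the mean error is infinite, only the second-moment bound of the noise is
  -- used; this concerns finitely many n.
  refine ⟨p, M, fun n => if 1 ≤ n ∧ J n < ∞ then (J n).toReal + D n else (1 + M) + ‖Sig‖,
    h, ?_, ?_, exists_le_quadForm hd hX.posDef,
    ⟨‖Sig‖, fun b => (le_abs_self _).trans (abs_quadForm_le Sig b)⟩⟩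
  · intro n b g hg hg1
    have hgm : AEStronglyMeasurable g P := (hg.mono (ℱ.le n)).aestronglyMeasurable
    have mulg : ∀ {y : Ω → ℝ}, Integrable y P → Integrable (fun ω => g ω * (y ω : ℂ)) P :=
      fun hy => hy.ofReal.bdd_mul hgm (Eventually.of_forall hg1)
    have hnsq : Integrable (fun ω => ‖b‖ ^ 2 * ‖noise X A n ω‖ ^ 2) P :=
      (h.integrable_sq n).const_mul _
    have hinsq : ∀ v : EuclideanSpace ℝ (Fin d), ⟪b, v⟫ ^ 2 ≤ ‖b‖ ^ 2 * ‖v‖ ^ 2 := by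
      intro v
      rw [← mul_pow, ← sq_abs]
      gcongr
      exact abs_real_inner_le_norm _ _
    split_ifs with hn
    · obtain ⟨hn1, hJn⟩ := hn
      have hherr : Integrable (fun ω => ‖err n ω‖) P := by
        have hm : StronglyMeasurable (err n) := stronglyMeasurable_matrix fun i j =>
          (herr_meas n hn1 i j).mono (ℱ.le n) le_rfl
        exact Integrable.norm ⟨hm.aestronglyMeasurable, hJn⟩
      have hJe : (J n).toReal = ∫ ω, ‖err n ω‖ ∂P := by
        rw [hJ, integral_eq_lintegral_of_nonneg_ae (Eventually.of_forall fun ω => norm_nonneg _)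
          hherr.1]
        congr 1
        refine lintegral_congr fun ω => ?_
        rw [ofReal_norm]; rfl
      set x : Ω → ℝ := fun ω => ⟪b, X (n + 1) ω⟫ with hx
      set y : Ω → ℝ := fun ω => ⟪b, noise X A n ω⟫ with hy
      set z : Ω → ℝ := fun ω => ⟪b, drf n ω⟫ with hz
      have hxL : MemLp x 2 P := (hXL n).const_inner b
      have hyL : MemLp y 2 P := (h.memLp n).const_inner b
      have hzL : MemLp z 2 P := (hdL n).const_inner b
      have hzm : StronglyMeasurable[ℱ n] z := stronglyMeasurable_const.inner (hdm n)
      have hcross : ∫ ω, g ω * ((z ω * y ω : ℝ) : ℂ) ∂P = 0 := by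
        have h1 := h.integral_mul_inner_eq_zero (n := n) (g := fun ω => g ω * (z ω : ℂ))
          (hg.mul (Complex.continuous_ofReal.comp_stronglyMeasurable hzm)) b
        have e : ∀ ω, g ω * (z ω : ℂ) * ((⟪b, noise X A n ω⟫ : ℝ) : ℂ) =
            g ω * ((z ω * y ω : ℝ) : ℂ) := by
          intro ω; simp only [hy]; push_cast; ring
        simp only [e] at h1
        exact h1 (mulg (hzL.integrable_mul hyL))
      have hcond := condExp_sq_inner (hXL n) (herr n hn1) b
      have hmain : ∫ ω, g ω * ((x ω ^ 2 : ℝ) : ℂ) ∂P =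
          ∫ ω, g ω * ((quadForm Sig b + quadForm (err n ω) b : ℝ) : ℂ) ∂P := by
        let B : ℂ →L[ℝ] ℝ →L[ℝ] ℂ := (ContinuousLinearMap.lsmul ℝ ℝ).flip
        have hB : ∀ (w : ℂ) (r : ℝ), B w r = w * (r : ℂ) := by
          intro w r
          change r • w = _
          rw [Complex.real_smul, mul_comm]
        have h1 := condExp_bilin_of_stronglyMeasurable_left (μ := P) (m := ℱ n) B hg
          (g := fun ω => x ω ^ 2) (by simp only [hB]; exact mulg hxL.integrable_sq)
          hxL.integrable_sq
        simp only [hB] at h1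
        rw [← integral_condExp (ℱ.le n), integral_congr_ae h1]
        refine integral_congr_ae ?_
        filter_upwards [hcond] with ω h2
        rw [← h2]; rfl
      have hqi : Integrable (fun ω => quadForm (err n ω) b) P := by
        have h1 : Integrable (fun ω => quadForm Sig b + quadForm (err n ω) b) P :=
          integrable_condExp.congr hcond
        refine (h1.sub (integrable_const (quadForm Sig b))).congr (Eventually.of_forall fun ω => ?_)
        simp
      have hzsq := hzL.integrable_sq
      have key : ∫ ω, g ω * ((y ω ^ 2 - quadForm Sig b : ℝ) : ℂ) ∂P =
          ∫ ω, g ω * ((quadForm (err n ω) b : ℝ) : ℂ) ∂P - ∫ ω, g ω * ((z ω ^ 2 : ℝ) : ℂ) ∂P := by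
        have e1 : ∀ ω, g ω * ((y ω ^ 2 - quadForm Sig b : ℝ) : ℂ) =
            g ω * ((x ω ^ 2 : ℝ) : ℂ) - g ω * ((quadForm Sig b : ℝ) : ℂ)
              - g ω * ((z ω ^ 2 : ℝ) : ℂ) - 2 * (g ω * ((z ω * y ω : ℝ) : ℂ)) := by
          intro ω
          have : x ω = y ω + z ω := by
            simp only [hx, hy, hz]
            rw [hXe n ω, inner_add_right]
          rw [this]; push_cast; ring
        have e2 : ∀ ω, g ω * ((quadForm Sig b + quadForm (err n ω) b : ℝ) : ℂ) =
            g ω * ((quadForm Sig b : ℝ) : ℂ) + g ω * ((quadForm (err n ω) b : ℝ) : ℂ) := by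
          intro ω; push_cast; ring
        have i1 := mulg hxL.integrable_sq
        have i2 := mulg (integrable_const (μ := P) (quadForm Sig b))
        have i3 := mulg hzsq
        have i4 := (mulg (hzL.integrable_mul hyL)).const_mul 2
        simp only [e1]
        rw [integral_sub, integral_sub, integral_sub i1 i2, integral_const_mul, hcross, mul_zero,
          sub_zero, hmain]
        · simp only [e2]
          rw [integral_add i2 (mulg hqi), add_sub_cancel_left]
        · exact i1.sub i2
        · exact i3
        · exact (i1.sub i2).sub i3
        · exact i4
      change ‖∫ ω, g ω * ((y ω ^ 2 - quadForm Sig b : ℝ) : ℂ) ∂P‖ ≤ _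
      rw [key]
      have b1 : ‖∫ ω, g ω * ((quadForm (err n ω) b : ℝ) : ℂ) ∂P‖ ≤ ‖b‖ ^ 2 * (J n).toReal := by
        rw [hJe, ← integral_const_mul]
        exact norm_integral_mul_ofReal_le hg1 (hherr.const_mul _)
          fun ω => (abs_quadForm_le _ _).trans (le_of_eq (mul_comm _ _))
      have b2 : ‖∫ ω, g ω * ((z ω ^ 2 : ℝ) : ℂ) ∂P‖ ≤ ‖b‖ ^ 2 * D n := by
        simp only [hD]
        rw [← integral_const_mul]
        refine norm_integral_mul_ofReal_le hg1
          (((hdL n).integrable_norm_pow two_ne_zero).const_mul _) fun ω => ?_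
        rw [abs_of_nonneg (sq_nonneg _)]
        exact hinsq _
      calc _ ≤ _ := norm_sub_le _ _
        _ ≤ _ := add_le_add b1 b2
        _ = _ := by ring
    · calc _ ≤ ∫ ω, (‖b‖ ^ 2 * ‖noise X A n ω‖ ^ 2 + ‖Sig‖ * ‖b‖ ^ 2) ∂P := by
            refine norm_integral_mul_ofReal_le hg1 (hnsq.add (integrable_const _)) fun ω => ?_
            refine (abs_sub _ _).trans (add_le_add ?_ (abs_quadForm_le _ _))
            rw [abs_of_nonneg (sq_nonneg _)]
            exact hinsq _
        _ = ‖b‖ ^ 2 * ∫ ω, ‖noise X A n ω‖ ^ 2 ∂P + ‖Sig‖ * ‖b‖ ^ 2 := by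
            rw [integral_add hnsq (integrable_const _), integral_const_mul]; simp
        _ ≤ ‖b‖ ^ 2 * (1 + M) + ‖Sig‖ * ‖b‖ ^ 2 := by gcongr; exact h.integral_sq_le n
        _ = _ := by ring
  -- α < 1 makes E‖drift‖² = O(n^{2α-2}) vanish.
  · obtain ⟨α, hα1, hα2⟩ := exists_between (max_lt hX.lambdaMax_lt_one (by norm_num : (1 / 2 : ℝ) < 1))
    obtain ⟨K, hK⟩ := exists_norm_flow_le hd ((le_max_left _ _).trans_lt hα1)
    obtain ⟨C, hC, hCw⟩ := h.exists_integral_norm_sq_walk_le hA hK ((le_max_right _ _).trans_lt hα1)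
    have hDlim : Tendsto D atTop (𝓝 0) := by
      have hlim : Tendsto (fun n : ℕ => ‖A‖ ^ 2 * C * (n : ℝ) ^ (-(2 - 2 * α))) atTop (𝓝 0) := by
        have := ((tendsto_rpow_neg_atTop (show 0 < 2 - 2 * α by linarith)).comp
          tendsto_natCast_atTop_atTop).const_mul (‖A‖ ^ 2 * C)
        simpa using this
      refine squeeze_zero' (Eventually.of_forall fun n => integral_nonneg fun ω => by positivity)
        ?_ hlim
      filter_upwards [eventually_ge_atTop 1] with n hn
      have hn0 : (0 : ℝ) < n := by exact_mod_cast hn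
      calc D n ≤ ∫ ω, (1 / (n : ℝ)) ^ 2 * ‖A‖ ^ 2 * ‖walk X n ω‖ ^ 2 ∂P := by
            refine integral_mono ((hdL n).integrable_norm_pow two_ne_zero)
              (((hwL n).integrable_norm_pow two_ne_zero).const_mul _) fun ω => ?_
            simp only [hdrf]
            rw [norm_smul, Real.norm_of_nonneg (by positivity), mul_pow, mul_assoc, ← mul_pow ‖A‖]
            gcongr
            exact (opOf A).le_opNorm _
        _ = (1 / (n : ℝ)) ^ 2 * ‖A‖ ^ 2 * ∫ ω, ‖walk X n ω‖ ^ 2 ∂P := integral_const_mul _ _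
        _ ≤ (1 / (n : ℝ)) ^ 2 * ‖A‖ ^ 2 * (C * (n : ℝ) ^ (2 * α)) := by gcongr; exact hCw n
        _ = _ := by
            rw [neg_sub, Real.rpow_sub hn0]
            have : (n : ℝ) ^ (2 : ℝ) = (n : ℝ) ^ 2 := Real.rpow_natCast _ 2
            rw [this]
            field_simp
    have hJlim : Tendsto (fun n => (J n).toReal) atTop (𝓝 0) := by
      have := (ENNReal.tendsto_toReal ENNReal.zero_ne_top).comp herr_lim
      rwa [ENNReal.toReal_zero] at this
    have hsum := hJlim.add hDlim
    rw [add_zero] at hsum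
    refine hsum.congr' ?_
    filter_upwards [eventually_ge_atTop 1, herr_lim.eventually (gt_mem_nhds ENNReal.zero_lt_top)]
      with n hn hJn
    rw [if_pos ⟨hn, hJn⟩]

end Noise

/-! ### Limits of L²-bounded martingales and their non-degeneracy. -/

section MartingaleLimit

open scoped RealInnerProductSpace

variable {Ω E : Type*} [mΩ : MeasurableSpace Ω] [NormedAddCommGroup E] [InnerProductSpace ℝ E]
  [CompleteSpace E] {P : Measure Ω} [IsProbabilityMeasure P] {ℱ : Filtration ℕ mΩ}
  {e : ℕ → Ω → E} {p M : ℝ}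

namespace IsMartingaleDiff

variable (h : IsMartingaleDiff P ℱ e p M)

include h

lemma martingale_sum_range (ℓ : ℕ → E →L[ℝ] ℝ) :
    Martingale (fun n ω => ∑ k ∈ Finset.range n, ℓ k (e k ω)) ℱ P := by
  have hint : ∀ n, Integrable (fun ω => ∑ k ∈ Finset.range n, ℓ k (e k ω)) P := fun n =>
    (h.memLp_sum ℓ _).integrable one_le_two
  refine martingale_nat (fun n => h.stronglyMeasurable_sum_range ℓ n) hint fun n => ?_
  have h1 : (fun ω => ∑ k ∈ Finset.range (n + 1), ℓ k (e k ω)) =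
      (fun ω => ∑ k ∈ Finset.range n, ℓ k (e k ω)) + fun ω => ℓ n (e n ω) := by
    funext ω; simp [Finset.sum_range_succ]
  rw [h1]
  have hi : Integrable (fun ω => ℓ n (e n ω)) P := (ℓ n).integrable_comp (h.integrable n)
  have h2 := condExp_add (hint n) hi (ℱ n)
  have h3 := (ℓ n).comp_condExp_comm (m := ℱ n) (h.integrable n)
  have h4 := condExp_of_stronglyMeasurable (ℱ.le n) (h.stronglyMeasurable_sum_range ℓ n) (hint n)
  filter_upwards [h2, h3, h.condExp_eq_zero n] with ω h5 h6 h7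
  rw [h5, Pi.add_apply, h4]
  have h8 : P[fun ω => ℓ n (e n ω) | ℱ n] ω = 0 := by
    have h9 : P[fun ω => ℓ n (e n ω) | ℱ n] ω = ℓ n (P[e n | ℱ n] ω) := h6.symm
    rw [h9, h7]; simp
  rw [h8, add_zero]

/-- A real martingale bounded in L², hence in L¹, converges almost surely by Doob's theorem. -/
lemma ae_exists_tendsto {ℓ : ℕ → E →L[ℝ] ℝ} (hℓ : Summable fun k => ‖ℓ k‖ ^ 2) :
    ∀ᵐ ω ∂P, ∃ c, Tendsto (fun n => ∑ k ∈ Finset.range n, ℓ k (e k ω)) atTop (𝓝 c) := by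
  have hM := h.moment_nonneg
  refine (h.martingale_sum_range ℓ).submartingale.exists_ae_tendsto_of_bdd
    (R := (Real.sqrt ((1 + M) * ∑' k, ‖ℓ k‖ ^ 2)).toNNReal) fun n => ?_
  refine (eLpNorm_le_eLpNorm_of_exponent_le one_le_two (h.memLp_sum ℓ _).1).trans ?_
  refine (h.eLpNorm_sum_le ℓ _).trans ?_
  refine ENNReal.ofReal_le_ofReal (Real.sqrt_le_sqrt ?_)
  gcongr
  exact hℓ.sum_le_tsum _ fun k _ => by positivity

/-- Square-summable linear combinations of martingale differences converge almost surely and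
in `L²`. -/
theorem exists_limit {d : ℕ} {B : ℕ → E →L[ℝ] EuclideanSpace ℝ (Fin d)}
    (hB : Summable fun k => ‖B k‖ ^ 2) :
    ∃ Z : Ω → EuclideanSpace ℝ (Fin d), Measurable Z ∧ MemLp Z 2 P ∧
      (∀ᵐ ω ∂P, Tendsto (fun n => ∑ k ∈ Finset.range n, B k (e k ω)) atTop (𝓝 (Z ω))) ∧
      Tendsto (fun n => eLpNorm (fun ω => ∑ k ∈ Finset.range n, B k (e k ω) - Z ω) 2 P)
        atTop (𝓝 0) := by
  have hM := h.moment_nonneg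
  let pr : Fin d → EuclideanSpace ℝ (Fin d) →L[ℝ] ℝ := fun i => EuclideanSpace.proj i
  have hpr : ∀ i, ‖pr i‖ ≤ 1 := fun i =>
    ContinuousLinearMap.opNorm_le_bound _ zero_le_one fun x => by
      rw [one_mul]; exact PiLp.norm_apply_le x i
  set ℓ : Fin d → ℕ → E →L[ℝ] ℝ := fun i k => (pr i).comp (B k)
  have hℓ : ∀ i, Summable fun k => ‖ℓ i k‖ ^ 2 := by
    intro i
    refine Summable.of_nonneg_of_le (fun k => by positivity) (fun k => ?_) hB
    gcongr
    calc _ ≤ ‖pr i‖ * ‖B k‖ := ContinuousLinearMap.opNorm_comp_le _ _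
      _ ≤ 1 * ‖B k‖ := by gcongr; exact hpr i
      _ = _ := one_mul _
  have hex : ∀ᵐ ω ∂P, ∃ z, Tendsto (fun n => ∑ k ∈ Finset.range n, B k (e k ω)) atTop (𝓝 z) := by
    have h1 : ∀ᵐ ω ∂P, ∀ i, ∃ c, Tendsto (fun n => ∑ k ∈ Finset.range n, ℓ i k (e k ω)) atTop
        (𝓝 c) := ae_all_iff.2 fun i => h.ae_exists_tendsto (hℓ i)
    filter_upwards [h1] with ω hω
    choose z hz using hω
    refine ⟨WithLp.toLp 2 z, ?_⟩
    have h2 : Tendsto (fun n => (∑ k ∈ Finset.range n, B k (e k ω)).ofLp) atTop (𝓝 z) := by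
      rw [tendsto_pi_nhds]
      intro i
      refine (hz i).congr fun n => ?_
      have : (∑ k ∈ Finset.range n, B k (e k ω)).ofLp i =
          pr i (∑ k ∈ Finset.range n, B k (e k ω)) := rfl
      rw [this, map_sum]; rfl
    exact ((PiLp.continuous_toLp 2 (fun _ : Fin d => ℝ)).tendsto _).comp h2
  obtain ⟨Z, hZm, hae⟩ := measurable_limit_of_tendsto_metrizable_ae
    (fun n => (h.memLp_sum B (Finset.range n)).1.aemeasurable) hex
  set τ : ℕ → ℝ := fun n => ∑' k, ‖B (k + n)‖ ^ 2 with hτ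
  have hτ0 : Tendsto τ atTop (𝓝 0) := tendsto_sum_nat_add fun k => ‖B k‖ ^ 2
  have hbd : ∀ n, eLpNorm (fun ω => ∑ k ∈ Finset.range n, B k (e k ω) - Z ω) 2 P ≤
      ENNReal.ofReal (Real.sqrt ((1 + M) * τ n)) := by
    intro n
    -- Fatou in m: the L² distance from the n-th partial sum to the limit is controlled by the tail
    -- of ∑ ‖B k‖².
    have h1 := Lp.eLpNorm_lim_le_liminf_eLpNorm (μ := P) (p := 2)
      (f := fun m ω => ∑ k ∈ Finset.range n, B k (e k ω) - ∑ k ∈ Finset.range m, B k (e k ω))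
      (fun m => ((h.memLp_sum B _).sub (h.memLp_sum B _)).1)
      (fun ω => ∑ k ∈ Finset.range n, B k (e k ω) - Z ω)
      (by filter_upwards [hae] with ω hω using hω.const_sub _)
    refine h1.trans ?_
    refine liminf_le_of_frequently_le' (Eventually.frequently ?_)
    filter_upwards [eventually_ge_atTop n] with m hm
    have h2 : (fun ω => ∑ k ∈ Finset.range n, B k (e k ω) - ∑ k ∈ Finset.range m, B k (e k ω)) =
        -fun ω => ∑ k ∈ Finset.Ico n m, B k (e k ω) := by
      funext ω
      rw [Pi.neg_apply, Finset.sum_Ico_eq_sub _ hm]; abel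
    rw [h2, eLpNorm_neg]
    refine (h.eLpNorm_sum_le B _).trans (ENNReal.ofReal_le_ofReal (Real.sqrt_le_sqrt ?_))
    gcongr
    rw [Finset.sum_Ico_eq_sum_range]
    simp only [add_comm n]
    exact ((summable_nat_add_iff n).2 hB).sum_le_tsum _ fun k _ => by positivity
  have hlim : Tendsto (fun n => eLpNorm (fun ω => ∑ k ∈ Finset.range n, B k (e k ω) - Z ω) 2 P)
      atTop (𝓝 0) := by
    have h1 : Tendsto (fun n => ENNReal.ofReal (Real.sqrt ((1 + M) * τ n))) atTop (𝓝 0) := by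
      have := ENNReal.tendsto_ofReal ((hτ0.const_mul (1 + M)).sqrt)
      simpa using this
    exact tendsto_of_tendsto_of_tendsto_of_le_of_le tendsto_const_nhds h1 (fun n => zero_le) hbd
  refine ⟨Z, hZm, ?_, hae, hlim⟩
  have h0 := hbd 0
  simp only [Finset.range_zero, Finset.sum_empty, zero_sub] at h0
  have h1 : eLpNorm (fun ω => -Z ω) 2 P = eLpNorm Z 2 P := eLpNorm_neg Z 2 P
  rw [h1] at h0
  exact ⟨hZm.aestronglyMeasurable, h0.trans_lt ENNReal.ofReal_lt_top⟩

lemma integral_eq_zero (n : ℕ) : ∫ ω, e n ω ∂P = 0 := by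
  rw [← integral_condExp (ℱ.le n), integral_congr_ae (h.condExp_eq_zero n)]
  simp

lemma integral_limit_eq_zero {F : Type*} [NormedAddCommGroup F] [InnerProductSpace ℝ F]
    [CompleteSpace F] {B : ℕ → E →L[ℝ] F} {Z : Ω → F}
    (hZ : MemLp Z 2 P)
    (hlim : Tendsto (fun n => eLpNorm (fun ω => ∑ k ∈ Finset.range n, B k (e k ω) - Z ω) 2 P)
      atTop (𝓝 0)) : ∫ ω, Z ω ∂P = 0 := by
  have hi : ∀ n, Integrable (fun ω => ∑ k ∈ Finset.range n, B k (e k ω)) P := fun n =>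
    (h.memLp_sum B _).integrable one_le_two
  have h1 : Tendsto (fun n => eLpNorm ((fun ω => ∑ k ∈ Finset.range n, B k (e k ω)) - Z) 1 P)
      atTop (𝓝 0) :=
    tendsto_of_tendsto_of_tendsto_of_le_of_le tendsto_const_nhds hlim (fun n => zero_le)
      fun n => eLpNorm_le_eLpNorm_of_exponent_le one_le_two ((h.memLp_sum B _).sub hZ).1
  have h2 := tendsto_integral_of_L1' Z hZ.1 (Eventually.of_forall hi) h1
  refine tendsto_nhds_unique h2 ?_
  have h3 : ∀ n, ∫ ω, ∑ k ∈ Finset.range n, B k (e k ω) ∂P = 0 := by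
    intro n
    rw [integral_finsetSum _ fun k _ => (B k).integrable_comp (h.integrable k)]
    refine Finset.sum_eq_zero fun k _ => ?_
    rw [(B k).integral_comp_comm (h.integrable k), h.integral_eq_zero, map_zero]
  simp only [h3]
  exact tendsto_const_nhds

end IsMartingaleDiff

/-- Once δ k < c, the second moment of ⟪b, e k⟫ is at least (c - δ k)‖b‖²; a single index serves all
directions b. -/
lemma IsMartingaleNoise.integral_inner_sq_pos {q : E → ℝ} {δ : ℕ → ℝ}
    (h : IsMartingaleNoise P ℱ e q p M δ) :
    ∃ k, ∀ b : E, b ≠ 0 → 0 < ∫ ω, ⟪b, e k ω⟫ ^ 2 ∂P := by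
  obtain ⟨c, hc, hcb⟩ := h.lower
  obtain ⟨k, hk⟩ := (h.tendsto_error.eventually (gt_mem_nhds hc)).exists
  refine ⟨k, fun b hb => ?_⟩
  have h1 := h.variance k b (fun _ => 1) stronglyMeasurable_const (fun _ => by simp)
  have h2 : Integrable (fun ω => ⟪b, e k ω⟫ ^ 2) P := ((h.memLp k).const_inner b).integrable_sq
  simp only [one_mul] at h1
  rw [show (∫ ω, ((⟪b, e k ω⟫ ^ 2 - q b : ℝ) : ℂ) ∂P) = ((∫ ω, ⟪b, e k ω⟫ ^ 2 - q b ∂P : ℝ) : ℂ)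
    from integral_ofReal, integral_sub h2 (integrable_const _), Complex.norm_real,
    Real.norm_eq_abs] at h1
  simp only [integral_const, probReal_univ, one_smul] at h1
  have h3 := (abs_le.1 h1).1
  have h4 : 0 < ‖b‖ ^ 2 := by positivity
  nlinarith [hcb b]

/-- The limit of a linear combination of martingale differences with injective coefficients is
non-degenerate. -/
theorem IsMartingaleNoise.nondegenerate {q : E → ℝ} {δ : ℕ → ℝ}
    (h : IsMartingaleNoise P ℱ e q p M δ) {d : ℕ} {B : ℕ → E →L[ℝ] EuclideanSpace ℝ (Fin d)}
    (hB : ∀ k x, x ≠ 0 → (B k).adjoint x ≠ 0) {Z : Ω → EuclideanSpace ℝ (Fin d)}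
    (hZ : MemLp Z 2 P)
    (hlim : Tendsto (fun n => eLpNorm (fun ω => ∑ k ∈ Finset.range n, B k (e k ω) - Z ω) 2 P)
      atTop (𝓝 0)) : Nondegenerate P Z := by
  have hc : ∀ i, MemLp (fun ω => Z ω i) 2 P := fun i =>
    (EuclideanSpace.proj i : EuclideanSpace ℝ (Fin d) →L[ℝ] ℝ).comp_memLp' hZ
  have hmean : ∀ i, ∫ ω, Z ω i ∂P = 0 := by
    intro i
    have h1 := (EuclideanSpace.proj i : EuclideanSpace ℝ (Fin d) →L[ℝ] ℝ).integral_comp_comm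
      (hZ.integrable one_le_two)
    rw [h.integral_limit_eq_zero hZ hlim, map_zero] at h1
    exact h1
  have hcov : ∀ i j, cov[fun ω => Z ω i, fun ω => Z ω j; P] = ∫ ω, Z ω i * Z ω j ∂P := by
    intro i j
    rw [covariance_eq_sub (hc i) (hc j), hmean i, zero_mul, sub_zero]
    rfl
  have hpos : ∀ x : EuclideanSpace ℝ (Fin d), x ≠ 0 → 0 < ∫ ω, ⟪x, Z ω⟫ ^ 2 ∂P := by
    intro x hx
    by_contra hcon
    have hxL : MemLp (fun ω => ⟪x, Z ω⟫) 2 P := hZ.const_inner x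
    have h0 : ∫ ω, ⟪x, Z ω⟫ ^ 2 ∂P = 0 :=
      le_antisymm (not_lt.1 hcon) (integral_nonneg fun ω => by positivity)
    rw [integral_eq_zero_iff_of_nonneg (fun ω => by positivity) hxL.integrable_sq] at h0
    obtain ⟨k, hk⟩ := h.integral_inner_sq_pos
    have hη := hk _ (hB k x hx)
    set η := ∫ ω, ⟪(B k).adjoint x, e k ω⟫ ^ 2 ∂P
    set ℓ : ℕ → E →L[ℝ] ℝ := fun j => (innerSL ℝ x).comp (B j)
    -- Orthogonality bounds the L² norm of ⟪x, partial sum⟫ below by that of its k-th term, while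
    -- ⟪x, Z⟫ = 0 bounds it above by the vanishing L² distance to Z.
    have hlow : ∀ n, k < n → ENNReal.ofReal (Real.sqrt η) ≤
        ENNReal.ofReal ‖x‖ * eLpNorm (fun ω => ∑ k ∈ Finset.range n, B k (e k ω) - Z ω) 2 P := by
      intro n hn
      have h1 : ENNReal.ofReal (Real.sqrt η) ≤
          eLpNorm (fun ω => ∑ j ∈ Finset.range n, ℓ j (e j ω)) 2 P := by
        rw [eLpNorm_two_eq (h.memLp_sum ℓ _)]
        refine ENNReal.ofReal_le_ofReal (Real.sqrt_le_sqrt ?_)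
        rw [h.integral_norm_sq_sum_range]
        refine le_trans (le_of_eq ?_) (Finset.single_le_sum
          (f := fun j => ∫ ω, ‖ℓ j (e j ω)‖ ^ 2 ∂P)
          (fun j _ => integral_nonneg fun ω => by positivity) (Finset.mem_range.2 hn))
        refine integral_congr_ae (Eventually.of_forall fun ω => ?_)
        simp only [ℓ, ContinuousLinearMap.comp_apply, innerSL_apply_apply,
          ContinuousLinearMap.adjoint_inner_left, Real.norm_eq_abs, sq_abs]
      refine h1.trans (eLpNorm_le_mul_eLpNorm_of_ae_le_mul ?_ _)
      filter_upwards [h0] with ω hω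
      have h2 : ⟪x, Z ω⟫ = 0 := by simpa using hω
      have h3 : ∑ j ∈ Finset.range n, ℓ j (e j ω) =
          ⟪x, ∑ k ∈ Finset.range n, B k (e k ω) - Z ω⟫ := by
        rw [inner_sub_right, h2, sub_zero, inner_sum]
        rfl
      rw [h3]
      exact norm_inner_le_norm _ _
    have hlim2 : Tendsto (fun n => ENNReal.ofReal ‖x‖ *
        eLpNorm (fun ω => ∑ k ∈ Finset.range n, B k (e k ω) - Z ω) 2 P) atTop (𝓝 0) := by
      have := ENNReal.Tendsto.const_mul (a := ENNReal.ofReal ‖x‖) hlim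
        (Or.inr ENNReal.ofReal_ne_top)
      simpa using this
    have h4 := ge_of_tendsto hlim2 (eventually_atTop.2 ⟨k + 1, fun n hn => hlow n hn⟩)
    have h5 : 0 < Real.sqrt η := Real.sqrt_pos.2 hη
    exact absurd h4 (not_le.2 (ENNReal.ofReal_pos.2 h5))
  refine Matrix.PosDef.of_dotProduct_mulVec_pos ?_ ?_
  · ext i j
    simp [hcov, mul_comm]
  · intro x hx
    have hx' : (WithLp.toLp 2 x : EuclideanSpace ℝ (Fin d)) ≠ 0 := by
      intro h0
      exact hx (by simpa using congrArg WithLp.ofLp h0)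
    have h1 := hpos _ hx'
    have h2 : ∫ ω, ⟪(WithLp.toLp 2 x : EuclideanSpace ℝ (Fin d)), Z ω⟫ ^ 2 ∂P =
        star x ⬝ᵥ (Matrix.of fun i j : Fin d => cov[fun ω => Z ω i, fun ω => Z ω j; P]) *ᵥ x := by
      have e1 : ∀ ω, ⟪(WithLp.toLp 2 x : EuclideanSpace ℝ (Fin d)), Z ω⟫ ^ 2 =
          ∑ i, ∑ j, x i * x j * (Z ω i * Z ω j) := by
        intro ω
        rw [PiLp.inner_apply, sq, Finset.sum_mul_sum]
        refine Finset.sum_congr rfl fun i _ => Finset.sum_congr rfl fun j _ => ?_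
        simp
        ring
      have hij : ∀ i j, Integrable (fun ω => x i * x j * (Z ω i * Z ω j)) P := fun i j =>
        ((hc i).integrable_mul (hc j)).const_mul _
      simp only [e1]
      rw [integral_finsetSum _ fun i _ => integrable_finsetSum _ fun j _ => hij i j]
      rw [dotProduct]
      refine Finset.sum_congr rfl fun i _ => ?_
      rw [integral_finsetSum _ fun j _ => hij i j, Matrix.mulVec, dotProduct, Finset.mul_sum]
      refine Finset.sum_congr rfl fun j _ => ?_
      rw [integral_const_mul, Matrix.of_apply, hcov]
      simp
      ring
    rwa [← h2]

end MartingaleLimit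

/-! ### The Lyapunov equation and quadratic forms. -/

section Lyapunov

open scoped RealInnerProductSpace Matrix.Norms.L2Operator

variable {d : ℕ} {A Sig Xi : Matrix (Fin d) (Fin d) ℝ}

lemma star_eq_transpose (M : Matrix (Fin d) (Fin d) ℝ) : star M = Mᵀ := by
  rw [Matrix.star_eq_conjTranspose, Matrix.conjTranspose_eq_transpose_of_trivial]

lemma isLyapunovSolution_iff : IsLyapunovSolution A Sig Xi ↔ Xi - A * Xi - Xi * star A = Sig := by
  have : ((1 / 2 : ℝ) • 1 - A) * Xi + Xi * ((1 / 2 : ℝ) • 1 - Aᵀ) = Xi - A * Xi - Xi * star A := by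
    rw [star_eq_transpose, sub_mul, mul_sub, smul_mul_assoc, mul_smul_comm, one_mul, mul_one]
    have : Xi = (1 / 2 : ℝ) • Xi + (1 / 2 : ℝ) • Xi := by rw [← add_smul]; norm_num
    nth_rewrite 5 [this]
    abel
  rw [IsLyapunovSolution, this]

/-- The Lyapunov operator is a linear endomorphism of a finite-dimensional space, so injectivity
yields existence and uniqueness together. -/
lemma exists_lyapunovSolution
    (h : ∀ Z : Matrix (Fin d) (Fin d) ℝ, Z - A * Z - Z * star A = 0 → Z = 0)
    (Sig : Matrix (Fin d) (Fin d) ℝ) :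
    ∃ Xi, Xi - A * Xi - Xi * star A = Sig ∧
      ∀ Xi', Xi' - A * Xi' - Xi' * star A = Sig → Xi' = Xi := by
  let L : Matrix (Fin d) (Fin d) ℝ →ₗ[ℝ] Matrix (Fin d) (Fin d) ℝ :=
    LinearMap.id - LinearMap.mulLeft ℝ A - LinearMap.mulRight ℝ (star A)
  have hL : ∀ Z, L Z = Z - A * Z - Z * star A := fun Z => by simp [L]
  have hinj : Function.Injective L := by
    rw [injective_iff_map_eq_zero]
    exact fun Z hZ => h Z (by rw [← hL, hZ])
  obtain ⟨Xi, hXi⟩ := (LinearMap.injective_iff_surjective.1 hinj) Sig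
  exact ⟨Xi, by rw [← hL, hXi], fun Xi' h' => hinj (by rw [hXi, hL, h'])⟩

/-- Combined with uniqueness, this makes the solution symmetric. -/
lemma transpose_lyapunov (hS : Sigᵀ = Sig) (h : Xi - A * Xi - Xi * star A = Sig) :
    Xiᵀ - A * Xiᵀ - Xiᵀ * star A = Sig := by
  have := congrArg Matrix.transpose h
  rw [hS] at this
  rw [← this, star_eq_transpose]
  simp only [Matrix.transpose_sub, Matrix.transpose_mul, Matrix.transpose_transpose]
  abel

lemma quadForm_smul_right (S : Matrix (Fin d) (Fin d) ℝ) (c : ℝ) (b : EuclideanSpace ℝ (Fin d)) :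
    quadForm S (c • b) = c ^ 2 * quadForm S b := by
  rw [quadForm, map_smul, real_inner_smul_left, real_inner_smul_right, quadForm]
  ring

lemma quadForm_zero_right (S : Matrix (Fin d) (Fin d) ℝ) : quadForm S 0 = 0 := by
  simp [quadForm]

lemma quadForm_smul_left (S : Matrix (Fin d) (Fin d) ℝ) (c : ℝ) (b : EuclideanSpace ℝ (Fin d)) :
    quadForm (c • S) b = c * quadForm S b := by
  simp only [quadForm_eq_sum, Finset.mul_sum, Matrix.smul_apply, smul_eq_mul]
  exact Finset.sum_congr rfl fun i _ => Finset.sum_congr rfl fun j _ => by ring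

lemma continuous_quadForm_left (b : EuclideanSpace ℝ (Fin d)) :
    Continuous fun S : Matrix (Fin d) (Fin d) ℝ => quadForm S b := by
  simp only [quadForm_eq_sum]
  refine continuous_finsetSum _ fun i _ => continuous_finsetSum _ fun j _ => ?_
  exact continuous_const.mul (continuous_id.matrix_elem i j)

/-- This joins the central limit theorem to the Lyapunov asymptotics: the right side is the variance
that the theorem asks for in direction t. -/
lemma quadForm_gramSum (n : ℕ) (s : Finset ℕ) (t : EuclideanSpace ℝ (Fin d)) :
    quadForm (gramSum A Sig n s) t =
      ∑ k ∈ s, quadForm Sig ((opOf (transition A n (k + 1))).adjoint t) := by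
  rw [quadForm, gramSum, opOf, map_sum, _root_.sum_apply, inner_sum]
  refine Finset.sum_congr rfl fun k _ => ?_
  rw [← opOf, opOf_mul_apply, opOf_mul_apply, star_eq_transpose, ← adjoint_opOf,
    ← ContinuousLinearMap.adjoint_inner_left, quadForm]

lemma posSemidef_of_quadForm_nonneg {S : Matrix (Fin d) (Fin d) ℝ} (hS : Sᵀ = S)
    (h : ∀ b, 0 ≤ quadForm S b) : S.PosSemidef := by
  refine Matrix.PosSemidef.of_dotProduct_mulVec_nonneg ?_ fun x => ?_
  · rw [Matrix.IsHermitian, Matrix.conjTranspose_eq_transpose_of_trivial, hS]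
  · have := h (WithLp.toLp 2 x)
    rw [quadForm, Matrix.inner_toEuclideanCLM] at this
    simpa using this

lemma quadForm_nonneg {S : Matrix (Fin d) (Fin d) ℝ} (hS : S.PosSemidef)
    (b : EuclideanSpace ℝ (Fin d)) : 0 ≤ quadForm S b := by
  rw [quadForm, Matrix.inner_toEuclideanCLM]
  simpa using hS.dotProduct_mulVec_nonneg b.ofLp

lemma charFun_multivariateGaussian_zero {S : Matrix (Fin d) (Fin d) ℝ} (hS : S.PosSemidef)
    (t : EuclideanSpace ℝ (Fin d)) :
    charFun (multivariateGaussian 0 S) t = (Real.exp (-quadForm S t / 2) : ℂ) := by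
  rw [charFun_multivariateGaussian hS, quadForm, Matrix.inner_toEuclideanCLM]
  simp [neg_div]

end Lyapunov

/-! ### The subcritical regime. -/

section Noncritical

open scoped RealInnerProductSpace Matrix.Norms.L2Operator

variable {Ω : Type*} [mΩ : MeasurableSpace Ω] {d : ℕ} {X : ℕ → Ω → EuclideanSpace ℝ (Fin d)}
  {P : Measure Ω} [IsProbabilityMeasure P] {A Sig : Matrix (Fin d) (Fin d) ℝ}

lemma IsLinearRWSD.measurable_walk (hX : IsLinearRWSD P X A Sig) (n : ℕ) :
    Measurable (walk X n) :=
  ((stronglyMeasurable_walk n).mono ((pastFiltration X hX.measurable).le n)).measurable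

lemma IsLinearRWSD.transpose_eq (hX : IsLinearRWSD P X A Sig) : Sigᵀ = Sig := by
  have := hX.posDef.isHermitian
  rwa [Matrix.IsHermitian, Matrix.conjTranspose_eq_transpose_of_trivial] at this

lemma sum_quadForm_smul (n : ℕ) (s : Finset ℕ) (t : EuclideanSpace ℝ (Fin d)) {c : ℝ}
    (hc : c ^ 2 = 1 / (n : ℝ)) :
    ∑ k ∈ s, quadForm Sig ((c • opOf (transition A n (k + 1))).adjoint t) =
      quadForm ((1 / (n : ℝ)) • gramSum A Sig n s) t := by
  rw [quadForm_smul_left, quadForm_gramSum, Finset.mul_sum]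
  refine Finset.sum_congr rfl fun k _ => ?_
  rw [map_smulₛₗ, _root_.smul_apply, quadForm_smul_right]
  simp only [conj_trivial, hc]

lemma one_div_sqrt_sq (n : ℕ) : (1 / √(n : ℝ)) ^ 2 = 1 / (n : ℝ) := by
  rw [div_pow, one_pow, Real.sq_sqrt (Nat.cast_nonneg n)]

theorem IsLinearRWSD.subcritical (hX : IsLinearRWSD P X A Sig) (hd : 0 < d)
    (h : lambdaMax A < 1 / 2) :
    ∃ Xi : Matrix (Fin d) (Fin d) ℝ, IsLyapunovSolution A Sig Xi ∧
      (∀ Xi', IsLyapunovSolution A Sig Xi' → Xi' = Xi) ∧ Xi.PosSemidef ∧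
      ConvergesInLaw P (fun n ω => (1 / √(n : ℝ)) • walk X n ω) (multivariateGaussian 0 Xi) := by
  obtain ⟨α, hα1, hα2⟩ := exists_between (max_lt h (by norm_num : (0 : ℝ) < 1 / 2))
  rw [max_lt_iff] at hα1
  have hA := isUnit_one_add_smul hX.lambdaMin_pos
  obtain ⟨K, hK⟩ := exists_norm_flow_le hd hα1.1
  obtain ⟨C, hC, hΦ⟩ := norm_transition_le hA hK
  -- For zero right-hand side the normalised Gram sums vanish identically, yet they converge to Z.
  have hinj : ∀ Z : Matrix (Fin d) (Fin d) ℝ, Z - A * Z - Z * star A = 0 → Z = 0 := by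
    intro Z hZ
    have := tendsto_gramSum_range hA hK hα1.2 hα2 hZ
    simp only [gramSum, mul_zero, zero_mul, Finset.sum_const_zero, smul_zero] at this
    exact tendsto_nhds_unique this tendsto_const_nhds
  obtain ⟨Xi, hXi, huniq⟩ := exists_lyapunovSolution hinj Sig
  have hlim := tendsto_gramSum_range hA hK hα1.2 hα2 hXi
  have hq : ∀ t, Tendsto (fun n : ℕ => quadForm ((1 / (n : ℝ)) •
      gramSum A Sig n (Finset.range n)) t) atTop (𝓝 (quadForm Xi t)) := fun t =>
    ((continuous_quadForm_left t).tendsto Xi).comp hlim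
  have hpsd : Xi.PosSemidef := by
    refine posSemidef_of_quadForm_nonneg (huniq _ (transpose_lyapunov hX.transpose_eq hXi))
      fun t => ge_of_tendsto (hq t) (Eventually.of_forall fun n => ?_)
    rw [quadForm_smul_left, quadForm_gramSum]
    exact mul_nonneg (by positivity)
      (Finset.sum_nonneg fun k _ => quadForm_nonneg hX.posDef.posSemidef _)
  refine ⟨Xi, isLyapunovSolution_iff.2 hXi, fun Xi' h' => huniq Xi' (isLyapunovSolution_iff.1 h'),
    hpsd, ?_⟩
  obtain ⟨p, M, δ, hN⟩ := hX.exists_isMartingaleNoise hd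
  -- The coefficients Φ(n,k+1)/√n are at most C n^{α-1/2} uniformly in k < n, and there is no
  -- remainder.
  refine hN.convergesInLaw (m := id)
    (B := fun n k => (1 / √(n : ℝ)) • opOf (transition A n (k + 1)))
    (β := fun n => C * (n : ℝ) ^ (-(1 / 2 - α))) (fun n => ?_) ?_ ?_ ?_ _ fun t => ?_
  · exact ((hX.measurable_walk n).const_smul (1 / √(n : ℝ))).aemeasurable
  · have := ((tendsto_rpow_neg_atTop (sub_pos.2 hα2)).comp
      tendsto_natCast_atTop_atTop).const_mul C
    simpa using this
  · refine Eventually.of_forall fun n k hk => ?_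
    have hk' : k + 1 ≤ n := hk
    have hn : (0 : ℝ) < n := by
      have : 0 < n := by lia
      exact_mod_cast this
    rw [norm_smul, norm_opOf, Real.norm_of_nonneg (by positivity)]
    calc _ ≤ 1 / √(n : ℝ) * (C * (n : ℝ) ^ α) := by
          gcongr
          refine (hΦ n (k + 1) (by lia) hk').trans ?_
          gcongr
          · exact hα1.2.le
          refine div_le_self hn.le ?_
          exact_mod_cast Nat.le_add_left 1 k
      _ = _ := by
          rw [neg_sub, Real.rpow_sub hn, Real.sqrt_eq_rpow]
          ring
  · refine tendsto_const_nhds.congr fun n => ?_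
    rw [← eLpNorm_zero (p := 1) (μ := P) (ε := EuclideanSpace ℝ (Fin d)) (α := Ω)]
    congr 1
    funext ω
    simp only [id, _root_.smul_apply, ← Finset.smul_sum, ← walk_eq_sum hA]
    simp
  · refine ⟨_, charFun_multivariateGaussian_zero hpsd t, (hq t).congr fun n => ?_⟩
    exact (sum_quadForm_smul n _ t (one_div_sqrt_sq n)).symm

end Noncritical

/-! ### The supercritical regime. -/

section Supercritical

open scoped RealInnerProductSpace Matrix.Norms.L2Operator

variable {Ω : Type*} [mΩ : MeasurableSpace Ω] {d : ℕ} {X : ℕ → Ω → EuclideanSpace ℝ (Fin d)}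
  {P : Measure Ω} [IsProbabilityMeasure P] {A Sig : Matrix (Fin d) (Fin d) ℝ}

/-- With H = `normProp`, n^{-A} Φ(n,k+1) = H n Φ(1,k+1). Inserting G' G = 1 separates a factor H n
G', which tends to 1 when G is the limit of H, from coefficients independent of n, so that the
remaining sum is a martingale. -/
lemma opOf_flow_neg_log_walk (hA : ∀ n : ℕ, IsUnit (1 + (1 / (n : ℝ)) • A))
    {G G' : Matrix (Fin d) (Fin d) ℝ} (hG : G' * G = 1) (n : ℕ) (ω : Ω) :
    opOf (flow A (-Real.log n)) (walk X n ω) = opOf (normProp A n * G')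
      (∑ k ∈ Finset.range n, opOf (G * transition A 1 (k + 1)) (noise X A k ω)) := by
  rw [walk_eq_sum hA, map_sum, map_sum]
  refine Finset.sum_congr rfl fun k _ => ?_
  rw [← opOf_mul_apply, ← opOf_mul_apply]
  congr 2
  rw [mul_assoc, ← mul_assoc G', hG, one_mul, normProp, mul_assoc, transition, transition,
    propagator_one, one_mul]

lemma flow_log_mul_normProp {G G' : Matrix (Fin d) (Fin d) ℝ} (hG : G' * G = 1) (n k : ℕ) :
    flow A (Real.log n) * (normProp A n * G') * (G * transition A 1 (k + 1)) =
      transition A n (k + 1) := by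
  rw [mul_assoc, mul_assoc (normProp A n), ← mul_assoc G', hG, one_mul, normProp,
    ← mul_assoc, ← mul_assoc, flow_mul_flow_neg, one_mul, transition, transition,
    propagator_one, one_mul]

lemma eLpNorm_opOf_le (M : Matrix (Fin d) (Fin d) ℝ) (f : Ω → EuclideanSpace ℝ (Fin d))
    (p : ℝ≥0∞) {c : ℝ} (hc : ‖M‖ ≤ c) :
    eLpNorm (fun ω => opOf M (f ω)) p P ≤ ENNReal.ofReal c * eLpNorm f p P :=
  eLpNorm_le_mul_eLpNorm_of_ae_le_mul (Eventually.of_forall fun _ =>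
    ((opOf M).le_opNorm _).trans (mul_le_mul_of_nonneg_right hc (norm_nonneg _))) _

/-- Operators at distance `ε` from the identity move `f` close to `W`. -/
lemma eLpNorm_opOf_sub_le {V : Matrix (Fin d) (Fin d) ℝ} {f W : Ω → EuclideanSpace ℝ (Fin d)}
    (hf : MemLp f 2 P) (hW : MemLp W 2 P) {c ε : ℝ} (hc : ‖V‖ ≤ c) (hε : ‖V - 1‖ ≤ ε) :
    eLpNorm (fun ω => opOf V (f ω) - W ω) 2 P ≤
      ENNReal.ofReal c * eLpNorm (fun ω => f ω - W ω) 2 P + ENNReal.ofReal ε * eLpNorm W 2 P := by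
  have e : (fun ω => opOf V (f ω) - W ω) =
      (fun ω => opOf V (f ω - W ω)) + fun ω => opOf (V - 1) (W ω) := by
    funext ω
    simp only [opOf, Pi.add_apply, map_sub, map_one, _root_.sub_apply, one_apply_eq_self]
    abel
  rw [e]
  refine (eLpNorm_add_le ((opOf V).comp_memLp' (hf.sub hW)).1
    ((opOf (V - 1)).comp_memLp' hW).1 one_le_two).trans ?_
  exact add_le_add (eLpNorm_opOf_le V _ 2 hc) (eLpNorm_opOf_le (V - 1) W 2 hε)

/-- In the supercritical case `n^{-A} S_n` is, up to a factor tending to the identity, a martingale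
with square-summable increments. -/
lemma summable_norm_sq_transition (G : Matrix (Fin d) (Fin d) ℝ) {C β : ℝ}
    (hβ : 1 / 2 < β)
    (hΦ : ∀ n k : ℕ, 1 ≤ n → n ≤ k → ‖transition A n k‖ ≤ C * ((n : ℝ) / k) ^ β) :
    Summable fun k : ℕ => ‖opOf (G * transition A 1 (k + 1))‖ ^ 2 := by
  have hs : Summable fun k : ℕ => 1 / ((k + 1 : ℕ) : ℝ) ^ (2 * β) :=
    (summable_nat_add_iff 1).2 (Real.summable_one_div_nat_rpow.2 (by linarith))
  refine Summable.of_nonneg_of_le (fun k => by positivity) (fun k => ?_)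
    (hs.mul_left (‖G‖ ^ 2 * C ^ 2))
  rw [norm_opOf]
  calc _ ≤ (‖G‖ * (C * (((1 : ℕ) : ℝ) / ((k + 1 : ℕ) : ℝ)) ^ β)) ^ 2 := by
        gcongr
        refine (norm_mul_le _ _).trans ?_
        gcongr
        exact hΦ 1 (k + 1) le_rfl (by lia)
    _ = _ := by
        rw [mul_pow, mul_pow, ← Real.rpow_natCast ((((1 : ℕ) : ℝ) / ((k + 1 : ℕ) : ℝ)) ^ β),
          ← Real.rpow_mul (by positivity), Real.div_rpow (by positivity) (by positivity)]
        push_cast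
        rw [mul_comm β 2, Real.one_rpow]
        ring

lemma adjoint_opOf_ne_zero {M M' : Matrix (Fin d) (Fin d) ℝ} (h : M * M' = 1)
    {x : EuclideanSpace ℝ (Fin d)} (hx : x ≠ 0) : (opOf M).adjoint x ≠ 0 := by
  intro h0
  have h1 : opOf M (opOf M' x) = x := by
    rw [← opOf_mul_apply, h, opOf, map_one]; rfl
  have h2 : ⟪x, x⟫ = 0 := by
    nth_rewrite 2 [← h1]
    rw [← ContinuousLinearMap.adjoint_inner_left, h0, inner_zero_left]
  exact hx (inner_self_eq_zero.1 h2)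

lemma matPow_eq_flow (n : ℕ) (B : Matrix (Fin d) (Fin d) ℝ) :
    matPow n B = flow B (Real.log n) := rfl

lemma matPow_neg_eq_flow (n : ℕ) (B : Matrix (Fin d) (Fin d) ℝ) :
    matPow n (-B) = flow B (-Real.log n) := by
  rw [matPow, flow, smul_neg, neg_smul]

lemma tendsto_const_div_sqrt (c : ℝ) : Tendsto (fun n : ℕ => c / √(n : ℝ)) atTop (𝓝 0) :=
  tendsto_const_nhds.div_atTop (Real.tendsto_sqrt_atTop.comp tendsto_natCast_atTop_atTop)

theorem IsLinearRWSD.supercritical (hX : IsLinearRWSD P X A Sig) (hd : 0 < d)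
    (h : 1 / 2 < lambdaMin A) :
    ∃ Xi : Matrix (Fin d) (Fin d) ℝ, IsLyapunovSolution A Sig Xi ∧
      (∀ Xi', IsLyapunovSolution A Sig Xi' → Xi' = Xi) ∧ (-Xi).PosSemidef ∧
      ∃ W : Ω → EuclideanSpace ℝ (Fin d),
        Measurable W ∧ MemLp W 2 P ∧ Nondegenerate P W ∧
        (∀ᵐ ω ∂P, Tendsto (fun n : ℕ => act (matPow n (-A)) (walk X n ω)) atTop (𝓝 (W ω))) ∧
        Tendsto (fun n : ℕ => eLpNorm
          (fun ω => act (matPow n (-A)) (walk X n ω) - W ω) 2 P) atTop (𝓝 0) ∧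
        ConvergesInLaw P
          (fun n ω => (1 / √(n : ℝ)) • (walk X n ω - act (matPow n A) (W ω)))
          (multivariateGaussian 0 (-Xi)) := by
  obtain ⟨β, hβ1, hβ2⟩ := exists_between h
  have hA := isUnit_one_add_smul hX.lambdaMin_pos
  obtain ⟨K, hK⟩ := exists_norm_flow_neg_le hd hβ2
  obtain ⟨K₁, hK₁⟩ := exists_norm_flow_le hd hX.lambdaMax_lt_one
  obtain ⟨C, hC, hΦ⟩ := norm_transition_le' hA hK
  obtain ⟨G, G', c, hGG', hG'G, hNG, hNc, -⟩ := exists_normProp_limit hA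
  have hc : 0 ≤ c := (norm_nonneg _).trans (hNc 1 le_rfl)
  have hK₁0 : 0 ≤ K₁ := by simpa using (norm_nonneg _).trans (hK₁ 0 le_rfl)
  -- With σ = 0 the Gram sums vanish, leaving ‖Z‖ ≤ D/n for every n ≥ 1.
  have hinj : ∀ Z : Matrix (Fin d) (Fin d) ℝ, Z - A * Z - Z * star A = 0 → Z = 0 := by
    intro Z hZ
    obtain ⟨D, hD⟩ := eventually_norm_gramSum_Ico_le hA hK hβ1 hZ
    have h1 : ∀ n : ℕ, 1 ≤ n → ‖Z‖ ≤ D / n := fun n hn => by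
      obtain ⟨m, hm⟩ := (hD n hn).exists
      simpa [gramSum] using hm
    have h2 := ge_of_tendsto (tendsto_const_div_atTop_nhds_zero_nat D)
      (eventually_atTop.2 ⟨1, h1⟩)
    exact norm_le_zero_iff.1 h2
  obtain ⟨Xi, hXi, huniq⟩ := exists_lyapunovSolution hinj Sig
  obtain ⟨D, hD⟩ := eventually_norm_gramSum_Ico_le hA hK hβ1 hXi
  obtain ⟨p, M, δ, hN⟩ := hX.exists_isMartingaleNoise hd
  set B : ℕ → EuclideanSpace ℝ (Fin d) →L[ℝ] EuclideanSpace ℝ (Fin d) :=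
    fun k => opOf (G * transition A 1 (k + 1)) with hBdef
  have hBsum : Summable fun k => ‖B k‖ ^ 2 := summable_norm_sq_transition G hβ1 hΦ
  obtain ⟨W, hWm, hW2, hWae, hWL2⟩ := hN.exists_limit hBsum
  set Z : ℕ → Ω → EuclideanSpace ℝ (Fin d) :=
    fun n ω => ∑ k ∈ Finset.range n, B k (noise X A k ω) with hZdef
  have hZ2 : ∀ n, MemLp (Z n) 2 P := fun n => hN.memLp_sum B _
  set V : ℕ → Matrix (Fin d) (Fin d) ℝ := fun n => normProp A n * G' with hVdef
  have hV1 : ∀ n : ℕ, 1 ≤ n → ‖V n - 1‖ ≤ c * ‖G'‖ / n := by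
    intro n hn
    rw [hVdef, ← hGG', ← sub_mul]
    refine (norm_mul_le _ _).trans ?_
    rw [mul_div_right_comm]
    gcongr
    exact hNG n hn
  have hVc : ∀ n : ℕ, 1 ≤ n → ‖V n‖ ≤ c * ‖G'‖ := fun n hn =>
    (norm_mul_le _ _).trans (by gcongr; exact hNc n hn)
  have hwalk : ∀ n ω, act (matPow n (-A)) (walk X n ω) = opOf (V n) (Z n ω) := by
    intro n ω
    rw [act_eq, matPow_neg_eq_flow, opOf_flow_neg_log_walk hA hG'G]
  have hVlim : Tendsto V atTop (𝓝 1) := by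
    rw [tendsto_iff_norm_sub_tendsto_zero]
    exact squeeze_zero' (Eventually.of_forall fun n => norm_nonneg _)
      (eventually_atTop.2 ⟨1, hV1⟩) (tendsto_const_div_atTop_nhds_zero_nat _)
  -- -Ξ is within O(1/n) of Gram sums of Σ, which have nonnegative quadratic forms.
  have hpsd : (-Xi).PosSemidef := by
    refine posSemidef_of_quadForm_nonneg ?_ fun t => ?_
    · rw [Matrix.transpose_neg, huniq _ (transpose_lyapunov hX.transpose_eq hXi)]
    · have h1 : ∀ n : ℕ, 1 ≤ n → -(D / n * ‖t‖ ^ 2) ≤ quadForm (-Xi) t := by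
        intro n hn
        obtain ⟨m, hm⟩ := (hD n hn).exists
        have h2 : 0 ≤ quadForm ((1 / (n : ℝ)) • gramSum A Sig n (Finset.Ico n m)) t := by
          rw [quadForm_smul_left, quadForm_gramSum]
          exact mul_nonneg (by positivity)
            (Finset.sum_nonneg fun k _ => quadForm_nonneg hX.posDef.posSemidef _)
        have h3 := (abs_le.1 ((abs_quadForm_le _ t).trans
          (mul_le_mul_of_nonneg_right hm (by positivity)))).2
        have h4 : quadForm ((1 / (n : ℝ)) • gramSum A Sig n (Finset.Ico n m) + Xi) t =
            quadForm ((1 / (n : ℝ)) • gramSum A Sig n (Finset.Ico n m)) t - quadForm (-Xi) t := by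
          simp only [quadForm, opOf, map_add, map_neg, _root_.add_apply, _root_.neg_apply,
            inner_add_right, inner_neg_right]
          ring
        linarith
      have h5 : Tendsto (fun n : ℕ => -(D / n * ‖t‖ ^ 2)) atTop (𝓝 0) := by
        simpa using ((tendsto_const_div_atTop_nhds_zero_nat D).mul_const (‖t‖ ^ 2)).neg
      exact le_of_tendsto h5 (eventually_atTop.2 ⟨1, h1⟩)
  refine ⟨Xi, isLyapunovSolution_iff.2 hXi, fun Xi' h' => huniq Xi' (isLyapunovSolution_iff.1 h'),
    hpsd, W, hWm, hW2, ?_, ?_, ?_, ?_⟩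
  · refine hN.nondegenerate (B := B) (fun k x hx => ?_) hW2 hWL2
    have h1 : transition A 1 (k + 1) * propagator A (k + 1) = 1 := by
      rw [transition_mul_propagator hA, propagator_one]
    refine adjoint_opOf_ne_zero (M' := propagator A (k + 1) * G') ?_ hx
    rw [mul_assoc, ← mul_assoc (transition A 1 (k + 1)), h1, one_mul, hGG']
  · filter_upwards [hWae] with ω hω
    simp only [hwalk]
    have h1 : Tendsto (fun n => opOf (V n)) atTop (𝓝 (opOf 1)) := by
      rw [tendsto_iff_norm_sub_tendsto_zero] at hVlim ⊢
      simp only [opOf, ← map_sub]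
      exact hVlim
    have h2 := ((isBoundedBilinearMap_apply (𝕜 := ℝ)).continuous.tendsto (opOf 1, W ω)).comp
      (h1.prodMk_nhds hω)
    simp only [opOf, map_one] at h2
    exact h2
  · simp only [hwalk]
    have h1 : Tendsto (fun n : ℕ => ENNReal.ofReal (c * ‖G'‖) * eLpNorm (fun ω => Z n ω - W ω) 2 P +
        ENNReal.ofReal (c * ‖G'‖ / n) * eLpNorm W 2 P) atTop (𝓝 0) := by
      have h2 := ENNReal.Tendsto.const_mul (a := ENNReal.ofReal (c * ‖G'‖)) hWL2
        (Or.inr ENNReal.ofReal_ne_top)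
      have h3 := ENNReal.Tendsto.mul_const (b := eLpNorm W 2 P)
        (ENNReal.tendsto_ofReal (tendsto_const_div_atTop_nhds_zero_nat (c * ‖G'‖)))
        (Or.inr hW2.2.ne)
      simpa using h2.add h3
    refine tendsto_of_tendsto_of_tendsto_of_le_of_le' tendsto_const_nhds h1
      (Eventually.of_forall fun n => zero_le) (eventually_atTop.2 ⟨1, fun n hn => ?_⟩)
    exact eLpNorm_opOf_sub_le (hZ2 n) hW2 (hVc n hn) (hV1 n hn)
  -- The infinite tail k ≥ n is cut at an index m n so far out that the Gram sum over [n, m n) is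
  -- already near -nΞ and Z (m n) is within 1/n of W in L². The central limit theorem then applies
  -- to a finite array.
  · have hm : ∀ n : ℕ, ∃ m, n ≤ m ∧ (1 ≤ n →
        ‖(1 / (n : ℝ)) • gramSum A Sig n (Finset.Ico n m) + Xi‖ ≤ D / n ∧
        eLpNorm (fun ω => Z m ω - W ω) 2 P ≤ ENNReal.ofReal (1 / n)) := by
      intro n
      rcases Nat.eq_zero_or_pos n with rfl | hn
      · exact ⟨0, le_rfl, by simp⟩
      · have h1 : ∀ᶠ m in atTop, eLpNorm (fun ω => Z m ω - W ω) 2 P ≤ ENNReal.ofReal (1 / n) :=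
          hWL2.eventually (ge_mem_nhds (ENNReal.ofReal_pos.2 (by positivity)))
        obtain ⟨m, h2, h3, h4⟩ := ((eventually_ge_atTop n).and ((hD n hn).and h1)).exists
        exact ⟨m, h2, fun _ => ⟨h3, h4⟩⟩
    choose m hnm hm using hm
    set w : ℝ := (eLpNorm W 2 P).toReal
    have hw : eLpNorm W 2 P = ENNReal.ofReal w := (ENNReal.ofReal_toReal hW2.2.ne).symm
    refine hN.convergesInLaw (m := m)
      (B := fun n k => if n ≤ k then (-(1 / √(n : ℝ))) • opOf (transition A n (k + 1)) else 0)
      (β := fun n => C / √(n : ℝ)) (fun n => ?_) (tendsto_const_div_sqrt C) ?_ ?_ _ fun t => ?_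
    · exact (((hX.measurable_walk n).sub ((opOf (matPow n A)).measurable.comp hWm)).const_smul
        (1 / √(n : ℝ))).aemeasurable
    · refine eventually_atTop.2 ⟨1, fun n hn k _ => ?_⟩
      split_ifs with hk
      · rw [norm_smul, norm_opOf, norm_neg, Real.norm_of_nonneg (by positivity), div_mul_eq_mul_div,
          one_mul]
        gcongr
        refine (hΦ n (k + 1) hn (by lia)).trans (mul_le_of_le_one_right hC ?_)
        refine Real.rpow_le_one (by positivity) ?_ (by linarith)
        rw [div_le_one (by positivity)]
        exact_mod_cast (by lia : n ≤ k + 1)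
      · rw [norm_zero]; positivity
    · have hlim : Tendsto (fun n : ℕ => ENNReal.ofReal
          (K₁ * (c * ‖G'‖ + c * ‖G'‖ * w) / √(n : ℝ))) atTop (𝓝 0) := by
        simpa using ENNReal.tendsto_ofReal (tendsto_const_div_sqrt (K₁ * (c * ‖G'‖ + c * ‖G'‖ * w)))
      refine tendsto_of_tendsto_of_tendsto_of_le_of_le' tendsto_const_nhds hlim
        (Eventually.of_forall fun n => zero_le) (eventually_atTop.2 ⟨1, fun n hn => ?_⟩)
      have hn0 : (0 : ℝ) < n := by exact_mod_cast hn
      -- n^A V n Z (m n) is exactly ∑_{k < m n} Φ(n,k+1) e k, whose first n terms form S n.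
      -- Replacing W by V n Z (m n) thus produces the tail sum and leaves n^A (V n Z (m n) - W)/√n.
      have e : ∀ ω, (1 / √(n : ℝ)) • (walk X n ω - act (matPow n A) (W ω)) -
          ∑ k ∈ Finset.range (m n), (if n ≤ k then
            (-(1 / √(n : ℝ))) • opOf (transition A n (k + 1)) else 0) (noise X A k ω) =
          opOf ((1 / √(n : ℝ)) • flow A (Real.log n)) (opOf (V n) (Z (m n) ω) - W ω) := by
        intro ω
        have e1 : ∑ k ∈ Finset.range (m n), (if n ≤ k then
            (-(1 / √(n : ℝ))) • opOf (transition A n (k + 1)) else 0) (noise X A k ω) =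
            ∑ k ∈ Finset.Ico n (m n),
              (-(1 / √(n : ℝ))) • opOf (transition A n (k + 1)) (noise X A k ω) := by
          rw [Finset.range_eq_Ico, ← Finset.sum_Ico_consecutive _ (Nat.zero_le n) (hnm n),
            Finset.sum_eq_zero, zero_add]
          · refine Finset.sum_congr rfl fun k hk => ?_
            rw [if_pos (Finset.mem_Ico.1 hk).1]; rfl
          · intro k hk
            rw [if_neg (by have := (Finset.mem_Ico.1 hk).2; lia)]; rfl
        have e2 : opOf (flow A (Real.log n)) (opOf (V n) (Z (m n) ω)) =
            ∑ k ∈ Finset.range (m n), opOf (transition A n (k + 1)) (noise X A k ω) := by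
          rw [hZdef, map_sum, map_sum]
          refine Finset.sum_congr rfl fun k _ => ?_
          rw [← opOf_mul_apply, ← opOf_mul_apply, ← flow_log_mul_normProp hG'G n k, mul_assoc]
        have e3 : opOf ((1 / √(n : ℝ)) • flow A (Real.log n)) (opOf (V n) (Z (m n) ω) - W ω) =
            (1 / √(n : ℝ)) • (opOf (flow A (Real.log n)) (opOf (V n) (Z (m n) ω)) -
              opOf (flow A (Real.log n)) (W ω)) := by
          rw [opOf, map_smul, _root_.smul_apply, map_sub]
        rw [e1, e3, e2, act_eq, matPow_eq_flow, ← Finset.smul_sum, walk_eq_sum hA,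
          Finset.range_eq_Ico, Finset.range_eq_Ico,
          ← Finset.sum_Ico_consecutive _ (Nat.zero_le n) (hnm n), neg_smul, sub_neg_eq_add,
          ← smul_add]
        congr 1
        abel
      simp only [e]
      -- λ_max < 1 gives ‖n^A‖ ≤ K₁ n; as V n Z (m n) - W is O(1/n) in L², the remainder is O(1/√n).
      have hflow : ‖(1 / √(n : ℝ)) • flow A (Real.log n)‖ ≤ K₁ * √(n : ℝ) := by
        rw [norm_smul, Real.norm_of_nonneg (by positivity)]
        calc _ ≤ 1 / √(n : ℝ) * (K₁ * Real.exp (1 * Real.log n)) := by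
              gcongr
              exact hK₁ _ (Real.log_natCast_nonneg n)
          _ = _ := by
              rw [one_mul, Real.exp_log hn0]
              have : (n : ℝ) = √(n : ℝ) * √(n : ℝ) := (Real.mul_self_sqrt hn0.le).symm
              have h0 : 0 < √(n : ℝ) := Real.sqrt_pos.2 hn0
              field_simp
              rw [sq, ← this, mul_comm]
      have hmem : MemLp (fun ω => opOf (V n) (Z (m n) ω) - W ω) 2 P :=
        ((opOf (V n)).comp_memLp' (hZ2 (m n))).sub hW2
      refine (eLpNorm_le_eLpNorm_of_exponent_le one_le_two ((opOf _).comp_memLp' hmem).1).trans ?_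
      refine (eLpNorm_opOf_le _ _ 2 hflow).trans ?_
      refine (mul_le_mul_right ((eLpNorm_opOf_sub_le (hZ2 (m n)) hW2 (hVc n hn) (hV1 n hn)).trans
        (add_le_add (mul_le_mul_right (hm n hn).2 _) le_rfl)) _).trans ?_
      rw [hw, ← ENNReal.ofReal_mul (by positivity), ← ENNReal.ofReal_mul (by positivity),
        ← ENNReal.ofReal_add (by positivity) (by positivity), ← ENNReal.ofReal_mul (by positivity)]
      refine ENNReal.ofReal_le_ofReal (le_of_eq ?_)
      have : (n : ℝ) = √(n : ℝ) * √(n : ℝ) := (Real.mul_self_sqrt hn0.le).symm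
      have h0 : 0 < √(n : ℝ) := Real.sqrt_pos.2 hn0
      rw [this, Real.sqrt_mul_self h0.le]
      field_simp
    · refine ⟨_, charFun_multivariateGaussian_zero hpsd t, ?_⟩
      have h1 : Tendsto (fun n : ℕ => (1 / (n : ℝ)) • gramSum A Sig n (Finset.Ico n (m n))) atTop
          (𝓝 (-Xi)) := by
        rw [tendsto_iff_norm_sub_tendsto_zero]
        refine squeeze_zero' (Eventually.of_forall fun n => norm_nonneg _)
          (eventually_atTop.2 ⟨1, fun n hn => ?_⟩) (tendsto_const_div_atTop_nhds_zero_nat D)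
        rw [sub_neg_eq_add]
        exact (hm n hn).1
      refine (((continuous_quadForm_left t).tendsto (-Xi)).comp h1).congr fun n => ?_
      have hsq : (-(1 / √(n : ℝ))) ^ 2 = 1 / (n : ℝ) := by rw [neg_sq, one_div_sqrt_sq]
      rw [Function.comp_apply, ← sum_quadForm_smul n _ t hsq, Finset.range_eq_Ico,
        ← Finset.sum_Ico_consecutive _ (Nat.zero_le n) (hnm n),
        Finset.sum_eq_zero (s := Finset.Ico 0 n), zero_add]
      · refine Finset.sum_congr rfl fun k hk => ?_
        rw [if_pos (Finset.mem_Ico.1 hk).1]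
      · intro k hk
        rw [if_neg (by have := (Finset.mem_Ico.1 hk).2; lia), map_zero, _root_.zero_apply,
          quadForm_zero_right]

end Supercritical

/-! ### Asymptotics of the sums of (log k)^m / k. -/

section LogSums

lemma tendsto_log_natCast : Tendsto (fun n : ℕ => Real.log n) atTop atTop :=
  Real.tendsto_log_atTop.comp tendsto_natCast_atTop_atTop

/-- b^{m+1} - a^{m+1} = (b - a) ∑ b^i a^{m-i}, with every summand between a^m and b^m. -/
lemma mul_pow_mul_sub_le_pow_sub_pow {a b : ℝ} (ha : 0 ≤ a) (hab : a ≤ b) (m : ℕ) :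
    (m + 1) * a ^ m * (b - a) ≤ b ^ (m + 1) - a ^ (m + 1) ∧
      b ^ (m + 1) - a ^ (m + 1) ≤ (m + 1) * b ^ m * (b - a) := by
  have e : (∑ i ∈ Finset.range (m + 1), b ^ i * a ^ (m - i)) * (b - a) =
      b ^ (m + 1) - a ^ (m + 1) := by
    have := (Commute.all b a).geom_sum₂_mul (m + 1)
    simpa using this
  have hb : 0 ≤ b := ha.trans hab
  rw [← e]
  constructor
  · refine mul_le_mul_of_nonneg_right ?_ (sub_nonneg.2 hab)
    calc _ = ∑ i ∈ Finset.range (m + 1), a ^ m := by simp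
      _ ≤ _ := by
        refine Finset.sum_le_sum fun i hi => ?_
        have hi' : i + (m - i) = m := by have := Finset.mem_range.1 hi; lia
        calc a ^ m = a ^ i * a ^ (m - i) := by rw [← pow_add, hi']
          _ ≤ _ := by gcongr
  · refine mul_le_mul_of_nonneg_right ?_ (sub_nonneg.2 hab)
    calc _ ≤ ∑ i ∈ Finset.range (m + 1), b ^ m := by
          refine Finset.sum_le_sum fun i hi => ?_
          have hi' : i + (m - i) = m := by have := Finset.mem_range.1 hi; lia
          calc _ ≤ b ^ i * b ^ (m - i) := by gcongr
            _ = b ^ m := by rw [← pow_add, hi']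
      _ = _ := by simp

lemma log_succ_sub_log_bounds {k : ℕ} (hk : 1 ≤ k) :
    1 / ((k : ℝ) + 1) ≤ Real.log (k + 1) - Real.log k ∧
      Real.log (k + 1) - Real.log k ≤ 1 / (k : ℝ) := by
  have h0 : (0 : ℝ) < k := by exact_mod_cast hk
  rw [← Real.log_div (by positivity) h0.ne']
  constructor
  · have := Real.one_sub_inv_le_log_of_pos (x := ((k : ℝ) + 1) / k) (by positivity)
    refine le_trans (le_of_eq ?_) this
    field_simp
    ring
  · have := Real.log_le_sub_one_of_pos (x := ((k : ℝ) + 1) / k) (by positivity)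
    refine this.trans (le_of_eq ?_)
    field_simp
    ring

/-- The sums `∑_{k ≤ n} (log k)^m / k` grow like `(log n)^(m+1) / (m+1)`. -/
theorem tendsto_sum_log_pow_div (m : ℕ) :
    Tendsto (fun n : ℕ => (∑ k ∈ Finset.range n, Real.log (k + 1) ^ m / ((k : ℝ) + 1)) /
      Real.log n ^ (m + 1)) atTop (𝓝 (1 / ((m : ℝ) + 1))) := by
  -- The terms, multiplied by m + 1, are equivalent to increments of (log k)^{m+1}, which telescope;
  -- equivalence with nonnegative terms passes to divergent sums.
  set g : ℕ → ℝ := fun k => Real.log (k + 1) ^ (m + 1) - Real.log k ^ (m + 1) with hg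
  set f : ℕ → ℝ := fun k => (m + 1) * (Real.log (k + 1) ^ m / ((k : ℝ) + 1)) with hf
  have hlog0 : ∀ k : ℕ, 0 ≤ Real.log k := fun k => Real.log_natCast_nonneg k
  have hlogle : ∀ k : ℕ, Real.log k ≤ Real.log (k + 1) := by
    intro k
    rcases Nat.eq_zero_or_pos k with rfl | hk
    · simp
    · exact Real.log_le_log (by exact_mod_cast hk) (by linarith)
  have hg0 : 0 ≤ g := fun k => sub_nonneg.2 (pow_le_pow_left₀ (hlog0 k) (hlogle k) _)
  have hsum : ∀ n : ℕ, ∑ k ∈ Finset.range n, g k = Real.log n ^ (m + 1) := by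
    intro n
    have := Finset.sum_range_sub (fun k : ℕ => Real.log k ^ (m + 1)) n
    simpa [hg] using this
  have hpow : Tendsto (fun n : ℕ => Real.log n ^ (m + 1)) atTop atTop :=
    (tendsto_pow_atTop (by lia)).comp tendsto_log_natCast
  have hratio : Tendsto (g / f) atTop (𝓝 1) := by
    have l1 : Tendsto (fun k : ℕ => (1 - 1 / (k : ℝ)) ^ m) atTop (𝓝 1) := by
      simpa using ((tendsto_const_nhds (x := (1 : ℝ))).sub
        (tendsto_const_div_atTop_nhds_zero_nat (1 : ℝ))).pow m
    have l2 : Tendsto (fun k : ℕ => 1 + 1 / (k : ℝ)) atTop (𝓝 1) := by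
      simpa using (tendsto_const_nhds (x := (1 : ℝ))).add
        (tendsto_const_div_atTop_nhds_zero_nat (1 : ℝ))
    have hbig : ∀ᶠ k : ℕ in atTop, 1 ≤ k ∧ 1 ≤ Real.log k :=
      (eventually_ge_atTop 1).and (tendsto_log_natCast.eventually (eventually_ge_atTop 1))
    have key : ∀ k : ℕ, 1 ≤ k → 1 ≤ Real.log k →
        (1 - 1 / (k : ℝ)) ^ m ≤ (g / f) k ∧ (g / f) k ≤ 1 + 1 / (k : ℝ) := by
      intro k hk1 hk2
      have hk0 : (1 : ℝ) ≤ k := by exact_mod_cast hk1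
      have hb1 : 1 ≤ Real.log (k + 1) := hk2.trans (hlogle k)
      have hb0 : 0 < Real.log (k + 1) := by linarith
      obtain ⟨b1, b2⟩ := log_succ_sub_log_bounds hk1
      obtain ⟨p1, p2⟩ := mul_pow_mul_sub_le_pow_sub_pow (hlog0 k) (hlogle k) m
      have hf0 : 0 < f k := by positivity
      have h1k : 1 / (k : ℝ) ≤ 1 := by rw [div_le_one (by linarith)]; exact hk0
      rw [Pi.div_apply, le_div_iff₀ hf0, div_le_iff₀ hf0]
      constructor
      · refine le_trans ?_ p1
        -- log(k+1) - log k ≤ 1/k ≤ log(k+1)/k, as soon as log(k+1) ≥ 1.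
        have h3 : (1 - 1 / (k : ℝ)) * Real.log (k + 1) ≤ Real.log k := by
          have : 1 / (k : ℝ) * 1 ≤ 1 / (k : ℝ) * Real.log (k + 1) := by gcongr
          linarith
        have h4 : ((1 - 1 / (k : ℝ)) * Real.log (k + 1)) ^ m ≤ Real.log k ^ m :=
          pow_le_pow_left₀ (mul_nonneg (by linarith) hb0.le) h3 m
        calc _ = (m + 1) * ((1 - 1 / (k : ℝ)) * Real.log (k + 1)) ^ m * (1 / ((k : ℝ) + 1)) := by
              rw [hf, mul_pow]; ring
          _ ≤ _ := by
              gcongr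
      · refine p2.trans ?_
        calc _ ≤ (m + 1) * Real.log (k + 1) ^ m * (1 / (k : ℝ)) := by gcongr
          _ = _ := by rw [hf]; field_simp
    exact tendsto_of_tendsto_of_tendsto_of_le_of_le' l1 l2
      (hbig.mono fun k hk => (key k hk.1 hk.2).1) (hbig.mono fun k hk => (key k hk.1 hk.2).2)
  have heq : Asymptotics.IsEquivalent atTop f g :=
    (Asymptotics.isEquivalent_of_tendsto_one hratio).symm
  have ho := heq.isLittleO.sum_range hg0 (by simpa only [hsum] using hpow)
  have h2 : Tendsto (fun n : ℕ => (∑ k ∈ Finset.range n, f k) / Real.log n ^ (m + 1)) atTop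
      (𝓝 1) := by
    have h3 := ho.tendsto_div_nhds_zero.add_const 1
    rw [zero_add] at h3
    refine h3.congr' ?_
    filter_upwards [hpow.eventually (eventually_gt_atTop 0)] with n hn
    simp only [Pi.sub_apply, Finset.sum_sub_distrib, hsum]
    rw [sub_div, div_self hn.ne', sub_add_cancel]
  have h4 := h2.div_const ((m : ℝ) + 1)
  refine h4.congr fun n => ?_
  rw [hf, ← Finset.mul_sum]
  have : ((m : ℝ) + 1) ≠ 0 := by positivity
  field_simp

end LogSums

/-! ### Rescaled coefficients in a Jordan basis and the critical covariance matrix. -/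

section JordanKernel

variable {d : ℕ}

/-- The rescaled coefficients of the noise in the critical case, in a Jordan basis. -/
def jordanKernel (d n k : ℕ) : Matrix (Fin d) (Fin d) ℝ :=
  Matrix.of fun i j => if i ≤ j then
    Real.log n ^ (-((d : ℝ) - 1 / 2 - (i : ℕ))) * (((k : ℝ) + 1) ^ (-(1 / 2 : ℝ)) *
      ((-Real.log (k + 1)) ^ ((j : ℕ) - i) / ((j : ℕ) - (i : ℕ)).factorial)) else 0

lemma jordanKernel_apply_of_le (n k : ℕ) {i j : Fin d} (hij : i ≤ j) :
    jordanKernel d n k i j = Real.log n ^ (-((d : ℝ) - 1 / 2 - (i : ℕ))) *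
      (((k : ℝ) + 1) ^ (-(1 / 2 : ℝ)) *
        ((-Real.log (k + 1)) ^ ((j : ℕ) - i) / ((j : ℕ) - (i : ℕ)).factorial)) := by
  rw [jordanKernel, Matrix.of_apply, if_pos hij]

/-- Row i carries (log n)^{-(d-1/2-i)} and the entry contributes at most (log n)^{j-i}; as j ≤ d -
1, the total exponent is at most -1/2. -/
lemma abs_jordanKernel_le {n k : ℕ} (hkn : k < n) (hn : 1 ≤ Real.log n) (i j : Fin d) :
    |jordanKernel d n k i j| ≤ Real.log n ^ (-(1 / 2 : ℝ)) := by
  have hl0 : 0 < Real.log n := by linarith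
  rcases le_or_gt i j with hij | hij
  swap
  · rw [jordanKernel, Matrix.of_apply, if_neg (not_le.2 hij), abs_zero]
    positivity
  rw [jordanKernel_apply_of_le n k hij]
  have hlk0 : 0 ≤ Real.log ((k : ℝ) + 1) := by
    have := Real.log_natCast_nonneg (k + 1)
    exact_mod_cast this
  have hlk : Real.log ((k : ℝ) + 1) ≤ Real.log n :=
    Real.log_le_log (by positivity) (by exact_mod_cast hkn)
  have h1 : ((k : ℝ) + 1) ^ (-(1 / 2 : ℝ)) ≤ 1 :=
    Real.rpow_le_one_of_one_le_of_nonpos (by linarith [Nat.cast_nonneg (α := ℝ) k]) (by norm_num)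
  have h2 : (1 : ℝ) ≤ ((j : ℕ) - (i : ℕ)).factorial := by exact_mod_cast Nat.factorial_pos _
  rw [abs_mul, abs_mul, abs_div, abs_pow, abs_neg, abs_of_nonneg hlk0,
    abs_of_nonneg (Real.rpow_nonneg hl0.le _), abs_of_nonneg (by positivity :
      0 ≤ ((k : ℝ) + 1) ^ (-(1 / 2 : ℝ))), Nat.abs_cast]
  calc _ ≤ Real.log n ^ (-((d : ℝ) - 1 / 2 - (i : ℕ))) *
        (1 * (Real.log n ^ ((j : ℕ) - (i : ℕ)) / 1)) := by gcongr
    _ = Real.log n ^ (-((d : ℝ) - 1 / 2 - (i : ℕ)) + (((j : ℕ) - (i : ℕ) : ℕ) : ℝ)) := by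
        rw [one_mul, div_one, Real.rpow_add hl0, Real.rpow_natCast]
    _ ≤ _ := by
        refine Real.rpow_le_rpow_of_exponent_le hn ?_
        rw [Nat.cast_sub (by exact_mod_cast hij)]
        have : ((j : ℕ) : ℝ) + 1 ≤ d := by exact_mod_cast j.2
        linarith

/-- The last index. -/
def lastIdx (hd : 0 < d) : Fin d := ⟨d - 1, Nat.sub_lt hd one_pos⟩

/-- The indices enter only through their distances a, b to the last one, as (-1)^{a+b}/(a! b!
(a+b+1)): the form in which the logarithmic sums deliver the limit. -/
lemma critMatrix_one_apply (i i' : Fin d) :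
    critMatrix d (1 : ℝ) i i' = (-1) ^ ((d - 1 - (i : ℕ)) + (d - 1 - (i' : ℕ))) /
      (((d - 1 - (i : ℕ)).factorial : ℝ) * (d - 1 - (i' : ℕ)).factorial) *
      (1 / ((((d - 1 - (i : ℕ)) + (d - 1 - (i' : ℕ)) : ℕ) : ℝ) + 1)) := by
  have hi := i.2
  have hi' := i'.2
  rw [critMatrix, Matrix.of_apply, mul_one]
  have e1 : d - ((i : ℕ) + 1) = d - 1 - i := by lia
  have e2 : d - ((i' : ℕ) + 1) = d - 1 - i' := by lia
  have e3 : (((d - 1 - (i : ℕ)) + (d - 1 - (i' : ℕ)) : ℕ) : ℝ) + 1 =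
      2 * (d : ℝ) - ((i : ℕ) + 1) - ((i' : ℕ) + 1) + 1 := by
    have : (d - 1 - (i : ℕ)) + (d - 1 - (i' : ℕ)) + ((i + 1) + (i' + 1)) = 2 * d := by lia
    have h2 : (((d - 1 - (i : ℕ)) + (d - 1 - (i' : ℕ)) : ℕ) : ℝ) + ((i + 1) + (i' + 1)) =
        2 * d := by exact_mod_cast this
    linarith
  have e4 : (-1 : ℝ) ^ ((i : ℕ) + 1 + ((i' : ℕ) + 1)) =
      (-1) ^ ((d - 1 - (i : ℕ)) + (d - 1 - (i' : ℕ))) := by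
    have : (d - 1 - (i : ℕ)) + (d - 1 - (i' : ℕ)) + ((i + 1) + (i' + 1)) = 2 * d := by lia
    rw [neg_one_pow_eq_pow_mod_two, neg_one_pow_eq_pow_mod_two (n := (d - 1 - (i : ℕ)) + _)]
    congr 1
    lia
  rw [e1, e2, e3, e4]
  field_simp

/-- With a = j - i and b = j' - i', the sum over k is of order (log n)^{a+b+1}, and the rescaling
leaves (log n)^{j+j'+2-2d}. This exponent is zero only for j = j' = d - 1, so only the last column
survives. -/
lemma tendsto_sum_jordanKernel_mul (hd : 0 < d) (i j i' j' : Fin d) :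
    Tendsto (fun n : ℕ => ∑ k ∈ Finset.range n, jordanKernel d n k i j * jordanKernel d n k i' j')
      atTop (𝓝 (if j = lastIdx hd ∧ j' = lastIdx hd then critMatrix d (1 : ℝ) i i' else 0)) := by
  -- Below the diagonal the kernel is zero, and j < i prevents j from being the last index, so the
  -- claimed limit is zero too.
  have hzero : ∀ {i j i' j' : Fin d}, j < i →
      Tendsto (fun n : ℕ => ∑ k ∈ Finset.range n,
        jordanKernel d n k i j * jordanKernel d n k i' j') atTop
      (𝓝 (if j = lastIdx hd ∧ j' = lastIdx hd then critMatrix d (1 : ℝ) i i' else 0)) := by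
    intro i j i' j' hij
    rw [if_neg]
    · refine tendsto_const_nhds.congr fun n => ?_
      symm
      refine Finset.sum_eq_zero fun k _ => ?_
      rw [jordanKernel, Matrix.of_apply, if_neg (not_le.2 hij), zero_mul]
    · rintro ⟨h, -⟩
      have h1 : (j : ℕ) = d - 1 := by rw [h]; rfl
      have h2 := i.2
      have h3 : (j : ℕ) < i := hij
      lia
  rcases lt_or_ge j i with hij | hij
  · exact hzero hij
  rcases lt_or_ge j' i' with hij' | hij'
  · have := hzero (i' := i) (j' := j) hij'
    have e : (if j = lastIdx hd ∧ j' = lastIdx hd then critMatrix d (1 : ℝ) i i' else 0) =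
        if j' = lastIdx hd ∧ j = lastIdx hd then critMatrix d (1 : ℝ) i' i else 0 := by
      simp only [critMatrix_one_apply, and_comm, add_comm, mul_comm]
    rw [e]
    simpa only [mul_comm] using this
  set a := (j : ℕ) - (i : ℕ) with ha
  set b := (j' : ℕ) - (i' : ℕ) with hb
  set c : ℝ := (-1) ^ (a + b) / ((a.factorial : ℝ) * b.factorial)
  have hprod : ∀ᶠ n : ℕ in atTop, c * (Real.log n ^ (((j : ℕ) : ℝ) + (j' : ℕ) + 2 - 2 * d) *
      ((∑ k ∈ Finset.range n, Real.log (k + 1) ^ (a + b) / ((k : ℝ) + 1)) /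
        Real.log n ^ (a + b + 1))) =
      ∑ k ∈ Finset.range n, jordanKernel d n k i j * jordanKernel d n k i' j' := by
    filter_upwards [tendsto_log_natCast.eventually (eventually_gt_atTop 0)] with n hn
    have e1 : Real.log n ^ (((j : ℕ) : ℝ) + (j' : ℕ) + 2 - 2 * d) =
        Real.log n ^ (-((d : ℝ) - 1 / 2 - (i : ℕ))) * Real.log n ^ (-((d : ℝ) - 1 / 2 - (i' : ℕ))) *
          Real.log n ^ (a + b + 1) := by
      rw [← Real.rpow_natCast, ← Real.rpow_add hn, ← Real.rpow_add hn]
      congr 1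
      rw [ha, hb]
      push_cast
      rw [Nat.cast_sub (by exact_mod_cast hij), Nat.cast_sub (by exact_mod_cast hij')]
      ring
    rw [e1, mul_assoc _ (Real.log n ^ (a + b + 1)), mul_div_cancel₀ _ (by positivity),
      Finset.mul_sum, Finset.mul_sum]
    refine Finset.sum_congr rfl fun k _ => ?_
    have hk : (0 : ℝ) < (k : ℝ) + 1 := by positivity
    have e2 : 1 / ((k : ℝ) + 1) = ((k : ℝ) + 1) ^ (-(1 / 2 : ℝ)) * ((k : ℝ) + 1) ^ (-(1 / 2 : ℝ)) := by
      rw [← Real.rpow_add hk]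
      norm_num [Real.rpow_neg_one]
    rw [jordanKernel_apply_of_le n k hij, jordanKernel_apply_of_le n k hij', ← ha, ← hb,
      div_eq_mul_one_div _ ((k : ℝ) + 1), e2, neg_pow _ a, neg_pow _ b]
    simp only [c]
    rw [pow_add, pow_add]
    field_simp
  refine Tendsto.congr' hprod ?_
  have hS := tendsto_sum_log_pow_div (a + b)
  have hjd := j.2
  have hjd' := j'.2
  split_ifs with hlast
  · have h1 : (j : ℕ) = d - 1 := by rw [hlast.1]; rfl
    have h2 : (j' : ℕ) = d - 1 := by rw [hlast.2]; rfl
    have e0 : ((j : ℕ) : ℝ) + (j' : ℕ) + 2 - 2 * d = 0 := by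
      have : (j : ℕ) + j' + 2 = 2 * d := by lia
      have : ((j : ℕ) : ℝ) + (j' : ℕ) + 2 = 2 * d := by exact_mod_cast this
      linarith
    have e1 : critMatrix d (1 : ℝ) i i' = c * (1 * (1 / (((a + b : ℕ) : ℝ) + 1))) := by
      have ea : d - 1 - (i : ℕ) = a := by rw [ha, h1]
      have eb : d - 1 - (i' : ℕ) = b := by rw [hb, h2]
      rw [critMatrix_one_apply, one_mul, ea, eb]
    rw [e1, e0]
    simp only [Real.rpow_zero]
    exact (tendsto_const_nhds.mul hS).const_mul c
  · have hneg : 0 < -(((j : ℕ) : ℝ) + (j' : ℕ) + 2 - 2 * d) := by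
      have : (j : ℕ) + j' + 2 < 2 * d := by
        by_contra hcon
        exact hlast ⟨Fin.ext (by change (j : ℕ) = d - 1; lia), Fin.ext (by change (j' : ℕ) = d - 1; lia)⟩
      have : ((j : ℕ) : ℝ) + (j' : ℕ) + 2 < 2 * d := by exact_mod_cast this
      linarith
    have h1 : Tendsto (fun n : ℕ => Real.log n ^ (((j : ℕ) : ℝ) + (j' : ℕ) + 2 - 2 * d)) atTop
        (𝓝 0) := by
      have := (tendsto_rpow_neg_atTop hneg).comp tendsto_log_natCast
      simp only [neg_neg] at this
      exact this
    simpa using (h1.mul hS).const_mul c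

/-- A limit of Gram matrices, built from the last columns of the kernels. -/
lemma posSemidef_critMatrix_one (hd : 0 < d) : (critMatrix d (1 : ℝ)).PosSemidef := by
  refine Matrix.PosSemidef.of_dotProduct_mulVec_nonneg ?_ fun x => ?_
  · ext i j
    simp only [Matrix.conjTranspose_apply, star_trivial, critMatrix_one_apply, add_comm, mul_comm]
  · have h1 : Tendsto (fun n : ℕ => ∑ i, ∑ j, x i * x j * ∑ k ∈ Finset.range n,
        jordanKernel d n k i (lastIdx hd) * jordanKernel d n k j (lastIdx hd)) atTop
        (𝓝 (∑ i, ∑ j, x i * x j * critMatrix d (1 : ℝ) i j)) := by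
      refine tendsto_finsetSum _ fun i _ => tendsto_finsetSum _ fun j _ => ?_
      have := tendsto_sum_jordanKernel_mul hd i (lastIdx hd) j (lastIdx hd)
      simp only [and_self, if_true] at this
      exact this.const_mul _
    have h2 : star x ⬝ᵥ critMatrix d (1 : ℝ) *ᵥ x =
        ∑ i, ∑ j, x i * x j * critMatrix d (1 : ℝ) i j := by
      simp only [dotProduct, Matrix.mulVec, Finset.mul_sum, star_trivial]
      exact Finset.sum_congr rfl fun i _ => Finset.sum_congr rfl fun j _ => by ring
    rw [h2]
    refine ge_of_tendsto h1 (Eventually.of_forall fun n => ?_)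
    have h3 : ∑ i, ∑ j, x i * x j * ∑ k ∈ Finset.range n,
        jordanKernel d n k i (lastIdx hd) * jordanKernel d n k j (lastIdx hd) =
        ∑ k ∈ Finset.range n, (∑ i, x i * jordanKernel d n k i (lastIdx hd)) ^ 2 := by
      symm
      simp only [sq, Finset.sum_mul_sum]
      rw [Finset.sum_comm]
      refine Finset.sum_congr rfl fun i _ => ?_
      rw [Finset.sum_comm]
      refine Finset.sum_congr rfl fun j _ => ?_
      rw [Finset.mul_sum]
      exact Finset.sum_congr rfl fun k _ => by ring
    rw [h3]
    positivity

end JordanKernel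

/-! ### Exponentials of a Jordan block. -/

section JordanBlock

open scoped Matrix.Norms.L2Operator

variable {d : ℕ}

lemma superdiag_apply (i j : Fin d) : superdiag d i j = if (i : ℕ) + 1 = j then 1 else 0 := rfl

lemma superdiag_pow_apply (m : ℕ) (i j : Fin d) :
    (superdiag d ^ m) i j = if (i : ℕ) + m = j then 1 else 0 := by
  induction m generalizing j with
  | zero => simp [Matrix.one_apply, Fin.ext_iff]
  | succ m ih =>
    rw [pow_succ, Matrix.mul_apply]
    simp only [ih, superdiag_apply]
    by_cases h : (i : ℕ) + (m + 1) = j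
    · have hj := j.2
      rw [if_pos h, Finset.sum_eq_single (⟨i + m, by lia⟩ : Fin d)]
      · rw [if_pos rfl, if_pos (by change (i : ℕ) + m + 1 = j; lia), mul_one]
      · intro l _ hl
        rw [if_neg, zero_mul]
        exact fun h' => hl (Fin.ext h'.symm)
      · simp
    · rw [if_neg h]
      refine Finset.sum_eq_zero fun l _ => ?_
      by_cases h1 : (i : ℕ) + m = l
      · have h2 : ¬ (l : ℕ) + 1 = j := by lia
        rw [if_neg h2, mul_zero]
      · rw [if_neg h1, zero_mul]

/-- The shift is nilpotent with m-th power the m-th superdiagonal, so the exponential series is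
finite and at most one term reaches each entry. -/
lemma exp_smul_superdiag_apply (s : ℂ) (i j : Fin d) :
    NormedSpace.exp (s • superdiag d) i j =
      if i ≤ j then s ^ ((j : ℕ) - i) / ((j : ℕ) - (i : ℕ)).factorial else 0 := by
  have h0 : ∀ m ∉ Finset.range d, ((m.factorial : ℂ))⁻¹ • (s • superdiag d) ^ m = 0 := by
    intro m hm
    rw [Finset.mem_range, not_lt] at hm
    ext a b
    have := b.2
    rw [smul_pow, Matrix.smul_apply, Matrix.smul_apply, superdiag_pow_apply, if_neg (by lia)]
    simp
  rw [NormedSpace.exp_eq_tsum ℂ]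
  change (∑' m : ℕ, ((m.factorial : ℂ))⁻¹ • (s • superdiag d) ^ m) i j = _
  rw [tsum_eq_sum h0, Matrix.sum_apply]
  have e : ∀ m, (((m.factorial : ℂ))⁻¹ • (s • superdiag d) ^ m) i j =
      if (i : ℕ) + m = j then s ^ m / m.factorial else 0 := by
    intro m
    rw [smul_pow, Matrix.smul_apply, Matrix.smul_apply, superdiag_pow_apply]
    split_ifs
    · simp [div_eq_inv_mul]
    · simp
  simp only [e]
  have hj := j.2
  split_ifs with hij
  · have hij' : (i : ℕ) ≤ j := hij
    rw [Finset.sum_eq_single ((j : ℕ) - i), if_pos (by lia)]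
    · intro m _ hm
      rw [if_neg (by lia)]
    · intro hm
      exact absurd (Finset.mem_range.2 (by lia)) hm
  · have hij' : ¬ (i : ℕ) ≤ j := hij
    exact Finset.sum_eq_zero fun m _ => if_neg (by lia)

lemma exp_neg_log_smul_jordan_apply {s : ℝ} (i j : Fin d) :
    NormedSpace.exp (-s • ((1 / 2 : ℂ) • 1 + superdiag d)) i j =
      ((if i ≤ j then Real.exp (-s / 2) * ((-s) ^ ((j : ℕ) - i) /
        ((j : ℕ) - (i : ℕ)).factorial) else 0 : ℝ) : ℂ) := by
  let := NormedAlgebra.restrictScalars ℚ ℂ (Matrix (Fin d) (Fin d) ℂ)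
  have e1 : -s • ((1 / 2 : ℂ) • (1 : Matrix (Fin d) (Fin d) ℂ) + superdiag d) =
      algebraMap ℂ _ (-(s : ℂ) / 2) + (-(s : ℂ)) • superdiag d := by
    rw [smul_add, Algebra.algebraMap_eq_smul_one]
    congr 1
    · ext a b; simp; ring
    · ext a b; simp
  rw [e1, NormedSpace.exp_add_of_commute (Algebra.commutes _ _), ← NormedSpace.algebraMap_exp_comm,
    Algebra.algebraMap_eq_smul_one, smul_mul_assoc, one_mul, Matrix.smul_apply,
    exp_smul_superdiag_apply, ← Complex.exp_eq_exp_ℂ]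
  split_ifs
  · push_cast
    rfl
  · simp

lemma exists_norm_le_of_entries (d : ℕ) : ∃ c : ℝ, 0 ≤ c ∧
    ∀ (M : Matrix (Fin d) (Fin d) ℂ) (b : ℝ), (∀ i j, ‖M i j‖ ≤ b) → ‖M‖ ≤ b * c := by
  refine ⟨∑ i : Fin d, ∑ j : Fin d, ‖Matrix.single i j (1 : ℂ)‖,
    Finset.sum_nonneg fun i _ => Finset.sum_nonneg fun j _ => norm_nonneg _, fun M b hb => ?_⟩
  have e : M = ∑ i, ∑ j, M i j • Matrix.single i j (1 : ℂ) := by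
    simp only [Matrix.smul_single, smul_eq_mul, mul_one]
    exact Matrix.matrix_eq_sum_single M
  rw [e, Finset.mul_sum]
  refine norm_sum_le_of_le _ fun i _ => ?_
  rw [Finset.mul_sum]
  refine norm_sum_le_of_le _ fun j _ => ?_
  rw [norm_smul]
  gcongr
  exact hb i j

variable {A : Matrix (Fin d) (Fin d) ℝ} {Q : Matrix (Fin d) (Fin d) ℂ} {lam : ℂ}

/-- The eigenvalue of a real matrix consisting of one Jordan block is real. -/
lemma eq_half_of_conj_jordan (hd : 0 < d) (hlam : lam.re = 1 / 2) (hQ : IsUnit Q.det)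
    (hAQ : A.map Complex.ofReal = Q * (lam • 1 + superdiag d) * Q⁻¹) : lam = 1 / 2 := by
  -- Neither conjugation nor the nilpotent part affects the trace, so dλ is the real number tr A.
  have h1 : (A.map Complex.ofReal).trace = d * lam := by
    rw [hAQ, Matrix.trace_mul_comm, ← mul_assoc, Matrix.nonsing_inv_mul Q hQ, one_mul,
      Matrix.trace_add, Matrix.trace_smul, Matrix.trace_one]
    have : (superdiag d).trace = 0 := by
      rw [Matrix.trace]
      exact Finset.sum_eq_zero fun i _ => by simp [superdiag]
    rw [this, Fintype.card_fin, add_zero, smul_eq_mul, mul_comm]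
  have h2 : (A.map Complex.ofReal).trace = ((A.trace : ℝ) : ℂ) := by
    simp [Matrix.trace]
  have h3 : ((d : ℂ) * lam).im = 0 := by rw [← h1, h2, Complex.ofReal_im]
  have h4 : (d : ℝ) * lam.im = 0 := by simpa using h3
  have h5 : (d : ℝ) ≠ 0 := by exact_mod_cast hd.ne'
  refine Complex.ext (by simp [hlam]) ?_
  simpa using (mul_eq_zero.1 h4).resolve_left h5

lemma inv_logScale {𝕜 : Type*} [RCLike 𝕜] {R : Matrix (Fin d) (Fin d) 𝕜} (hR : IsUnit R.det)
    {n : ℕ} (hn : 0 < Real.log n) :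
    (logScale R n)⁻¹ = R * Matrix.diagonal (fun i : Fin d =>
      ((Real.log n ^ (-((d : ℝ) - 1 / 2 - (i : ℕ))) : ℝ) : 𝕜)) * R⁻¹ := by
  refine Matrix.inv_eq_right_inv ?_
  have e : ∀ D D' : Matrix (Fin d) (Fin d) 𝕜, R * D * R⁻¹ * (R * D' * R⁻¹) =
      R * (D * D') * R⁻¹ := by
    intro D D'
    rw [mul_assoc (R * D), ← mul_assoc R⁻¹, ← mul_assoc R⁻¹, Matrix.nonsing_inv_mul R hR, one_mul]
    simp only [mul_assoc]
  rw [logScale, e, Matrix.diagonal_mul_diagonal]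
  have : (fun i : Fin d => ((Real.log n ^ ((d : ℝ) - 1 / 2 - (i : ℕ)) : ℝ) : 𝕜) *
      ((Real.log n ^ (-((d : ℝ) - 1 / 2 - (i : ℕ))) : ℝ) : 𝕜)) = fun _ => 1 := by
    funext i
    rw [← RCLike.ofReal_mul, ← Real.rpow_add hn, add_neg_cancel, Real.rpow_zero, RCLike.ofReal_one]
  rw [this, Matrix.diagonal_one, mul_one, Matrix.mul_nonsing_inv R hR]

/-- In the basis Q the scale is diagonal and (k+1)^{-A} is the exponential of a Jordan block, namely
(k+1)^{-1/2} times a polynomial in log(k+1); `jordanKernel` is defined as their product. -/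
lemma inv_logScale_mul_flow (hQ : IsUnit Q.det)
    (hAQ : A.map Complex.ofReal = Q * ((1 / 2 : ℂ) • 1 + superdiag d) * Q⁻¹) {n : ℕ}
    (hn : 0 < Real.log n) (k : ℕ) :
    (logScale Q n)⁻¹ * (flow A (-Real.log ((k + 1 : ℕ) : ℝ))).map Complex.ofReal =
      Q * (jordanKernel d n k).map Complex.ofReal * Q⁻¹ := by
  have hQ' : IsUnit Q := (Matrix.isUnit_iff_isUnit_det Q).2 hQ
  set s : ℝ := Real.log ((k + 1 : ℕ) : ℝ) with hs
  have e1 : (flow A (-s)).map Complex.ofReal =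
      Q * NormedSpace.exp (-s • ((1 / 2 : ℂ) • 1 + superdiag d)) * Q⁻¹ := by
    rw [flow, map_ofReal_exp, map_ofReal_smul, hAQ, ← Matrix.exp_conj _ _ hQ', mul_smul_comm,
      smul_mul_assoc]
  rw [e1, inv_logScale hQ hn, mul_assoc (Q * _), ← mul_assoc Q⁻¹, ← mul_assoc Q⁻¹,
    Matrix.nonsing_inv_mul Q hQ, one_mul, mul_assoc Q, mul_assoc Q, ← mul_assoc (Matrix.diagonal _)]
  congr 2
  ext i j
  rw [Matrix.diagonal_mul, exp_neg_log_smul_jordan_apply, Matrix.map_apply, jordanKernel,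
    Matrix.of_apply]
  have hk : (0 : ℝ) < (k : ℝ) + 1 := by positivity
  have e2 : ((k : ℝ) + 1) ^ (-(1 / 2 : ℝ)) = Real.exp (-s / 2) := by
    rw [Real.rpow_def_of_pos hk, hs]
    push_cast
    congr 1
    ring
  rw [e2, show Real.log ((k : ℝ) + 1) = s by rw [hs]; push_cast; rfl]
  split_ifs
  · push_cast; rfl
  · simp

end JordanBlock

/-! ### Complex matrices acting on real vectors. -/

section Complexify

open scoped Matrix.Norms.L2Operator RealInnerProductSpace

variable {d : ℕ}

lemma norm_complexify (x : EuclideanSpace ℝ (Fin d)) : ‖complexify x‖ = ‖x‖ := by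
  simp [EuclideanSpace.norm_eq, complexify]

lemma act_apply {𝕜 : Type*} [RCLike 𝕜] (M : Matrix (Fin d) (Fin d) 𝕜)
    (x : EuclideanSpace 𝕜 (Fin d)) (i : Fin d) : act M x i = ∑ j, M i j * x j := rfl

lemma act_mul {𝕜 : Type*} [RCLike 𝕜] (M N : Matrix (Fin d) (Fin d) 𝕜)
    (x : EuclideanSpace 𝕜 (Fin d)) : act (M * N) x = act M (act N x) := by
  rw [act, map_mul]; rfl

lemma complexify_act (B : Matrix (Fin d) (Fin d) ℝ) (x : EuclideanSpace ℝ (Fin d)) :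
    complexify (act B x) = act (B.map Complex.ofReal) (complexify x) := by
  ext i
  simp [act_apply, complexify]

/-- The real-linear map `x ↦ M x` from real to complex vectors. -/
def complexOp (M : Matrix (Fin d) (Fin d) ℂ) :
    EuclideanSpace ℝ (Fin d) →L[ℝ] EuclideanSpace ℂ (Fin d) :=
  LinearMap.mkContinuous
    { toFun := fun x => act M (complexify x)
      map_add' := fun x y => by
        ext i; simp [act_apply, complexify, mul_add, Finset.sum_add_distrib]
      map_smul' := fun c x => by
        ext i
        simp only [act_apply, complexify, PiLp.smul_apply, smul_eq_mul, Complex.ofReal_mul,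
          RingHom.id_apply, Complex.real_smul, Finset.mul_sum]
        exact Finset.sum_congr rfl fun j _ => by ring } ‖M‖
    fun x => by
      rw [← norm_complexify x]
      exact (Matrix.toEuclideanCLM (𝕜 := ℂ) M).le_opNorm _

lemma complexOp_apply (M : Matrix (Fin d) (Fin d) ℂ) (x : EuclideanSpace ℝ (Fin d)) :
    complexOp M x = act M (complexify x) := rfl

lemma norm_complexOp_le (M : Matrix (Fin d) (Fin d) ℂ) : ‖complexOp M‖ ≤ ‖M‖ :=
  LinearMap.mkContinuous_norm_le _ (norm_nonneg _) _

lemma real_inner_eq (w z : EuclideanSpace ℂ (Fin d)) : ⟪w, z⟫ = (∑ i, star (w i) * z i).re := by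
  rw [PiLp.inner_apply, Complex.re_sum]
  refine Finset.sum_congr rfl fun i _ => ?_
  rw [Complex.inner, mul_comm]
  rfl

/-- The real vector representing `x ↦ Re (c * (b · x))`. -/
def reVec (c : ℂ) (b : Fin d → ℂ) : EuclideanSpace ℝ (Fin d) :=
  WithLp.toLp 2 fun l => (c * b l).re

/-- With u = w* Q, the functional x ↦ Re(w* Q C S x) equals ∑ C i j Re(u i (S j · x)): real entries
come out of the real part. The kernel thus enters linearly, with vectors that depend neither on n
nor on k. -/
lemma adjoint_complexOp_conj (Q S : Matrix (Fin d) (Fin d) ℂ) (C : Matrix (Fin d) (Fin d) ℝ)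
    (w : EuclideanSpace ℂ (Fin d)) :
    (complexOp (Q * C.map Complex.ofReal * S)).adjoint w =
      ∑ i, ∑ j, C i j • reVec (∑ a, star (w a) * Q a i) (S j) := by
  refine ext_inner_right ℝ fun e => ?_
  rw [ContinuousLinearMap.adjoint_inner_left, real_inner_eq, sum_inner]
  simp only [sum_inner, real_inner_smul_left, complexOp_apply, act_mul, act_apply]
  have e1 : ∀ i j, ⟪reVec (∑ a, star (w a) * Q a i) (S j), e⟫ =
      ((∑ a, star (w a) * Q a i) * ∑ l, S j l * (e l : ℂ)).re := by
    intro i j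
    rw [PiLp.inner_apply, Finset.mul_sum, Complex.re_sum]
    refine Finset.sum_congr rfl fun l _ => ?_
    rw [← mul_assoc, Complex.re_mul_ofReal]
    simp [reVec, mul_comm]
  simp only [e1, ← Complex.re_ofReal_mul, ← Complex.re_sum]
  congr 1
  simp only [Finset.mul_sum, Finset.sum_mul, Matrix.map_apply, complexify]
  rw [Finset.sum_comm]
  refine Finset.sum_congr rfl fun i _ => ?_
  rw [Finset.sum_comm]
  refine Finset.sum_congr rfl fun j _ => ?_
  rw [Finset.sum_comm]
  refine Finset.sum_congr rfl fun l _ => Finset.sum_congr rfl fun a _ => ?_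
  ring

end Complexify

/-! ### Replacing the propagators by exact powers. -/

section Remainder

open scoped RealInnerProductSpace Matrix.Norms.L2Operator

variable {Ω : Type*} [mΩ : MeasurableSpace Ω] {d : ℕ} {X : ℕ → Ω → EuclideanSpace ℝ (Fin d)}
  {P : Measure Ω} [IsProbabilityMeasure P] {A Sig : Matrix (Fin d) (Fin d) ℝ}

lemma flow_neg_log_succ_mul (A : Matrix (Fin d) (Fin d) ℝ) (n : ℕ) :
    flow A (-Real.log ((n + 1 : ℕ) : ℝ)) * (1 + (1 / (n : ℝ)) • A) =
      (1 + stepError A n) * flow A (-Real.log n) := by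
  have hc : Commute (1 + (1 / (n : ℝ)) • A) (flow A (-Real.log n)) :=
    (Commute.one_left _).add_left ((commute_flow A _ (Commute.refl A)).symm.smul_left _)
  rw [stepError, add_sub_cancel, mul_assoc, hc.eq, ← mul_assoc, ← flow_add]
  congr 2
  ring

/-- The rescaled walk `n^{-A} S_n` is a sum of rescaled noise, up to a perturbation series. -/
lemma flow_neg_log_walk_eq (X : ℕ → Ω → EuclideanSpace ℝ (Fin d)) (A : Matrix (Fin d) (Fin d) ℝ)
    (n : ℕ) (ω : Ω) :
    opOf (flow A (-Real.log n)) (walk X n ω) =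
      ∑ k ∈ Finset.range n, opOf (flow A (-Real.log ((k + 1 : ℕ) : ℝ))) (noise X A k ω) +
      ∑ k ∈ Finset.range n, opOf (stepError A k) (opOf (flow A (-Real.log k)) (walk X k ω)) := by
  induction n with
  | zero => simp [walk]
  | succ n ih =>
    have e : walk X (n + 1) ω = opOf (1 + (1 / (n : ℝ)) • A) (walk X n ω) + noise X A n ω := by
      rw [walk_succ, noise]
      simp only [opOf, map_add, map_one, map_smul, _root_.add_apply, one_apply_eq_self,
        _root_.smul_apply]
      abel
    rw [Finset.sum_range_succ, Finset.sum_range_succ, e, map_add, ← opOf_mul_apply,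
      flow_neg_log_succ_mul, opOf_mul_apply]
    have e2 : ∀ x, opOf (1 + stepError A n) x = x + opOf (stepError A n) x := by
      intro x
      simp only [opOf, map_add, map_one, _root_.add_apply, one_apply_eq_self]
    rw [e2]
    nth_rewrite 1 [ih]
    abel

/-- The series in `flow_neg_log_walk_eq` is summable in L²: `stepError` is O(1/k²), k^{-A} is
bounded as λ_min > 0, and S k is O(k^α) in L² with α < 1. The gain over `transition` is that the
coefficients (k+1)^{-A} are explicit. -/
theorem IsLinearRWSD.exists_eLpNorm_remainder_le (hX : IsLinearRWSD P X A Sig) (hd : 0 < d) :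
    ∃ C : ℝ, ∀ n : ℕ, eLpNorm (fun ω => opOf (flow A (-Real.log n)) (walk X n ω) -
      ∑ k ∈ Finset.range n, opOf (flow A (-Real.log ((k + 1 : ℕ) : ℝ))) (noise X A k ω)) 2 P ≤
        ENNReal.ofReal C := by
  obtain ⟨α, hα1, hα2⟩ := exists_between (max_lt hX.lambdaMax_lt_one (by norm_num : (1 / 2 : ℝ) < 1))
  rw [max_lt_iff] at hα1
  have hA := isUnit_one_add_smul hX.lambdaMin_pos
  obtain ⟨K, hK⟩ := exists_norm_flow_le hd hα1.1
  obtain ⟨K', hK'⟩ := exists_norm_flow_neg_le hd hX.lambdaMin_pos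
  have hK'0 : 0 ≤ K' := by simpa using (norm_nonneg _).trans (hK' 0 le_rfl)
  obtain ⟨p, M, hD⟩ := hX.isMartingaleDiff
  obtain ⟨C₀, hC₀, hwalk⟩ := hD.exists_integral_norm_sq_walk_le hA hK hα1.2
  obtain ⟨C₁, hC₁⟩ := bound_of_isBigO_inv_sq (stepError_isBigO A)
  have hC₁0 : 0 ≤ C₁ := by simpa using (norm_nonneg _).trans (hC₁ 1 le_rfl)
  have hw2 : ∀ n, MemLp (walk X n) 2 P := by
    intro n
    have := hD.memLp_sum (fun k => opOf (transition A n (k + 1))) (Finset.range n)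
    simpa only [← walk_eq_sum hA] using this
  have hsum : Summable fun k : ℕ => 1 / (k : ℝ) ^ (2 - α) :=
    Real.summable_one_div_nat_rpow.2 (by linarith)
  set c : ℝ := C₁ * K' * √C₀
  refine ⟨c * ∑' k : ℕ, 1 / (k : ℝ) ^ (2 - α), fun n => ?_⟩
  simp only [flow_neg_log_walk_eq X A n, add_sub_cancel_left]
  have hterm : ∀ k : ℕ, eLpNorm (fun ω => opOf (stepError A k)
      (opOf (flow A (-Real.log k)) (walk X k ω))) 2 P ≤
      ENNReal.ofReal (c * (1 / (k : ℝ) ^ (2 - α))) := by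
    intro k
    rcases Nat.eq_zero_or_pos k with rfl | hk
    · simp [walk]
    have hk0 : (0 : ℝ) < k := by exact_mod_cast hk
    refine (eLpNorm_opOf_le (stepError A k) _ 2 (hC₁ k hk)).trans ?_
    have hf : ‖flow A (-Real.log k)‖ ≤ K' := by
      simpa using hK' (Real.log k) (Real.log_natCast_nonneg k)
    refine (mul_le_mul_right (eLpNorm_opOf_le _ (walk X k) 2 hf) _).trans ?_
    have h2 : eLpNorm (walk X k) 2 P ≤ ENNReal.ofReal (√C₀ * (k : ℝ) ^ α) := by
      rw [eLpNorm_two_eq (hw2 k)]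
      refine ENNReal.ofReal_le_ofReal ((Real.sqrt_le_sqrt (hwalk k)).trans (le_of_eq ?_))
      rw [Real.sqrt_mul hC₀, mul_comm 2 α, Real.rpow_mul hk0.le, Real.rpow_two,
        Real.sqrt_sq (by positivity)]
    refine (mul_le_mul_right (mul_le_mul_right h2 _) _).trans ?_
    rw [← ENNReal.ofReal_mul hK'0, ← ENNReal.ofReal_mul (by positivity)]
    refine ENNReal.ofReal_le_ofReal (le_of_eq ?_)
    rw [Real.rpow_sub hk0, Real.rpow_two]
    have : (k : ℝ) ^ α ≠ 0 := by positivity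
    simp only [c]
    field_simp
  have e : (fun ω => ∑ k ∈ Finset.range n, opOf (stepError A k)
      (opOf (flow A (-Real.log k)) (walk X k ω))) = ∑ k ∈ Finset.range n, fun ω =>
        opOf (stepError A k) (opOf (flow A (-Real.log k)) (walk X k ω)) := by
    funext ω; simp
  rw [e]
  refine (eLpNorm_sum_le (fun k _ => ((opOf _).comp_memLp' ((opOf _).comp_memLp' (hw2 k))).1)
    one_le_two).trans ?_
  refine (Finset.sum_le_sum fun k _ => hterm k).trans ?_
  rw [← ENNReal.ofReal_sum_of_nonneg fun k _ => by positivity]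
  refine ENNReal.ofReal_le_ofReal ?_
  rw [← Finset.mul_sum]
  gcongr
  exact hsum.sum_le_tsum _ fun k _ => by positivity

end Remainder

/-! ### The critical limit theorem. -/

section CriticalLimit

open scoped RealInnerProductSpace Matrix.Norms.L2Operator

variable {Ω : Type*} [mΩ : MeasurableSpace Ω] {d : ℕ} {X : ℕ → Ω → EuclideanSpace ℝ (Fin d)}
  {P : Measure Ω} [IsProbabilityMeasure P] {A Sig : Matrix (Fin d) (Fin d) ℝ}
  {Q : Matrix (Fin d) (Fin d) ℂ}

/-- The variance of `Re (w* Z)` for the limit `Z` in the critical case, where `b` is the last row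
of `Q⁻¹`. -/
def critVar (Sig : Matrix (Fin d) (Fin d) ℝ) (Q : Matrix (Fin d) (Fin d) ℂ) (b : Fin d → ℂ)
    (w : EuclideanSpace ℂ (Fin d)) : ℝ :=
  ∑ i, ∑ i', critMatrix d (1 : ℝ) i i' *
    ⟪reVec (∑ a, star (w a) * Q a i) b, opOf Sig (reVec (∑ a, star (w a) * Q a i') b)⟫

/-- The form expands into finitely many terms whose coefficients are sums over k of products of two
kernel entries, each with the limit given by `tendsto_sum_jordanKernel_mul`. -/
lemma tendsto_sum_quadForm_adjoint (hd : 0 < d) (Sig : Matrix (Fin d) (Fin d) ℝ)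
    (Q S : Matrix (Fin d) (Fin d) ℂ) (w : EuclideanSpace ℂ (Fin d)) :
    Tendsto (fun n => ∑ k ∈ Finset.range n, quadForm Sig
      ((complexOp (Q * (jordanKernel d n k).map Complex.ofReal * S)).adjoint w)) atTop
      (𝓝 (critVar Sig Q (S (lastIdx hd)) w)) := by
  set h : Fin d → Fin d → EuclideanSpace ℝ (Fin d) :=
    fun i j => reVec (∑ a, star (w a) * Q a i) (S j) with hh
  have e1 : ∀ n, ∑ k ∈ Finset.range n, quadForm Sig
      ((complexOp (Q * (jordanKernel d n k).map Complex.ofReal * S)).adjoint w) =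
      ∑ i, ∑ j, ∑ i', ∑ j', (∑ k ∈ Finset.range n, jordanKernel d n k i j *
        jordanKernel d n k i' j') * ⟪h i j, opOf Sig (h i' j')⟫ := by
    intro n
    have e2 : ∀ k, quadForm Sig
        ((complexOp (Q * (jordanKernel d n k).map Complex.ofReal * S)).adjoint w) =
        ∑ i, ∑ j, ∑ i', ∑ j', jordanKernel d n k i j *
          jordanKernel d n k i' j' * ⟪h i j, opOf Sig (h i' j')⟫ := by
      intro k
      rw [adjoint_complexOp_conj, quadForm]
      simp only [sum_inner, real_inner_smul_left]
      simp only [inner_sum, map_sum, map_smul, real_inner_smul_right, Finset.mul_sum]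
      exact Finset.sum_congr rfl fun i _ => Finset.sum_congr rfl fun j _ =>
        Finset.sum_congr rfl fun i' _ => Finset.sum_congr rfl fun j' _ => by rw [hh]; ring
    simp only [e2, Finset.sum_mul]
    rw [Finset.sum_comm]
    refine Finset.sum_congr rfl fun i _ => ?_
    rw [Finset.sum_comm]
    refine Finset.sum_congr rfl fun j _ => ?_
    rw [Finset.sum_comm]
    refine Finset.sum_congr rfl fun i' _ => ?_
    rw [Finset.sum_comm]
  have e3 : critVar Sig Q (S (lastIdx hd)) w = ∑ i, ∑ j, ∑ i', ∑ j',
      (if j = lastIdx hd ∧ j' = lastIdx hd then critMatrix d (1 : ℝ) i i' else 0) *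
        ⟪h i j, opOf Sig (h i' j')⟫ := by
    rw [critVar]
    refine Finset.sum_congr rfl fun i _ => ?_
    symm
    rw [Finset.sum_eq_single (lastIdx hd)]
    · refine Finset.sum_congr rfl fun i' _ => ?_
      rw [Finset.sum_eq_single (lastIdx hd)]
      · rw [if_pos ⟨rfl, rfl⟩]
      · intro j' _ hj'
        rw [if_neg fun hc => hj' hc.2, zero_mul]
      · simp
    · intro j _ hj
      exact Finset.sum_eq_zero fun i' _ => Finset.sum_eq_zero fun j' _ => by
        rw [if_neg fun hc => hj hc.1, zero_mul]
    · simp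
  simp only [e1]
  rw [e3]
  exact tendsto_finsetSum _ fun i _ => tendsto_finsetSum _ fun j _ => tendsto_finsetSum _ fun i' _ =>
    tendsto_finsetSum _ fun j' _ => (tendsto_sum_jordanKernel_mul hd i j i' j').mul_const _

lemma tendsto_log_rpow_neg_half : Tendsto (fun n : ℕ => Real.log n ^ (-(1 / 2 : ℝ))) atTop (𝓝 0) :=
  (tendsto_rpow_neg_atTop (by norm_num : (0 : ℝ) < 1 / 2)).comp tendsto_log_natCast

lemma continuous_complexify : Continuous (complexify (d := d)) := by
  have : complexify (d := d) = complexOp 1 := by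
    funext x
    rw [complexOp_apply, act, map_one]; rfl
  rw [this]
  exact (complexOp 1).continuous

/-- The smallest exponent on the diagonal of the scale is 1/2. -/
lemma exists_norm_inv_logScale_le (hQ : IsUnit Q.det) : ∃ C, 0 ≤ C ∧ ∀ᶠ n : ℕ in atTop,
    ‖(logScale Q n)⁻¹‖ ≤ C * Real.log n ^ (-(1 / 2 : ℝ)) := by
  refine ⟨‖Q‖ * ‖Q⁻¹‖, by positivity, ?_⟩
  filter_upwards [tendsto_log_natCast.eventually (eventually_ge_atTop 1)] with n hn
  have hl0 : 0 < Real.log n := by linarith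
  rw [inv_logScale hQ hl0]
  refine (norm_mul_le _ _).trans ?_
  rw [mul_right_comm]
  gcongr
  refine (norm_mul_le _ _).trans ?_
  gcongr
  rw [Matrix.l2_opNorm_diagonal, pi_norm_le_iff_of_nonneg (by positivity)]
  intro i
  rw [RCLike.norm_ofReal, abs_of_nonneg (by positivity)]
  refine Real.rpow_le_rpow_of_exponent_le hn ?_
  have : ((i : ℕ) : ℝ) + 1 ≤ d := by exact_mod_cast i.2
  linarith

/-- The inverse scale, of order (log n)^{-1/2}, kills the L²-bounded difference between n^{-A} S n
and ∑ (k+1)^{-A} e k; the rescaled sum is an array with coefficients Q J Q⁻¹, J the kernel. -/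
theorem IsLinearRWSD.critical_convergesInLaw (hX : IsLinearRWSD P X A Sig) (hd : 0 < d)
    (hQ : IsUnit Q.det)
    (hAQ : A.map Complex.ofReal = Q * ((1 / 2 : ℂ) • 1 + superdiag d) * Q⁻¹)
    (ν : Measure (EuclideanSpace ℂ (Fin d))) [IsProbabilityMeasure ν]
    (hν : ∀ w, charFun ν w = (Real.exp (-critVar Sig Q (Q⁻¹ (lastIdx hd)) w / 2) : ℂ)) :
    ConvergesInLaw P (fun n ω => act ((logScale Q n)⁻¹ * (matPow n (-A)).map Complex.ofReal)
      (complexify (walk X n ω))) ν := by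
  obtain ⟨p, M, δ, hN⟩ := hX.exists_isMartingaleNoise hd
  obtain ⟨C, hC⟩ := hX.exists_eLpNorm_remainder_le hd
  obtain ⟨C', hC'0, hC'⟩ := exists_norm_inv_logScale_le hQ
  obtain ⟨c, hc, hcb⟩ := exists_norm_le_of_entries d
  refine hN.convergesInLaw (m := id)
    (B := fun n k => complexOp (Q * (jordanKernel d n k).map Complex.ofReal * Q⁻¹))
    (β := fun n => ‖Q‖ * ‖Q⁻¹‖ * c * Real.log n ^ (-(1 / 2 : ℝ))) (fun n => ?_) ?_ ?_ ?_ ν fun t => ?_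
  · exact (((Matrix.toEuclideanCLM (𝕜 := ℂ) _).continuous.comp
      continuous_complexify).measurable.comp (hX.measurable_walk n)).aemeasurable
  · simpa using tendsto_log_rpow_neg_half.const_mul (‖Q‖ * ‖Q⁻¹‖ * c)
  · filter_upwards [tendsto_log_natCast.eventually (eventually_ge_atTop 1)] with n hn k hk
    refine (norm_complexOp_le _).trans ((norm_mul_le _ _).trans ?_)
    calc _ ≤ ‖Q‖ * (Real.log n ^ (-(1 / 2 : ℝ)) * c) * ‖Q⁻¹‖ := by
          gcongr
          refine (norm_mul_le _ _).trans ?_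
          gcongr
          refine hcb _ _ fun i j => ?_
          rw [Matrix.map_apply, Complex.norm_real]
          exact abs_jordanKernel_le hk hn i j
      _ = _ := by ring
  · have hlim : Tendsto (fun n : ℕ => ENNReal.ofReal (C' * Real.log n ^ (-(1 / 2 : ℝ))) *
        ENNReal.ofReal C) atTop (𝓝 0) := by
      have h1 := ENNReal.tendsto_ofReal (tendsto_log_rpow_neg_half.const_mul C')
      have h2 := ENNReal.Tendsto.mul_const (b := ENNReal.ofReal C) h1 (Or.inr ENNReal.ofReal_ne_top)
      simpa using h2
    refine tendsto_of_tendsto_of_tendsto_of_le_of_le' tendsto_const_nhds hlim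
      (Eventually.of_forall fun n => zero_le) ?_
    filter_upwards [tendsto_log_natCast.eventually (eventually_gt_atTop 0), hC'] with n hn hn'
    set rem : Ω → EuclideanSpace ℝ (Fin d) := fun ω =>
      opOf (flow A (-Real.log n)) (walk X n ω) -
        ∑ k ∈ Finset.range n, opOf (flow A (-Real.log ((k + 1 : ℕ) : ℝ))) (noise X A k ω)
    have e : ∀ ω, act ((logScale Q n)⁻¹ * (matPow n (-A)).map Complex.ofReal)
        (complexify (walk X n ω)) - ∑ k ∈ Finset.range (id n),
          complexOp (Q * (jordanKernel d n k).map Complex.ofReal * Q⁻¹) (noise X A k ω) =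
        complexOp (logScale Q n)⁻¹ (rem ω) := by
      intro ω
      simp only [rem, map_sub, map_sum, id]
      have e1 : ∀ (B : Matrix (Fin d) (Fin d) ℝ) (x : EuclideanSpace ℝ (Fin d)),
          complexOp (logScale Q n)⁻¹ (opOf B x) =
            complexOp ((logScale Q n)⁻¹ * B.map Complex.ofReal) x := by
        intro B x
        rw [complexOp_apply, complexOp_apply, ← act_eq, complexify_act, act_mul]
      simp only [e1, inv_logScale_mul_flow hQ hAQ hn]
      rw [matPow_neg_eq_flow]
      rfl
    simp only [e]
    have hrem : AEStronglyMeasurable (fun ω => complexOp (logScale Q n)⁻¹ (rem ω)) P := by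
      refine (complexOp _).continuous.comp_aestronglyMeasurable ?_
      exact ((opOf _).continuous.measurable.comp (hX.measurable_walk n)).aestronglyMeasurable.sub
        (hN.memLp_sum (fun k => opOf (flow A (-Real.log ((k + 1 : ℕ) : ℝ)))) _).1
    refine (eLpNorm_le_eLpNorm_of_exponent_le one_le_two hrem).trans ?_
    refine (eLpNorm_le_mul_eLpNorm_of_ae_le_mul (g := rem) (Eventually.of_forall fun ω =>
      ((complexOp (logScale Q n)⁻¹).le_opNorm (rem ω)).trans
        (mul_le_mul_of_nonneg_right ((norm_complexOp_le _).trans hn') (norm_nonneg _))) 2).trans ?_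
    exact mul_le_mul_right (hC n) _
  · exact ⟨_, hν t, tendsto_sum_quadForm_adjoint hd Sig Q Q⁻¹ t⟩

end CriticalLimit

/-! ### Construction and identification of the limiting complex Gaussian law. -/

section ComplexGaussian

open scoped RealInnerProductSpace

variable {d : ℕ} {Sig : Matrix (Fin d) (Fin d) ℝ}

/-- The linear map sending a Gaussian family `g i`, `i < d`, of real vectors to the complex vector
`Q (b · g 0, …, b · g (d - 1))`. -/
def gaussianImage (Q : Matrix (Fin d) (Fin d) ℂ) (b : Fin d → ℂ) :
    EuclideanSpace ℝ (Fin d × Fin d) →ₗ[ℝ] EuclideanSpace ℂ (Fin d) where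
  toFun g := WithLp.toLp 2 fun a => ∑ i, Q a i * ∑ l, b l * (g (i, l) : ℂ)
  map_add' g g' := by
    ext a
    simp [mul_add, Finset.sum_add_distrib]
  map_smul' c g := by
    ext a
    simp only [PiLp.smul_apply, smul_eq_mul, Complex.ofReal_mul, RingHom.id_apply,
      Complex.real_smul, Finset.mul_sum]
    exact Finset.sum_congr rfl fun i _ => Finset.sum_congr rfl fun l _ => by ring

lemma inner_gaussianImage (Q : Matrix (Fin d) (Fin d) ℂ) (b : Fin d → ℂ)
    (g : EuclideanSpace ℝ (Fin d × Fin d)) (w : EuclideanSpace ℂ (Fin d)) :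
    ⟪gaussianImage Q b g, w⟫ = ⟪g, WithLp.toLp 2 fun p : Fin d × Fin d =>
      reVec (∑ a, star (w a) * Q a p.1) b p.2⟫ := by
  rw [real_inner_comm, real_inner_eq, PiLp.inner_apply, Fintype.sum_prod_type]
  have e : ∀ i l, inner ℝ (g (i, l)) (reVec (∑ a, star (w a) * Q a i) b l) =
      ((∑ a, star (w a) * Q a i) * b l * (g (i, l) : ℂ)).re := by
    intro i l
    rw [Complex.re_mul_ofReal]
    rfl
  simp only [e, ← Complex.re_sum]
  congr 1
  simp only [gaussianImage, LinearMap.coe_mk, AddHom.coe_mk, Finset.mul_sum, Finset.sum_mul]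
  rw [Finset.sum_comm]
  refine Finset.sum_congr rfl fun i _ => ?_
  rw [Finset.sum_comm]
  exact Finset.sum_congr rfl fun l _ => Finset.sum_congr rfl fun a _ => by ring

/-- The Kronecker product is the covariance of real vectors g i with E[g i (g i')ᵀ] = V i i' Σ,
where V is `critMatrix d 1`. This form yields both the sign of the variance and the existence of the
law. -/
lemma critVar_eq_dotProduct (Q : Matrix (Fin d) (Fin d) ℂ) (b : Fin d → ℂ)
    (w : EuclideanSpace ℂ (Fin d)) :
    critVar Sig Q b w = (fun p : Fin d × Fin d => reVec (∑ a, star (w a) * Q a p.1) b p.2) ⬝ᵥ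
      (Matrix.kroneckerMap (fun x y => x * y) (critMatrix d (1 : ℝ)) Sig) *ᵥ
        fun p : Fin d × Fin d => reVec (∑ a, star (w a) * Q a p.1) b p.2 := by
  simp only [critVar, dotProduct, Matrix.mulVec, Fintype.sum_prod_type, Matrix.kroneckerMap_apply,
    Finset.mul_sum]
  refine Finset.sum_congr rfl fun i _ => ?_
  rw [Finset.sum_comm]
  refine Finset.sum_congr rfl fun i' _ => ?_
  rw [Matrix.inner_toEuclideanCLM]
  simp only [dotProduct, Matrix.mulVec, Finset.mul_sum]
  exact Finset.sum_congr rfl fun l _ => Finset.sum_congr rfl fun m _ => by ring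

lemma critVar_nonneg (hd : 0 < d) (hS : Sig.PosSemidef) (Q : Matrix (Fin d) (Fin d) ℂ)
    (b : Fin d → ℂ) (w : EuclideanSpace ℂ (Fin d)) : 0 ≤ critVar Sig Q b w := by
  rw [critVar_eq_dotProduct]
  have := ((posSemidef_critMatrix_one hd).kronecker hS).dotProduct_mulVec_nonneg
    fun p : Fin d × Fin d => reVec (∑ a, star (w a) * Q a p.1) b p.2
  simpa using this

lemma critVar_smul (Q : Matrix (Fin d) (Fin d) ℂ) (b : Fin d → ℂ) (t : ℝ)
    (w : EuclideanSpace ℂ (Fin d)) : critVar Sig Q b (t • w) = t ^ 2 * critVar Sig Q b w := by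
  have e : ∀ i, reVec (∑ a, star ((t • w) a) * Q a i) b =
      t • reVec (∑ a, star (w a) * Q a i) b := by
    intro i
    ext l
    have : ∑ a, star ((t • w) a) * Q a i = (t : ℂ) * ∑ a, star (w a) * Q a i := by
      rw [Finset.mul_sum]
      refine Finset.sum_congr rfl fun a _ => ?_
      simp [mul_assoc]
    rw [this]
    simp [reVec, mul_assoc]
  simp only [critVar, e, map_smul, real_inner_smul_left, real_inner_smul_right, Finset.mul_sum]
  exact Finset.sum_congr rfl fun i _ => Finset.sum_congr rfl fun j _ => by ring

/-- The law is that of Q (b · g i)_i for the real Gaussian family with Kronecker covariance,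
positive semidefinite because both factors are. -/
theorem exists_charFun_eq_exp_critVar (hd : 0 < d) (hS : Sig.PosSemidef)
    (Q : Matrix (Fin d) (Fin d) ℂ) (b : Fin d → ℂ) :
    ∃ (ν : Measure (EuclideanSpace ℂ (Fin d))) (_ : IsProbabilityMeasure ν),
      ∀ w, charFun ν w = (Real.exp (-critVar Sig Q b w / 2) : ℂ) := by
  have hK := (posSemidef_critMatrix_one hd).kronecker hS
  set μ := multivariateGaussian 0
    (Matrix.kroneckerMap (fun x y => x * y) (critMatrix d (1 : ℝ)) Sig)
  have hm : Measurable (gaussianImage Q b) :=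
    (LinearMap.continuous_of_finiteDimensional _).measurable
  refine ⟨μ.map (gaussianImage Q b), Measure.isProbabilityMeasure_map hm.aemeasurable, fun w => ?_⟩
  have h1 : charFun (μ.map (gaussianImage Q b)) w = charFun μ (WithLp.toLp 2
      fun p : Fin d × Fin d => reVec (∑ a, star (w a) * Q a p.1) b p.2) := by
    rw [charFun_apply, charFun_apply, integral_map hm.aemeasurable (by fun_prop)]
    simp only [inner_gaussianImage]
  rw [h1, charFun_multivariateGaussian hK, critVar_eq_dotProduct, inner_zero_right]
  push_cast
  rw [zero_mul, zero_sub, neg_div]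

lemma charFun_map_inner {F : Type*} [NormedAddCommGroup F] [InnerProductSpace ℝ F]
    [MeasurableSpace F] [BorelSpace F] (ν : Measure F) (w : F) (t : ℝ) :
    charFun (ν.map fun z => ⟪w, z⟫) t = charFun ν (t • w) := by
  have hm : AEMeasurable (fun z => ⟪w, z⟫) ν :=
    (continuous_const.inner continuous_id).measurable.aemeasurable
  rw [charFun_apply, charFun_apply, integral_map hm (by fun_prop)]
  refine integral_congr_ae (Eventually.of_forall fun z => ?_)
  simp only [inner_smul_right, real_inner_comm z w]
  simp

/-- Each real projection is identified by its one-dimensional characteristic function t ↦ exp(-v(t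
w)/2) with v(t w) = t² v(w). -/
lemma isComplexGaussian_of_charFun {ν : Measure (EuclideanSpace ℂ (Fin d))}
    [IsProbabilityMeasure ν] {Γ C : Matrix (Fin d) (Fin d) ℂ} {v : EuclideanSpace ℂ (Fin d) → ℝ}
    (hν : ∀ w, charFun ν w = (Real.exp (-v w / 2) : ℂ)) (hv : ∀ w, 0 ≤ v w)
    (hsmul : ∀ (t : ℝ) w, v (t • w) = t ^ 2 * v w)
    (hΓ : ∀ w : Fin d → ℂ, v (WithLp.toLp 2 w) =
      ((star w ⬝ᵥ Γ *ᵥ w).re + (star w ⬝ᵥ C *ᵥ star w).re) / 2) :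
    IsComplexGaussian ν Γ C := by
  intro w
  set w' : EuclideanSpace ℂ (Fin d) := WithLp.toLp 2 w
  obtain ⟨r, hr⟩ : ∃ r : NNReal, (r : ℝ) = v w' := ⟨⟨v w', hv w'⟩, rfl⟩
  refine ⟨r, hr.trans (hΓ w), ?_⟩
  have hfun : (fun z : EuclideanSpace ℂ (Fin d) => (∑ i, star (w i) * z i).re) =
      fun z => ⟪w', z⟫ := by
    funext z; rw [real_inner_eq]
  rw [hfun]
  refine Measure.ext_of_charFun ?_
  funext t
  rw [charFun_map_inner, hν, hsmul, charFun_gaussianReal, ← hr]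
  push_cast
  congr 1
  simp
  ring

lemma IsComplexGaussian.charFun_eq {ν : Measure (EuclideanSpace ℂ (Fin d))}
    {Γ C : Matrix (Fin d) (Fin d) ℂ} (h : IsComplexGaussian ν Γ C) (w : Fin d → ℂ) :
    charFun ν (WithLp.toLp 2 w) = (Real.exp (-(((star w ⬝ᵥ Γ *ᵥ w).re +
      (star w ⬝ᵥ C *ᵥ star w).re) / 2) / 2) : ℂ) := by
  obtain ⟨v, hv, hmap⟩ := h w
  have hfun : (fun z : EuclideanSpace ℂ (Fin d) => (∑ i, star (w i) * z i).re) =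
      fun z => ⟪(WithLp.toLp 2 w : EuclideanSpace ℂ (Fin d)), z⟫ := by
    funext z; rw [real_inner_eq]
  rw [← hv, ← one_smul ℝ (WithLp.toLp 2 w : EuclideanSpace ℂ (Fin d)), ← charFun_map_inner, ← hfun,
    hmap, charFun_gaussianReal]
  push_cast
  congr 1
  simp
  ring

lemma star_dotProduct_conj_mulVec (Q M S : Matrix (Fin d) (Fin d) ℂ) (w x : Fin d → ℂ) :
    star w ⬝ᵥ (Q * M * S) *ᵥ x =
      ∑ i, ∑ i', (∑ a, star (w a) * Q a i) * (M i i' * ∑ a, S i' a * x a) := by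
  rw [← Matrix.mulVec_mulVec, ← Matrix.mulVec_mulVec, Matrix.dotProduct_mulVec]
  simp only [dotProduct, Matrix.mulVec, Matrix.vecMul, Pi.star_apply, Finset.mul_sum]

lemma critMatrix_eq_ofReal_mul (s : ℂ) (i j : Fin d) :
    critMatrix d s i j = ((critMatrix d (1 : ℝ) i j : ℝ) : ℂ) * s := by
  simp only [critMatrix, Matrix.of_apply]
  push_cast
  rw [mul_one]

lemma lastEntry_mul_mul (hd : 0 < d) (Q S T : Matrix (Fin d) (Fin d) ℂ) :
    lastEntry hd (Q * S * T) =
      ∑ l, ∑ m, Q (lastIdx hd) l * S l m * T m (lastIdx hd) := by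
  change (Q * S * T) (lastIdx hd) (lastIdx hd) = _
  simp only [Matrix.mul_apply, Finset.sum_mul]
  rw [Finset.sum_comm]

/-- Re x Re y = (Re(x ȳ) + Re(x y))/2 splits the variance into a Hermitian part, which gives the
covariance matrix, and a bilinear part, which gives the relation matrix. -/
lemma critVar_eq (hd : 0 < d) (Q S : Matrix (Fin d) (Fin d) ℂ) (w : Fin d → ℂ) :
    critVar Sig Q (S (lastIdx hd)) (WithLp.toLp 2 w) =
      ((star w ⬝ᵥ (Q * critMatrix d (lastEntry hd (S * Sig.map Complex.ofReal * Sᴴ)) * Qᴴ) *ᵥ w).re +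
      (star w ⬝ᵥ (Q * critMatrix d (lastEntry hd (S * Sig.map Complex.ofReal * Sᵀ)) * Qᵀ) *ᵥ
        star w).re) / 2 := by
  set u : Fin d → ℂ := fun i => ∑ a, star (w a) * Q a i with hu
  have h1 : ∀ i, ∑ a, Qᴴ i a * w a = star (u i) := by
    intro i
    rw [hu, star_sum]
    refine Finset.sum_congr rfl fun a _ => ?_
    simp [Matrix.conjTranspose_apply, mul_comm]
  have h2 : ∀ i, ∑ a, Qᵀ i a * (star w) a = u i := by
    intro i
    rw [hu]
    refine Finset.sum_congr rfl fun a _ => ?_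
    simp [mul_comm]
  have hkey : ∀ x y : ℂ, x.re * y.re = ((x * star y).re + (x * y).re) / 2 := by
    intro x y
    simp
  have hcrit : critVar Sig Q (S (lastIdx hd)) (WithLp.toLp 2 w) =
      ∑ i, ∑ i', critMatrix d (1 : ℝ) i i' *
        ⟪reVec (u i) (S (lastIdx hd)), opOf Sig (reVec (u i') (S (lastIdx hd)))⟫ := rfl
  have e3 : ∀ M : Matrix (Fin d) (Fin d) ℂ, star w ⬝ᵥ (Q * M * Qᴴ) *ᵥ w =
      ∑ i, ∑ i', u i * (M i i' * star (u i')) := by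
    intro M
    rw [star_dotProduct_conj_mulVec]
    simp only [h1, hu]
  have e4 : ∀ M : Matrix (Fin d) (Fin d) ℂ, star w ⬝ᵥ (Q * M * Qᵀ) *ᵥ star w =
      ∑ i, ∑ i', u i * (M i i' * u i') := by
    intro M
    rw [star_dotProduct_conj_mulVec]
    simp only [h2, hu]
  rw [hcrit, e3, e4]
  clear_value u
  simp only [critMatrix_eq_ofReal_mul, lastEntry_mul_mul]
  simp only [Complex.re_sum, ← Finset.sum_add_distrib, Finset.sum_div]
  refine Finset.sum_congr rfl fun i _ => Finset.sum_congr rfl fun i' _ => ?_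
  rw [Matrix.inner_toEuclideanCLM]
  simp only [dotProduct, Matrix.mulVec, Finset.mul_sum, Finset.sum_mul, Complex.re_sum,
    ← Finset.sum_add_distrib, Finset.sum_div]
  refine Finset.sum_congr rfl fun l _ => Finset.sum_congr rfl fun m _ => ?_
  have e1 : critMatrix d (1 : ℝ) i i' * (reVec (u i) (S (lastIdx hd)) l *
      (Sig l m * reVec (u i') (S (lastIdx hd)) m)) = critMatrix d (1 : ℝ) i i' * Sig l m *
      ((u i * S (lastIdx hd) l).re * (u i' * S (lastIdx hd) m).re) := by
    simp only [reVec]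
    ring
  refine e1.trans ?_
  rw [hkey, ← mul_div_assoc, mul_add, ← Complex.re_ofReal_mul, ← Complex.re_ofReal_mul]
  congr 3
  · simp only [Matrix.map_apply, Matrix.conjTranspose_apply, star_mul']
    push_cast
    ring
  · simp only [Matrix.map_apply, Matrix.transpose_apply]
    push_cast
    ring

end ComplexGaussian

/-! ### Descent to real vectors when the Jordan basis is real. -/

section RealJordanBasis

open scoped RealInnerProductSpace

variable {d : ℕ}

lemma map_ofReal_inv (R : Matrix (Fin d) (Fin d) ℝ) :
    (R.map Complex.ofReal)⁻¹ = R⁻¹.map Complex.ofReal := by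
  have hdet : (R.map Complex.ofReal).det = (R.det : ℂ) := (Complex.ofRealHom.map_det R).symm
  by_cases h : IsUnit R.det
  · refine Matrix.inv_eq_right_inv ?_
    have := congrArg Complex.ofRealHom.mapMatrix (Matrix.mul_nonsing_inv R h)
    rw [map_mul, map_one] at this
    exact this
  · rw [Matrix.nonsing_inv_apply_not_isUnit R h, Matrix.nonsing_inv_apply_not_isUnit]
    · ext; simp
    · rw [hdet]
      rw [isUnit_iff_ne_zero, not_not] at h ⊢
      rw [h, Complex.ofReal_zero]

lemma map_ofReal_mul (M N : Matrix (Fin d) (Fin d) ℝ) :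
    (M * N).map Complex.ofReal = M.map Complex.ofReal * N.map Complex.ofReal :=
  map_mul Complex.ofRealHom.mapMatrix M N

lemma conjTranspose_map_ofReal (M : Matrix (Fin d) (Fin d) ℝ) :
    (M.map Complex.ofReal)ᴴ = Mᵀ.map Complex.ofReal := by
  ext; simp

lemma transpose_map_ofReal (M : Matrix (Fin d) (Fin d) ℝ) :
    (M.map Complex.ofReal)ᵀ = Mᵀ.map Complex.ofReal := rfl

lemma critMatrix_map_ofReal (s : ℝ) :
    (critMatrix d s).map Complex.ofReal = critMatrix d (s : ℂ) := by
  ext i j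
  simp only [critMatrix, Matrix.of_apply, Matrix.map_apply]
  push_cast
  rfl

lemma logScale_map_ofReal (R : Matrix (Fin d) (Fin d) ℝ) (n : ℕ) :
    logScale (R.map Complex.ofReal) n = (logScale R n).map Complex.ofReal := by
  rw [logScale, logScale, map_ofReal_mul, map_ofReal_mul, map_ofReal_inv,
    Matrix.diagonal_map Complex.ofReal_zero]
  rfl

lemma transpose_critMatrix (s : ℝ) : (critMatrix d s)ᵀ = critMatrix d s := by
  ext i j
  simp only [Matrix.transpose_apply, critMatrix, Matrix.of_apply]
  ring

/-- The real part of a complex vector. -/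
def rePart (z : EuclideanSpace ℂ (Fin d)) : EuclideanSpace ℝ (Fin d) :=
  WithLp.toLp 2 fun i => (z i).re

lemma rePart_complexify (x : EuclideanSpace ℝ (Fin d)) : rePart (complexify x) = x := by
  ext i; simp [rePart, complexify]

lemma continuous_rePart : Continuous (rePart (d := d)) := by
  unfold rePart
  fun_prop

lemma inner_rePart (z : EuclideanSpace ℂ (Fin d)) (t : EuclideanSpace ℝ (Fin d)) :
    ⟪rePart z, t⟫ = ⟪z, complexify t⟫ := by
  rw [real_inner_comm _ z, real_inner_eq, PiLp.inner_apply, Complex.re_sum]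
  refine Finset.sum_congr rfl fun i _ => ?_
  simp [rePart, complexify]

lemma dotProduct_map_ofReal_mulVec (S : Matrix (Fin d) (Fin d) ℝ)
    (t : EuclideanSpace ℝ (Fin d)) :
    star (complexify t).ofLp ⬝ᵥ S.map Complex.ofReal *ᵥ (complexify t).ofLp =
      (quadForm S t : ℂ) := by
  rw [quadForm_eq_sum]
  simp only [dotProduct, Matrix.mulVec, complexify, Finset.mul_sum, Pi.star_apply, Matrix.map_apply]
  push_cast
  refine Finset.sum_congr rfl fun i _ => Finset.sum_congr rfl fun j _ => ?_
  simp
  ring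

lemma star_complexify (t : EuclideanSpace ℝ (Fin d)) :
    star (complexify t).ofLp = (complexify t).ofLp := by
  funext i; simp [complexify]

lemma IsComplexGaussian.charFun_complexify {ν : Measure (EuclideanSpace ℂ (Fin d))}
    {S : Matrix (Fin d) (Fin d) ℝ}
    (h : IsComplexGaussian ν (S.map Complex.ofReal) (S.map Complex.ofReal))
    (t : EuclideanSpace ℝ (Fin d)) :
    charFun ν (complexify t) = (Real.exp (-quadForm S t / 2) : ℂ) := by
  have h1 := h.charFun_eq (complexify t).ofLp
  have e := dotProduct_map_ofReal_mulVec S t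
  rw [star_complexify] at h1 e
  rw [e, Complex.ofReal_re, add_self_div_two] at h1
  exact h1

lemma IsComplexGaussian.quadForm_nonneg {ν : Measure (EuclideanSpace ℂ (Fin d))}
    {S : Matrix (Fin d) (Fin d) ℝ}
    (h : IsComplexGaussian ν (S.map Complex.ofReal) (S.map Complex.ofReal))
    (t : EuclideanSpace ℝ (Fin d)) : 0 ≤ quadForm S t := by
  obtain ⟨v, hv, -⟩ := h (complexify t).ofLp
  have e := dotProduct_map_ofReal_mulVec S t
  rw [star_complexify] at hv e
  rw [e, Complex.ofReal_re, add_self_div_two] at hv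
  rw [← hv]
  exact v.2

/-- The law of the real part is determined by the characteristic function at real vectors, where the
covariance and relation forms coincide and their half-sum is the form of S. -/
lemma IsComplexGaussian.map_rePart {ν : Measure (EuclideanSpace ℂ (Fin d))} [IsProbabilityMeasure ν]
    {S : Matrix (Fin d) (Fin d) ℝ} (hS : S.PosSemidef)
    (h : IsComplexGaussian ν (S.map Complex.ofReal) (S.map Complex.ofReal)) :
    ν.map rePart = multivariateGaussian 0 S := by
  have hm : AEMeasurable (rePart (d := d)) ν := continuous_rePart.measurable.aemeasurable
  have := Measure.isProbabilityMeasure_map hm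
  refine Measure.ext_of_charFun ?_
  funext t
  rw [charFun_multivariateGaussian_zero hS, ← h.charFun_complexify, charFun_apply, charFun_apply,
    integral_map hm (by fun_prop)]
  simp only [inner_rePart]

end RealJordanBasis

/-! ### The critical case, for complex and for real Q. -/

section Critical

variable {Ω : Type*} [mΩ : MeasurableSpace Ω] {d : ℕ} {X : ℕ → Ω → EuclideanSpace ℝ (Fin d)}
  {P : Measure Ω} [IsProbabilityMeasure P] {A Sig : Matrix (Fin d) (Fin d) ℝ}

theorem IsLinearRWSD.critical (hX : IsLinearRWSD P X A Sig) (hd : 0 < d) {lam : ℂ}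
    {Q : Matrix (Fin d) (Fin d) ℂ} (hlam : lam.re = 1 / 2) (hQ : IsUnit Q.det)
    (hAQ : A.map Complex.ofReal = Q * (lam • 1 + superdiag d) * Q⁻¹) :
    ∃ (ν : Measure (EuclideanSpace ℂ (Fin d))) (_ : IsProbabilityMeasure ν),
      IsComplexGaussian ν
        (Q * critMatrix d (lastEntry hd (Q⁻¹ * Sig.map Complex.ofReal * (Q⁻¹)ᴴ)) * Qᴴ)
        (Q * critMatrix d (lastEntry hd (Q⁻¹ * Sig.map Complex.ofReal * (Q⁻¹)ᵀ)) * Qᵀ) ∧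
      ConvergesInLaw P (fun n ω => act ((logScale Q n)⁻¹ * (matPow n (-A)).map Complex.ofReal)
        (complexify (walk X n ω))) ν := by
  rw [eq_half_of_conj_jordan hd hlam hQ hAQ] at hAQ
  have hS := hX.posDef.posSemidef
  obtain ⟨ν, hprob, hν⟩ := exists_charFun_eq_exp_critVar hd hS Q (Q⁻¹ (lastIdx hd))
  exact ⟨ν, hprob, isComplexGaussian_of_charFun hν (critVar_nonneg hd hS Q _) (critVar_smul Q _)
    (critVar_eq hd Q Q⁻¹), hX.critical_convergesInLaw hd hQ hAQ ν hν⟩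

/-- For real R every complex datum is the image of a real one, and the continuous map `rePart`
undoes `complexify`, so the complex limit descends by continuous mapping. Positivity holds because
the form of S is a variance of the complex law. -/
lemma critical_real_of_complex (hd : 0 < d) {ν : Measure (EuclideanSpace ℂ (Fin d))}
    [IsProbabilityMeasure ν] {R : Matrix (Fin d) (Fin d) ℝ}
    (hν : IsComplexGaussian ν
      (R.map Complex.ofReal * critMatrix d (lastEntry hd ((R.map Complex.ofReal)⁻¹ *
        Sig.map Complex.ofReal * ((R.map Complex.ofReal)⁻¹)ᴴ)) * (R.map Complex.ofReal)ᴴ)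
      (R.map Complex.ofReal * critMatrix d (lastEntry hd ((R.map Complex.ofReal)⁻¹ *
        Sig.map Complex.ofReal * ((R.map Complex.ofReal)⁻¹)ᵀ)) * (R.map Complex.ofReal)ᵀ))
    (hlaw : ConvergesInLaw P (fun n ω => act ((logScale (R.map Complex.ofReal) n)⁻¹ *
      (matPow n (-A)).map Complex.ofReal) (complexify (walk X n ω))) ν) :
    (R * critMatrix d (lastEntry hd (R⁻¹ * Sig * (R⁻¹)ᵀ)) * Rᵀ).PosSemidef ∧
      ConvergesInLaw P (fun n ω => act ((logScale R n)⁻¹ * matPow n (-A)) (walk X n ω))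
        (multivariateGaussian 0
          (R * critMatrix d (lastEntry hd (R⁻¹ * Sig * (R⁻¹)ᵀ)) * Rᵀ)) := by
  set S := R * critMatrix d (lastEntry hd (R⁻¹ * Sig * (R⁻¹)ᵀ)) * Rᵀ with hS
  have hlast : ∀ M : Matrix (Fin d) (Fin d) ℝ,
      lastEntry hd (M.map Complex.ofReal) = ((lastEntry hd M : ℝ) : ℂ) := fun M => rfl
  simp only [map_ofReal_inv, conjTranspose_map_ofReal, transpose_map_ofReal, ← map_ofReal_mul,
    hlast, ← critMatrix_map_ofReal, ← hS] at hν
  have hpsd : S.PosSemidef := by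
    refine posSemidef_of_quadForm_nonneg ?_ hν.quadForm_nonneg
    rw [hS, Matrix.transpose_mul, Matrix.transpose_mul, Matrix.transpose_transpose,
      transpose_critMatrix, ← mul_assoc]
  refine ⟨hpsd, ?_⟩
  have h1 : TendstoInDistribution _ atTop (rePart ∘ id) (fun _ => P) ν :=
    TendstoInDistribution.continuous_comp continuous_rePart hlaw
  have e : (fun (n : ℕ) => rePart ∘ fun ω => act ((logScale (R.map Complex.ofReal) n)⁻¹ *
      (matPow n (-A)).map Complex.ofReal) (complexify (walk X n ω))) =
      fun n ω => act ((logScale R n)⁻¹ * matPow n (-A)) (walk X n ω) := by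
    funext n ω
    rw [Function.comp_apply, logScale_map_ofReal, map_ofReal_inv, ← map_ofReal_mul, ← complexify_act,
      rePart_complexify]
  rw [e] at h1
  refine ⟨h1.1, aemeasurable_id, ?_⟩
  have h2 : Measure.map id (multivariateGaussian 0 S) = Measure.map (rePart ∘ id) ν := by
    rw [Measure.map_id, Function.comp_id, hν.map_rePart hpsd]
  convert h1.3 using 2
  exact congrArg 𝓝 (Subtype.ext h2)

end Critical

end

end RWSD

theorem theorem2 {Ω : Type*} [MeasurableSpace Ω] (P : Measure Ω) [IsProbabilityMeasure P]
    (d : ℕ) (hd : 0 < d) (X : ℕ → Ω → EuclideanSpace ℝ (Fin d))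
    (A Sig : Matrix (Fin d) (Fin d) ℝ) (hX : RWSD.IsLinearRWSD P X A Sig) :
    -- (a) subcritical case
    (RWSD.lambdaMax A < 1 / 2 →
      ∃ Xi : Matrix (Fin d) (Fin d) ℝ,
        RWSD.IsLyapunovSolution A Sig Xi ∧
        (∀ Xi', RWSD.IsLyapunovSolution A Sig Xi' → Xi' = Xi) ∧
        Xi.PosSemidef ∧
        RWSD.ConvergesInLaw P (fun n ω => (1 / √(n : ℝ)) • RWSD.walk X n ω)
          (multivariateGaussian 0 Xi)) ∧
    -- (b) supercritical case
    (1 / 2 < RWSD.lambdaMin A →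
      ∃ Xi : Matrix (Fin d) (Fin d) ℝ,
        RWSD.IsLyapunovSolution A Sig Xi ∧
        (∀ Xi', RWSD.IsLyapunovSolution A Sig Xi' → Xi' = Xi) ∧
        (-Xi).PosSemidef ∧
        ∃ W : Ω → EuclideanSpace ℝ (Fin d),
          Measurable W ∧ MemLp W 2 P ∧ RWSD.Nondegenerate P W ∧
          (∀ᵐ ω ∂P, Tendsto (fun n : ℕ => RWSD.act (RWSD.matPow n (-A)) (RWSD.walk X n ω))
            atTop (𝓝 (W ω))) ∧
          Tendsto (fun n : ℕ => eLpNorm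
            (fun ω => RWSD.act (RWSD.matPow n (-A)) (RWSD.walk X n ω) - W ω) 2 P)
            atTop (𝓝 0) ∧
          RWSD.ConvergesInLaw P
            (fun n ω => (1 / √(n : ℝ)) •
              (RWSD.walk X n ω - RWSD.act (RWSD.matPow n A) (W ω)))
            (multivariateGaussian 0 (-Xi))) ∧
    -- (c) critical case, one Jordan block
    (∀ (lam : ℂ) (Q : Matrix (Fin d) (Fin d) ℂ), lam.re = 1 / 2 → IsUnit Q.det →
      A.map Complex.ofReal = Q * (lam • 1 + RWSD.superdiag d) * Q⁻¹ →
      (∃ (ν : Measure (EuclideanSpace ℂ (Fin d))) (_ : IsProbabilityMeasure ν),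
        RWSD.IsComplexGaussian ν
          (Q * RWSD.critMatrix d
            (RWSD.lastEntry hd (Q⁻¹ * Sig.map Complex.ofReal * (Q⁻¹)ᴴ)) * Qᴴ)
          (Q * RWSD.critMatrix d
            (RWSD.lastEntry hd (Q⁻¹ * Sig.map Complex.ofReal * (Q⁻¹)ᵀ)) * Qᵀ) ∧
        RWSD.ConvergesInLaw P
          (fun n ω => RWSD.act ((RWSD.logScale Q n)⁻¹ * (RWSD.matPow n (-A)).map Complex.ofReal)
            (RWSD.complexify (RWSD.walk X n ω))) ν) ∧
      -- for a real matrix `Q` the limit is the usual Gaussian law on `ℝ^d`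
      (∀ R : Matrix (Fin d) (Fin d) ℝ, Q = R.map Complex.ofReal →
        (R * RWSD.critMatrix d (RWSD.lastEntry hd (R⁻¹ * Sig * (R⁻¹)ᵀ)) * Rᵀ).PosSemidef ∧
        RWSD.ConvergesInLaw P
          (fun n ω => RWSD.act ((RWSD.logScale R n)⁻¹ * RWSD.matPow n (-A)) (RWSD.walk X n ω))
          (multivariateGaussian 0
            (R * RWSD.critMatrix d (RWSD.lastEntry hd (R⁻¹ * Sig * (R⁻¹)ᵀ)) * Rᵀ)))) := by
  refine ⟨hX.subcritical hd, hX.supercritical hd, fun lam Q hlam hQ hAQ => ?_⟩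
  obtain ⟨ν, hprob, hν, hlaw⟩ := hX.critical hd hlam hQ hAQ
  refine ⟨⟨ν, hprob, hν, hlaw⟩, fun R hR => ?_⟩
  subst hR
  exact RWSD.critical_real_of_complex hd hν hlaw
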